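/- Let $n,N,k\ge 1$ be integers. An $N$-function is an increasing, continuous, convex function $\varphi:[0,\infty)\to[0,\infty)$ with $\varphi(t)=0$ if and only if $t=0$, $\lim_{t\to0}\varphi(t)/t=0$ and $\lim_{t\to\infty}\varphi(t)/t=\infty$; its conjugate is $\varphi^*(s)=\sup_{t>0}(ts-\varphi(t))$. We write $\varphi\in\Delta_2$ if there is $C\ge1$ with $\varphi(2t)\le C\varphi(t)$ for all $t\ge0$, the least such $C$ being $\Delta_2(\varphi)$, and $\varphi\in\nabla_2$ if $\varphi^*\in\Delta_2$, with $\nabla_2(\varphi)=\Delta_2(\varphi^*)$. For a function $u$ with values in $\mathbb R^N$, $\nabla^j u=(D^\alpha u)_{|\alpha|=j}$ denotes the weak gradient of order $j$, with $|\nabla^j u|^2=\sum_{|\alpha|=j}|D^\alpha u|^2$. For $\Omega\subset\mathbb R^n$ open and bounded, $W^{k,\varphi}(\Omega,\mathbb R^N)$ is the space of $k$ times weakly differentiable $u\in L^1_{\rm loc}(\Omega,\mathbb R^N)$ with $\int_\Omega\varphi(|\nabla^j u|)\,dx<\infty$ for $0\le j\le k$, normed by $\sum_{j=0}^k\|\nabla^j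 u\|_{L^\varphi(\Omega)}$, where $\|f\|_{L^\varphi(\Omega)}=\inf\{s>0:\int_\Omega\varphi(|f|/s)\,dx\le1\}$; $W^{k,\varphi}_0(\Omega,\mathbb R^N)$ is the closure of $C^\infty_c(\Omega,\mathbb R^N)$ in it; and $W^{k,\infty}_0(\Omega,\mathbb R^N)=W^{k,\infty}(\Omega,\mathbb R^N)\cap W^{k,1}_0(\Omega,\mathbb R^N)$, where $W^{k,1}_0$ is the closure of $C_c^\infty$ in $W^{k,1}$. **Proposition (higher-order Lipschitz truncation).** There are a constant $C_1=C_1(n,N,k)$ and, for every $N$-function $\varphi\in\Delta_2\cap\nabla_2$, a constant $C_2=C_2(n,N,k,\Delta_2(\varphi),\nabla_2(\varphi))$ such that the following holds. Let $\varphi\in\Delta_2\cap\nabla_2$ be an $N$-function, let $B_R(x_0)\subset\mathbb R^n$ be an open ball, $R>0$, and let $q\in W^{k,\varphi}_0(B_R(x_0),\mathbb R^N)$. Then for each $\lambda>0$ there exists $q_\lambda\in W^{k,\infty}_0(B_R(x_0),\mathbb R^N)$ such that \begin{align*} \|\nabla^k q_\lambda\|_{L^\infty(B_R(x_0))}&\le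 C_1\lambda,\\ \int_{B_R(x_0)}\varphi(|\nabla^k q_\lambda|)\,dx&\le C_2\int_{B_R(x_0)}\varphi(|\nabla^k q|)\,dx,\\ \varphi(\lambda)\,\mathcal L^n\big(\{x\in B_R(x_0):q(x)\ne q_\lambda(x)\}\big)&\le C_2\int_{B_R(x_0)}\varphi(|\nabla^k q|)\,dx. \end{align*} -/

import Mathlib

open MeasureTheory Filter Topology Set
open scoped ENNReal ContDiff

noncomputable section

namespace LipTrunc

/-! ### N-functions -/

/-- `φ : [0,∞) → [0,∞)` is an N-function; only the values of `φ` on `[0,∞)` matter. -/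
structure IsNFunction (φ : ℝ → ℝ) : Prop where
  nonneg : ∀ t, 0 ≤ t → 0 ≤ φ t
  monotoneOn : MonotoneOn φ (Ici 0)
  continuousOn : ContinuousOn φ (Ici 0)
  convexOn : ConvexOn ℝ (Ici 0) φ
  eq_zero_iff : ∀ t, 0 ≤ t → (φ t = 0 ↔ t = 0)
  tendsto_zero : Tendsto (fun t => φ t / t) (𝓝[>] 0) (𝓝 0)
  tendsto_atTop : Tendsto (fun t => φ t / t) atTop atTop

/-- The conjugate function `φ*(s) = sup_{t > 0} (t s - φ(t))`. For an N-function and `s ≥ 0` the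
set is bounded above. -/
def conjugate (φ : ℝ → ℝ) (s : ℝ) : ℝ :=
  sSup ((fun t => t * s - φ t) '' Ioi 0)

/-- The admissible constants in the doubling condition. -/
def doublingConsts (φ : ℝ → ℝ) : Set ℝ :=
  {C | 1 ≤ C ∧ ∀ t, 0 ≤ t → φ (2 * t) ≤ C * φ t}

/-- The `Δ₂`-condition. -/
def Delta2 (φ : ℝ → ℝ) : Prop := (doublingConsts φ).Nonempty

/-- The least doubling constant `Δ₂(φ)`. -/
def delta2Const (φ : ℝ → ℝ) : ℝ := sInf (doublingConsts φ)

/-- The `∇₂`-condition. -/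
def Nabla2 (φ : ℝ → ℝ) : Prop := Delta2 (conjugate φ)

/-- `∇₂(φ) = Δ₂(φ*)`. -/
def nabla2Const (φ : ℝ → ℝ) : ℝ := delta2Const (conjugate φ)

/-! ### Weak derivatives -/

/-- `ℝⁿ` with its Euclidean norm. -/
abbrev Eucl (n : ℕ) : Type := EuclideanSpace ℝ (Fin n)

/-- The multi-indices `α ∈ ℕⁿ` with `|α| = j`. -/
abbrev MultiIndex (n j : ℕ) : Type :=
  ↥(Finset.piAntidiag (Finset.univ : Finset (Fin n)) j)

/-- The space of symmetric `j`-linear maps `(ℝⁿ)ʲ → ℝᴺ`, a map `z` being represented by its values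
`z(e^α)`, `|α| = j`, with the norm of the inner product `z : w = ∑_{|α| = j} z(e^α) · w(e^α)`. -/
abbrev SymTensor (n N j : ℕ) : Type :=
  PiLp 2 (fun _ : MultiIndex n j => Eucl N)

/-- The partial derivative `∂ᵢ f`. -/
def partialDeriv {n : ℕ} (i : Fin n) (f : Eucl n → ℝ) : Eucl n → ℝ :=
  fun x => fderiv ℝ f x (EuclideanSpace.single i 1)

/-- The classical derivative `D^α f = ∂₀^{α₀} ⋯ ∂ₙ₋₁^{αₙ₋₁} f` (used for smooth `f`). -/
def multiDeriv {n : ℕ} (α : Fin n → ℕ) (f : Eucl n → ℝ) : Eucl n → ℝ :=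
  (List.finRange n).foldr (fun i g => (partialDeriv i)^[α i] g) f

/-- `C_c^∞(Ω, F)`. -/
def IsTestFunction {n : ℕ} {F : Type*} [NormedAddCommGroup F] [NormedSpace ℝ F]
    (Ω : Set (Eucl n)) (η : Eucl n → F) : Prop :=
  ContDiff ℝ ∞ η ∧ HasCompactSupport η ∧ tsupport η ⊆ Ω

/-- `v` is the weak derivative `D^α u` on the open set `Ω`. -/
def HasWeakDeriv {n N : ℕ} (Ω : Set (Eucl n)) (α : Fin n → ℕ) (u v : Eucl n → Eucl N) : Prop :=
  LocallyIntegrableOn u Ω ∧ LocallyIntegrableOn v Ω ∧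
    ∀ η : Eucl n → ℝ, IsTestFunction Ω η →
      ∫ x in Ω, multiDeriv α η x • u x = (-1 : ℝ) ^ (∑ i, α i) • ∫ x in Ω, η x • v x

/-- `V` is the weak `j`-th order gradient `∇ʲu` on `Ω`, that is `V(x)(e^α) = D^α u(x)`. -/
def HasWeakGrad {n N : ℕ} (Ω : Set (Eucl n)) (j : ℕ) (u : Eucl n → Eucl N)
    (V : Eucl n → SymTensor n N j) : Prop :=
  ∀ α : MultiIndex n j, HasWeakDeriv Ω α.1 u (fun x => V x α)

/-- `u` has a weak gradient of order `j` on `Ω`. -/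
def HasWeakGradOfOrder {n N : ℕ} (Ω : Set (Eucl n)) (j : ℕ) (u : Eucl n → Eucl N) : Prop :=
  ∃ V : Eucl n → SymTensor n N j, HasWeakGrad Ω j u V

open Classical in
/-- The weak gradient `∇ʲu` on `Ω`, unique almost everywhere on `Ω` if it exists (and `0`
otherwise). -/
def weakGrad {n N : ℕ} (Ω : Set (Eucl n)) (j : ℕ) (u : Eucl n → Eucl N) :
    Eucl n → SymTensor n N j :=
  if h : HasWeakGradOfOrder Ω j u then h.choose else 0

/-! ### Orlicz and Orlicz–Sobolev spaces -/

/-- The modular `∫_Ω φ(|f|) dx`, as an extended non-negative number. -/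
def modular {n : ℕ} {F : Type*} [NormedAddCommGroup F]
    (φ : ℝ → ℝ) (Ω : Set (Eucl n)) (f : Eucl n → F) : ℝ≥0∞ :=
  ∫⁻ x in Ω, ENNReal.ofReal (φ ‖f x‖)

/-- The Orlicz space `L^φ(Ω, F)`. -/
def MemOrlicz {n : ℕ} {F : Type*} [NormedAddCommGroup F]
    (φ : ℝ → ℝ) (Ω : Set (Eucl n)) (f : Eucl n → F) : Prop :=
  LocallyIntegrableOn f Ω ∧ modular φ Ω f < ⊤

/-- The Luxemburg norm `inf {s > 0 : ∫_Ω φ(|f| / s) dx ≤ 1}`. -/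
def luxemburgNorm {n : ℕ} {F : Type*} [NormedAddCommGroup F]
    (φ : ℝ → ℝ) (Ω : Set (Eucl n)) (f : Eucl n → F) : ℝ≥0∞ :=
  ⨅ (s : ℝ) (_ : 0 < s) (_ : modular φ Ω (fun x => ‖f x‖ / s) ≤ 1), ENNReal.ofReal s

/-- `u ∈ W^{k,φ}(Ω, ℝᴺ)`. -/
def MemOrliczSobolev {n N : ℕ} (φ : ℝ → ℝ) (Ω : Set (Eucl n)) (k : ℕ)
    (u : Eucl n → Eucl N) : Prop :=
  ∀ j, j ≤ k → HasWeakGradOfOrder Ω j u ∧ MemOrlicz φ Ω (weakGrad Ω j u)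

/-- The norm of `W^{k,φ}(Ω, ℝᴺ)`. -/
def orliczSobolevNorm {n N : ℕ} (φ : ℝ → ℝ) (Ω : Set (Eucl n)) (k : ℕ)
    (u : Eucl n → Eucl N) : ℝ≥0∞ :=
  ∑ j ∈ Finset.range (k + 1), luxemburgNorm φ Ω (weakGrad Ω j u)

/-- `u ∈ W^{k,φ}_0(Ω, ℝᴺ)`, the closure of `C_c^∞(Ω, ℝᴺ)` in `W^{k,φ}(Ω, ℝᴺ)`. -/
def MemOrliczSobolevZero {n N : ℕ} (φ : ℝ → ℝ) (Ω : Set (Eucl n)) (k : ℕ)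
    (u : Eucl n → Eucl N) : Prop :=
  MemOrliczSobolev φ Ω k u ∧
    ∀ ε : ℝ≥0∞, 0 < ε → ∃ ψ : Eucl n → Eucl N, IsTestFunction Ω ψ ∧
      orliczSobolevNorm φ Ω k (u - ψ) < ε

/-! ### The spaces `W^{k,p}` -/

/-- `u ∈ W^{k,p}(Ω, ℝᴺ)`, `1 ≤ p ≤ ∞`. -/
def MemSobolev {n N : ℕ} (p : ℝ≥0∞) (Ω : Set (Eucl n)) (k : ℕ)
    (u : Eucl n → Eucl N) : Prop :=
  ∀ j, j ≤ k → HasWeakGradOfOrder Ω j u ∧ MemLp (weakGrad Ω j u) p (volume.restrict Ω)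

/-- The norm of `W^{k,p}(Ω, ℝᴺ)`. -/
def sobolevNorm {n N : ℕ} (p : ℝ≥0∞) (Ω : Set (Eucl n)) (k : ℕ)
    (u : Eucl n → Eucl N) : ℝ≥0∞ :=
  ∑ j ∈ Finset.range (k + 1), eLpNorm (weakGrad Ω j u) p (volume.restrict Ω)

/-- `u ∈ W^{k,1}_0(Ω, ℝᴺ)`, the closure of `C_c^∞(Ω, ℝᴺ)` in `W^{k,1}(Ω, ℝᴺ)`. -/
def MemSobolevOneZero {n N : ℕ} (Ω : Set (Eucl n)) (k : ℕ) (u : Eucl n → Eucl N) : Prop :=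
  MemSobolev 1 Ω k u ∧
    ∀ ε : ℝ≥0∞, 0 < ε → ∃ ψ : Eucl n → Eucl N, IsTestFunction Ω ψ ∧
      sobolevNorm 1 Ω k (u - ψ) < ε

/-- `u ∈ W^{k,∞}_0(Ω, ℝᴺ) = W^{k,∞}(Ω, ℝᴺ) ∩ W^{k,1}_0(Ω, ℝᴺ)`, for bounded `Ω`. -/
def MemSobolevInftyZero {n N : ℕ} (Ω : Set (Eucl n)) (k : ℕ) (u : Eucl n → Eucl N) : Prop :=
  MemSobolev ⊤ Ω k u ∧ MemSobolevOneZero Ω k u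

end LipTrunc

end

/-! Smooth case. Let `u` be a test function on the ball and `F` the set where all averages of
`|Dᵏu|` over centred balls are at most `l` (`goodSet`). Replace `u` by a smoothing at the variable
scale `r(x)`, a regularised distance to `F` that vanishes near `F`. At each scale `u(x)` is
extrapolated from `k` points on a ray leaving `x`, averaged over rays (`smoothing`). Three features
make this work. The extrapolation reproduces every function whose `k`-th derivative vanishes, so the
Taylor polynomial of `u` at a nearby point `w` of `F` may be subtracted. The rays drift away from
`x₀`, so zero boundary values survive. Where `r` vanishes nothing changes, so `u` and `Dᵏu` are kept
on `F`. After the subtraction, Taylor's formula along segments issuing from `w` and Fubini bound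
`Dᵏ` of the smoothing by averages of `|Dᵏu|` over balls comparable to balls centred at `w`; these
are of order `l` because `w ∈ F`. This is `exists_smooth_truncation`.

Size of the bad set. Off `F` some ball has average larger than `l`; Jensen's inequality and the
Vitali covering lemma give `φ(l) |Fᶜ| ≤ 5ⁿ ∫ φ(|Dᵏu|)` (`ofReal_mul_volume_goodSet_compl_le`).

General `q`. Averages and smoothing are applied to test functions only. Choose test functions `ψₘ →
q` with very small modular errors, truncate the increments `ψₘ - ψₘ₋₁` at the levels `l 2⁻ᵐ`, and
add up. The truncations have geometrically decaying `k`-th derivatives, so by the Poincaré bound for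
test functions the sum is `Cᵏ`, lies in `W^{k,∞}_0`, and has `k`-th derivative of order `l`.
Lowering the level to `l 2⁻ᵐ` costs `Δ₂(φ)ᵐ` in the weak-type estimate, which the choice of the
errors compensates. Off the union of the bad sets the series telescopes to `q`, and its derivatives
to the weak gradient of `q` (`exists_truncation_with_error`).

Conclusion. The remaining error is absorbed into the modular of `∇ᵏq` when that is positive; when it
is zero, `q = 0` almost everywhere. The modular of `∇ᵏq_λ` is split at the exceptional set: off it
the two gradients agree, and on it `φ(C₁ l)` times its measure is controlled by the weak-type bound.
-/

noncomputable section

namespace LipTrunc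

/-! ### Calculus of smooth maps between normed spaces -/

section Calculus

variable {E : Type} [NormedAddCommGroup E] [NormedSpace ℝ E]
  {G : Type} [NormedAddCommGroup G] [NormedSpace ℝ G]

/-! ### Iterated directional derivatives -/

/-- The iterated directional derivative along a list of directions. -/
def listDeriv (L : List E) (f : E → G) : E → G :=
  L.foldr (fun v g x => fderiv ℝ g x v) f

@[simp] lemma listDeriv_nil (f : E → G) : listDeriv [] f = f := rfl

lemma listDeriv_cons (v : E) (L : List E) (f : E → G) :
    listDeriv (v :: L) f = fun x => fderiv ℝ (listDeriv L f) x v := rfl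

lemma listDeriv_append (L L' : List E) (f : E → G) :
    listDeriv (L ++ L') f = listDeriv L (listDeriv L' f) := by
  simp [listDeriv, List.foldr_append]

lemma ContDiff.fderiv_dir {m : ℕ} {f : E → G} (hf : ContDiff ℝ (m + 1 : ℕ) f) (v : E) :
    ContDiff ℝ m (fun x => fderiv ℝ f x v) := by
  have : ContDiff ℝ m (fderiv ℝ f) := hf.fderiv_right (by norm_cast)
  exact this.clm_apply contDiff_const

lemma contDiff_listDeriv (L : List E) : ∀ {m : ℕ} {f : E → G},
    ContDiff ℝ (m + L.length : ℕ) f → ContDiff ℝ m (listDeriv L f) := by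
  induction L with
  | nil => intro m f hf; simpa using hf
  | cons v L ih =>
    intro m f hf
    rw [listDeriv_cons]
    refine ContDiff.fderiv_dir (ih ?_) v
    convert hf using 2
    simp; ring

lemma fderiv_dir_comm {f : E → G} (hf : ContDiff ℝ 2 f) (v w x : E) :
    fderiv ℝ (fun y => fderiv ℝ f y v) x w = fderiv ℝ (fun y => fderiv ℝ f y w) x v := by
  have hd : DifferentiableAt ℝ (fderiv ℝ f) x :=
    (hf.fderiv_right (m := 1) (by norm_num)).differentiable (by norm_num) x
  have h1 : ∀ u, fderiv ℝ (fun y => fderiv ℝ f y u) x = (fderiv ℝ (fderiv ℝ f) x).flip u := by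
    intro u
    rw [fderiv_clm_apply hd (by fun_prop)]
    simp
  rw [h1, h1]
  have := (hf.contDiffAt (x := x)).isSymmSndFDerivAt (by simp)
  exact this.eq w v

/-- Adjacent swaps generate all permutations, and a swap is the symmetry of the second derivative.
This is what lets multi-indices, which forget the order, describe iterated derivatives. -/
lemma listDeriv_perm {L L' : List E} (h : L.Perm L') : ∀ {f : E → G},
    ContDiff ℝ (L.length : ℕ) f → listDeriv L f = listDeriv L' f := by
  induction h with
  | nil => intro f _; rfl
  | cons v h ih =>
    intro f hf
    rw [listDeriv_cons, listDeriv_cons, ih (hf.of_le (by simp))]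
  | swap v w L =>
    intro f hf
    simp only [listDeriv_cons]
    funext x
    refine fderiv_dir_comm ?_ _ _ _
    exact contDiff_listDeriv L (m := 2) (by convert hf using 2; simp; ring)
  | trans h₁ h₂ ih₁ ih₂ =>
    intro f hf
    rw [ih₁ hf, ih₂ (by rwa [← h₁.length_eq])]

lemma iteratedFDeriv_apply_eq_listDeriv : ∀ {j : ℕ} {f : E → G}, ContDiff ℝ j f →
    ∀ (x : E) (v : Fin j → E), iteratedFDeriv ℝ j f x v = listDeriv (List.ofFn v) f x := by
  intro j
  induction j with
  | zero => intro f _ x v; simp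
  | succ j ih =>
    intro f hf x v
    rw [List.ofFn_succ, listDeriv_cons, iteratedFDeriv_succ_apply_left]
    have h1 : (listDeriv (List.ofFn fun i => v i.succ) f) =
        fun y => iteratedFDeriv ℝ j f y (fun i => v i.succ) := by
      funext y
      rw [ih (hf.of_le (by norm_cast; omega))]
    rw [h1]
    have hd : DifferentiableAt ℝ (iteratedFDeriv ℝ j f) x :=
      hf.differentiable_iteratedFDeriv (by norm_cast; omega) x
    have := (hd.hasFDerivAt.continuousMultilinear_apply_const (fun i => v i.succ)).fderiv
    exact (congrArg (fun T : E →L[ℝ] G => T (v 0)) this).symm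

lemma iteratedFDeriv_comp_perm_of_contDiff {j : ℕ} {f : E → G} (hf : ContDiff ℝ j f) (x : E)
    (v : Fin j → E) (σ : Equiv.Perm (Fin j)) :
    iteratedFDeriv ℝ j f x (fun i => v (σ i)) = iteratedFDeriv ℝ j f x v := by
  rw [iteratedFDeriv_apply_eq_listDeriv hf, iteratedFDeriv_apply_eq_listDeriv hf]
  refine congrFun (listDeriv_perm ?_ (by simpa using hf)) x
  exact Equiv.Perm.ofFn_comp_perm σ v

/-! ### Derivatives of parametric integrals -/

section Parametric

variable {Y : Type} [NormedAddCommGroup Y]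

lemma contDiff_partial_fderiv [NormedSpace ℝ Y] {F : E → Y → G}
    (hF : ContDiff ℝ ∞ (Function.uncurry F)) :
    ContDiff ℝ ∞ (Function.uncurry fun x y => fderiv ℝ (fun x' => F x' y) x) := by
  have h : ContDiff ℝ ∞
      (Function.uncurry (fun (q : E × Y) (x' : E) => F x' q.2)) :=
    hF.comp (f := fun z : (E × Y) × E => (z.2, z.1.2)) (by fun_prop)
  exact h.fderiv (n := ∞) contDiff_fst (by simp)

variable [MeasurableSpace Y] [OpensMeasurableSpace Y]

lemma integrable_of_continuous_of_ae_mem_compact {G : Type} [NormedAddCommGroup G] {μ : Measure Y}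
    [IsFiniteMeasure μ] {K : Set Y} (hK : IsCompact K) (hμ : ∀ᵐ y ∂μ, y ∈ K) {g : Y → G}
    (hg : Continuous g) : Integrable g μ := by
  have := hg.continuousOn.integrableOn_compact (μ := μ) hK
  rwa [IntegrableOn, Measure.restrict_eq_self_of_ae_mem hμ] at this

variable [NormedSpace ℝ Y] [SecondCountableTopology Y]

lemma hasFDerivAt_parametric_integral [ProperSpace E] {μ : Measure Y} [IsFiniteMeasure μ]
    {K : Set Y} (hK : IsCompact K) (hμ : ∀ᵐ y ∂μ, y ∈ K) {F : E → Y → G}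
    (hF : ContDiff ℝ ∞ (Function.uncurry F)) (x : E) :
    HasFDerivAt (fun x => ∫ y, F x y ∂μ) (∫ y, fderiv ℝ (fun x' => F x' y) x ∂μ) x := by
  have hF' := contDiff_partial_fderiv hF
  obtain ⟨B, hB⟩ := ((isCompact_closedBall x 1).prod hK).exists_bound_of_continuousOn
    hF'.continuous.continuousOn
  have hslice : ∀ x, Continuous (F x) := fun x =>
    hF.continuous.comp (f := fun y => (x, y)) (by fun_prop)
  refine hasFDerivAt_integral_of_dominated_of_fderiv_le (bound := fun _ => B)
    (F' := fun x y => fderiv ℝ (fun x' => F x' y) x)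
    (Metric.closedBall_mem_nhds x one_pos) ?_ ?_ ?_ ?_ ?_ ?_
  · exact Eventually.of_forall fun x => (hslice x).aestronglyMeasurable
  · exact integrable_of_continuous_of_ae_mem_compact hK hμ (hslice x)
  · exact (hF'.continuous.comp (f := fun y => (x, y)) (by fun_prop)).aestronglyMeasurable
  · filter_upwards [hμ] with y hy z hz
    exact hB (z, y) ⟨hz, hy⟩
  · exact integrable_const _
  · refine Eventually.of_forall fun y z _ => ?_
    have : ContDiff ℝ ∞ (fun x' => F x' y) := hF.comp (f := fun x' => (x', y)) (by fun_prop)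
    exact (this.differentiable (by simp) z).hasFDerivAt

end Parametric

section ParametricIterated

variable {Y : Type} [NormedAddCommGroup Y] [NormedSpace ℝ Y] [MeasurableSpace Y]
  [OpensMeasurableSpace Y] [SecondCountableTopology Y] [ProperSpace E]
  {μ : Measure Y} [IsFiniteMeasure μ]

/-- Differentiate under the integral one order at a time. The codomain is quantified inside the
induction because the first derivative takes values in a space of linear maps. -/
lemma norm_iteratedFDeriv_parametric_integral_le {K : Set Y} (hK : IsCompact K)
    (hμ : ∀ᵐ y ∂μ, y ∈ K) (j : ℕ) : ∀ {G : Type} [NormedAddCommGroup G] [NormedSpace ℝ G]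
    {F : E → Y → G}, ContDiff ℝ ∞ (Function.uncurry F) → ∀ x : E,
    ‖iteratedFDeriv ℝ j (fun x => ∫ y, F x y ∂μ) x‖ ≤
      ∫ y, ‖iteratedFDeriv ℝ j (fun x' => F x' y) x‖ ∂μ := by
  induction j with
  | zero =>
    intro G _ _ F hF x
    simpa using norm_integral_le_integral_norm (fun y => F x y)
  | succ j ih =>
    intro G _ _ F hF x
    rw [← norm_iteratedFDeriv_fderiv]
    have : fderiv ℝ (fun x => ∫ y, F x y ∂μ) =
        fun x => ∫ y, fderiv ℝ (fun x' => F x' y) x ∂μ := by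
      funext z
      exact (hasFDerivAt_parametric_integral hK hμ hF z).fderiv
    rw [this]
    refine (ih (contDiff_partial_fderiv hF) x).trans_eq ?_
    congr 1
    funext y
    exact norm_iteratedFDeriv_fderiv

lemma contDiff_parametric_integral {K : Set Y} (hK : IsCompact K)
    (hμ : ∀ᵐ y ∂μ, y ∈ K) {G : Type} [NormedAddCommGroup G] [NormedSpace ℝ G]
    {F : E → Y → G} (hF : ContDiff ℝ ∞ (Function.uncurry F)) :
    ContDiff ℝ ∞ (fun x => ∫ y, F x y ∂μ) := by
  rw [contDiff_infty]
  intro m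
  induction m generalizing G with
  | zero =>
    refine contDiff_zero.2 (continuous_iff_continuousAt.2 fun x => ?_)
    exact (hasFDerivAt_parametric_integral hK hμ hF x).continuousAt
  | succ m ih =>
    push_cast
    refine contDiff_succ_iff_fderiv.2 ⟨fun x => ?_, by simp, ?_⟩
    · exact (hasFDerivAt_parametric_integral hK hμ hF x).differentiableAt
    · have : fderiv ℝ (fun x => ∫ y, F x y ∂μ) =
        fun x => ∫ y, fderiv ℝ (fun x' => F x' y) x ∂μ := by
        funext z
        exact (hasFDerivAt_parametric_integral hK hμ hF z).fderiv
      rw [this]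
      exact ih (contDiff_partial_fderiv hF)

end ParametricIterated

/-! ### Composition, finite differences and Taylor polynomials -/

/-- Inserting the dilation by `d` between `h` and `Ψ` turns the bounds on `Ψ` into the geometric
form `(A d⁻¹)ʲ` required by the Faà di Bruno estimate, while the `j`-th derivative of the dilated
`h` gains `dʲ`. -/
lemma norm_iteratedFDeriv_comp_le_scaled {h : E → G} {Ψ : E → E} (hh : ContDiff ℝ ∞ h)
    (hΨ : ContDiff ℝ ∞ Ψ) {k : ℕ} {x : E} {A d : ℝ} (hA : 1 ≤ A) (hd : 0 < d)
    (hb : ∀ j, 1 ≤ j → j ≤ k → ‖iteratedFDeriv ℝ j Ψ x‖ ≤ A * d * d⁻¹ ^ j) :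
    ‖iteratedFDeriv ℝ k (fun x => h (Ψ x)) x‖ ≤ k.factorial * A ^ k * d⁻¹ ^ k *
      ∑ j ∈ Finset.range (k + 1), d ^ j * ‖iteratedFDeriv ℝ j h (Ψ x)‖ := by
  set T : E →L[ℝ] E := d • ContinuousLinearMap.id ℝ E with hT
  have hTn : ‖T‖ ≤ d := by
    rw [hT, norm_smul, Real.norm_of_nonneg hd.le]
    exact mul_le_of_le_one_right hd.le ContinuousLinearMap.norm_id_le
  have hcomp : (fun x => h (Ψ x)) = (h ∘ T) ∘ (fun x => d⁻¹ • Ψ x) := by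
    funext y
    simp [hT, smul_smul, hd.ne']
  have hΨ' : ContDiff ℝ ∞ (fun x => d⁻¹ • Ψ x) := contDiff_const.smul hΨ
  rw [hcomp]
  have key := norm_iteratedFDeriv_comp_le (n := k) (hh.comp T.contDiff) hΨ' (by exact_mod_cast le_top) x
    (C := ∑ j ∈ Finset.range (k + 1), d ^ j * ‖iteratedFDeriv ℝ j h (Ψ x)‖) (D := A * d⁻¹) ?_ ?_
  · refine key.trans_eq ?_
    rw [mul_pow]; ring
  · intro i hi
    have hTx : T (d⁻¹ • Ψ x) = Ψ x := by simp [hT, smul_smul, hd.ne']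
    rw [T.iteratedFDeriv_comp_right hh _ (by exact_mod_cast le_top), hTx]
    refine (ContinuousMultilinearMap.norm_compContinuousLinearMap_le _ _).trans ?_
    refine le_trans ?_ (Finset.single_le_sum (f := fun j => d ^ j * ‖iteratedFDeriv ℝ j h (Ψ x)‖)
      (fun j _ => by positivity) (Finset.mem_range.2 (Nat.lt_succ_of_le hi)))
    rw [mul_comm]
    simp only [Finset.prod_const, Finset.card_univ, Fintype.card_fin]
    gcongr
  · intro i hi1 hi
    have : (fun x => d⁻¹ • Ψ x) = d⁻¹ • Ψ := rfl
    rw [this, iteratedFDeriv_const_smul_apply (hΨ.of_le (by exact_mod_cast le_top)).contDiffAt, norm_smul,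
      Real.norm_of_nonneg (by positivity), mul_pow]
    calc d⁻¹ * ‖iteratedFDeriv ℝ i Ψ x‖ ≤ d⁻¹ * (A * d * d⁻¹ ^ i) := by
          gcongr; exact hb i hi1 hi
      _ = A * d⁻¹ ^ i := by field_simp
      _ ≤ A ^ i * d⁻¹ ^ i := by
          gcongr; exact le_self_pow₀ hA (by omega)

lemma iteratedFDeriv_const_of_succ_eq_zero {k : ℕ} {P : E → G} (hP : ContDiff ℝ ∞ P)
    (h0 : ∀ x, iteratedFDeriv ℝ (k + 1) P x = 0) (x y : E) :
    iteratedFDeriv ℝ k P x = iteratedFDeriv ℝ k P y := by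
  refine is_const_of_fderiv_eq_zero (𝕜 := ℝ) (f := iteratedFDeriv ℝ k P) ?_ ?_ x y
  · exact hP.differentiable_iteratedFDeriv (by exact_mod_cast ENat.natCast_lt_top k)
  · intro z
    rw [← norm_eq_zero, norm_fderiv_iteratedFDeriv, h0, norm_zero]

/-- One difference lowers the order by one: if the `(k+1)`-st derivative vanishes, the `k`-th is
constant, hence cancels in `P(· + v) - P`. -/
lemma fwdDiff_iter_eq_zero {k : ℕ} : ∀ {P : E → G}, ContDiff ℝ ∞ P →
    (∀ x, iteratedFDeriv ℝ k P x = 0) → ∀ v x, (fwdDiff v)^[k] P x = 0 := by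
  induction k with
  | zero =>
    intro P _ h0 v x
    have := congrArg (fun M => M (fun _ => 0)) (h0 x)
    simpa using this
  | succ k ih =>
    intro P hP h0 v x
    rw [Function.iterate_succ_apply]
    have hs : ContDiff ℝ ∞ (fun y => P (y + v)) := hP.comp (by fun_prop)
    refine ih (hs.sub hP) (fun y => ?_) v x
    have : (fun y => P (y + v) - P y) = (fun y => P (y + v)) - P := rfl
    rw [this, iteratedFDeriv_sub_apply (hs.of_le (by exact_mod_cast le_top)).contDiffAt
      (hP.of_le (by exact_mod_cast le_top)).contDiffAt, iteratedFDeriv_comp_add_right,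
      iteratedFDeriv_const_of_succ_eq_zero hP h0 (y + v) y, sub_self]

/-- Extrapolation: a function with vanishing `k`-th derivative is determined at `x` by its values
at `x + i v`, `1 ≤ i ≤ k`. -/
lemma sum_extrapolation {k : ℕ} {P : E → G} (hP : ContDiff ℝ ∞ P)
    (h0 : ∀ x, iteratedFDeriv ℝ k P x = 0) (x v : E) :
    ∑ i ∈ Finset.range k, ((-1) ^ i * (k.choose (i + 1)) : ℝ) • P (x + ((i + 1 : ℕ) : ℝ) • v) = P x := by
  -- The formula is the vanishing of the `k`-th forward difference, solved for its unshifted term.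
  have h := fwdDiff_iter_eq_zero hP h0 v x
  rw [fwdDiff_iter_eq_sum_shift, Finset.sum_range_succ'] at h
  have h2 := congrArg (fun z => ((-1 : ℝ) ^ k) • z) h
  simp only [smul_add, Finset.smul_sum, smul_zero] at h2
  have e0 : (-1 : ℝ) ^ k • (((-1) ^ (k - 0) * ((k.choose 0 : ℕ) : ℤ)) • P (x + 0 • v)) = P x := by
    rw [← Int.cast_smul_eq_zsmul ℝ, smul_smul]
    simp [← mul_pow]
  rw [e0] at h2
  rw [eq_comm, ← sub_eq_zero, ← h2, add_comm, sub_eq_add_neg, ← Finset.sum_neg_distrib]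
  congr 1
  refine Finset.sum_congr rfl fun i hi => ?_
  rw [← Int.cast_smul_eq_zsmul ℝ, smul_smul, ← neg_smul, Nat.cast_smul_eq_nsmul]
  congr 1
  have hik : i < k := Finset.mem_range.1 hi
  obtain ⟨m, rfl⟩ := Nat.exists_eq_add_of_lt hik
  have : i + m + 1 - (i + 1) = m := by omega
  rw [this]
  push_cast
  have h3 : (-1 : ℝ) ^ (i + m + 1) * (-1) ^ m = -(-1) ^ i := by
    rw [pow_succ, pow_add]
    have : ((-1 : ℝ) ^ m) * (-1) ^ m = 1 := by rw [← mul_pow]; simp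
    linear_combination (-(-1) ^ i) * this
  rw [← mul_assoc, h3]
  ring


lemma iteratedFDeriv_succ_eq_zero_of_const {k : ℕ} {P : E → G} {M : E [×k]→L[ℝ] G}
    (h : ∀ x, iteratedFDeriv ℝ k P x = M) (x : E) : iteratedFDeriv ℝ (k + 1) P x = 0 := by
  have : iteratedFDeriv ℝ k P = fun _ => M := funext h
  have h0 : fderiv ℝ (iteratedFDeriv ℝ k P) x = 0 := by
    rw [this, fderiv_fun_const]
    rfl
  rw [← norm_eq_zero, ← norm_fderiv_iteratedFDeriv, h0]
  exact norm_zero (E := E →L[ℝ] E [×k]→L[ℝ] G)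

/-- The polynomial is built degree by degree: the new homogeneous term has vanishing derivatives of
lower order at `w`, and so does not disturb what is already matched. -/
lemma exists_taylor_polynomial {u : E → G} (hu : ContDiff ℝ ∞ u) (w : E) (k : ℕ) :
    ∃ P : E → G, ContDiff ℝ ∞ P ∧ (∀ x, iteratedFDeriv ℝ k P x = 0) ∧
      ∀ j < k, iteratedFDeriv ℝ j P w = iteratedFDeriv ℝ j u w := by
  induction k with
  | zero =>
    refine ⟨0, contDiff_const, fun x => ?_, by simp⟩
    ext v
    simp
  | succ k ih =>
    obtain ⟨P, hP, hP0, hPw⟩ := ih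
    set M : E [×k]→L[ℝ] G := ((k.factorial : ℝ)⁻¹) • iteratedFDeriv ℝ k u w with hM
    set Q₀ : E → G := fun z => M (fun _ => z) with hQ₀
    set Q : E → G := fun z => Q₀ (z - w) with hQ
    set T : E →L[ℝ] (Fin k → E) := ContinuousLinearMap.pi fun _ => ContinuousLinearMap.id ℝ E
    have hQ₀s : ContDiff ℝ ∞ Q₀ := M.contDiff.comp T.contDiff
    have hQs : ContDiff ℝ ∞ Q := hQ₀s.comp (by fun_prop)
    have hQD : ∀ j x, iteratedFDeriv ℝ j Q x = iteratedFDeriv ℝ j Q₀ (x - w) := by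
      intro j x
      exact iteratedFDeriv_comp_sub j w x
    have hQk : ∀ x, iteratedFDeriv ℝ k Q x = iteratedFDeriv ℝ k u w := by
      intro x
      rw [hQD]
      ext v
      rw [hQ₀, ContinuousMultilinearMap.iteratedFDeriv_comp_diagonal]
      simp only [hM, smul_apply]
      -- The `k`-th derivative of the diagonal form is a sum over permutations; by symmetry its `k!`
      -- terms coincide, and the factor `(k!)⁻¹` cancels them.
      rw [Finset.sum_congr rfl (fun σ _ => by
        rw [iteratedFDeriv_comp_perm_of_contDiff (hu.of_le (by exact_mod_cast le_top))])]
      rw [Finset.sum_const, Finset.card_univ, Fintype.card_perm, Fintype.card_fin,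
        ← Nat.cast_smul_eq_nsmul ℝ, smul_smul, mul_inv_cancel₀ (by positivity), one_smul]
    have hQj : ∀ j < k, iteratedFDeriv ℝ j Q w = 0 := by
      intro j hj
      rw [hQD, sub_self]
      have : Q₀ = M ∘ T := rfl
      rw [this, T.iteratedFDeriv_comp_right M.contDiff (n := ∞) _ (by exact_mod_cast le_top), map_zero]
      have h0 : iteratedFDeriv ℝ j M 0 = 0 := by
        have := M.norm_iteratedFDeriv_le j 0
        rw [Fintype.card_fin, norm_zero, zero_pow (by omega), mul_zero] at this
        exact norm_le_zero_iff.1 this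
      rw [h0]
      ext v
      simp
    have hadd : ∀ j x, iteratedFDeriv ℝ j (P + Q) x =
        iteratedFDeriv ℝ j P x + iteratedFDeriv ℝ j Q x := fun j x =>
      iteratedFDeriv_add_apply (hP.of_le (by exact_mod_cast le_top)).contDiffAt
        (hQs.of_le (by exact_mod_cast le_top)).contDiffAt
    refine ⟨P + Q, hP.add hQs, fun x => ?_, fun j hj => ?_⟩
    · rw [hadd, iteratedFDeriv_succ_eq_zero_of_const hP0, iteratedFDeriv_succ_eq_zero_of_const hQk,
        add_zero]
    · rw [hadd]
      rcases Nat.lt_succ_iff_lt_or_eq.1 hj with h | rfl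
      · rw [hPw j h, hQj j h, add_zero]
      · rw [hP0, hQk, zero_add]

/-- The fundamental theorem of calculus on the segment is used `k - j` times, each time starting
from a zero value at `w` and costing a factor `‖e‖`. The integral over the whole segment is kept
rather than a supremum, since only averages of the `k`-th derivative will be under control. -/
lemma norm_iteratedFDeriv_le_integral_of_vanishing [CompleteSpace G] {h : E → G}
    (hh : ContDiff ℝ ∞ h) {w : E} {k : ℕ} (h0 : ∀ j < k, iteratedFDeriv ℝ j h w = 0) (e : E)
    {j : ℕ} (hj : j < k) {t : ℝ} (ht : t ∈ Icc (0 : ℝ) 1) :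
    ‖iteratedFDeriv ℝ j h (w + t • e)‖ ≤
      ‖e‖ ^ (k - j) * ∫ s in (0 : ℝ)..1, ‖iteratedFDeriv ℝ k h (w + s • e)‖ := by
  have hcont : ∀ i, Continuous fun s : ℝ => ‖iteratedFDeriv ℝ i h (w + s • e)‖ := fun i =>
    ((hh.continuous_iteratedFDeriv (m := i) (by exact_mod_cast le_top)).comp
      (by fun_prop : Continuous fun s : ℝ => w + s • e)).norm
  have step : ∀ i < k, ∀ t ∈ Icc (0 : ℝ) 1, ‖iteratedFDeriv ℝ i h (w + t • e)‖ ≤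
      ‖e‖ * ∫ s in (0 : ℝ)..t, ‖iteratedFDeriv ℝ (i + 1) h (w + s • e)‖ := by
    intro i hi t ht
    have hd : ∀ s, HasDerivAt (fun s : ℝ => iteratedFDeriv ℝ i h (w + s • e))
        (fderiv ℝ (iteratedFDeriv ℝ i h) (w + s • e) e) s := by
      intro s
      have h1 : HasFDerivAt (iteratedFDeriv ℝ i h) (fderiv ℝ (iteratedFDeriv ℝ i h) (w + s • e))
          (w + s • e) :=
        (hh.differentiable_iteratedFDeriv (by exact_mod_cast ENat.natCast_lt_top i) _).hasFDerivAt
      have h2 : HasDerivAt (fun s : ℝ => w + s • e) e s := by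
        simpa using ((hasDerivAt_id s).smul_const e).const_add w
      exact h1.comp_hasDerivAt s h2
    have hc : Continuous fun s : ℝ => fderiv ℝ (iteratedFDeriv ℝ i h) (w + s • e) e := by
      have h1 : ContDiff ℝ 1 (iteratedFDeriv ℝ i h) :=
        hh.iteratedFDeriv_right (m := 1) (by exact_mod_cast le_top)
      exact ((h1.continuous_fderiv (by norm_num)).comp
        (by fun_prop : Continuous fun s : ℝ => w + s • e)).clm_apply continuous_const
    have hftc := intervalIntegral.integral_eq_sub_of_hasDerivAt (a := 0) (b := t)
      (fun s _ => hd s) (hc.intervalIntegrable _ _)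
    simp only [zero_smul, add_zero, h0 i hi, sub_zero] at hftc
    rw [← hftc, ← intervalIntegral.integral_const_mul]
    refine intervalIntegral.norm_integral_le_of_norm_le ht.1 (Eventually.of_forall fun s _ => ?_)
      ((continuous_const.mul (hcont _)).intervalIntegrable _ _)
    refine (ContinuousLinearMap.le_opNorm _ _).trans ?_
    rw [norm_fderiv_iteratedFDeriv, mul_comm]
  set I := ∫ s in (0 : ℝ)..1, ‖iteratedFDeriv ℝ k h (w + s • e)‖ with hI
  have hI0 : 0 ≤ I := intervalIntegral.integral_nonneg zero_le_one fun _ _ => norm_nonneg _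
  have main : ∀ m, ∀ i, i + (m + 1) = k → ∀ t ∈ Icc (0 : ℝ) 1,
      ‖iteratedFDeriv ℝ i h (w + t • e)‖ ≤ ‖e‖ ^ (m + 1) * I := by
    intro m
    induction m with
    | zero =>
      intro i hi t ht
      refine (step i (by omega) t ht).trans ?_
      rw [zero_add] at hi
      rw [hi, zero_add, pow_one]
      gcongr
      rw [hI, ← intervalIntegral.integral_add_adjacent_intervals
        ((hcont k).intervalIntegrable 0 t) ((hcont k).intervalIntegrable t 1)]
      have := intervalIntegral.integral_nonneg ht.2 (μ := volume)
        (f := fun s => ‖iteratedFDeriv ℝ k h (w + s • e)‖) fun _ _ => norm_nonneg _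
      linarith
    | succ m ih =>
      intro i hi t ht
      refine (step i (by omega) t ht).trans ?_
      rw [pow_succ' _ (m + 1), mul_assoc]
      gcongr
      have : ∫ s in (0 : ℝ)..t, ‖iteratedFDeriv ℝ (i + 1) h (w + s • e)‖ ≤
          ∫ s in (0 : ℝ)..t, ‖e‖ ^ (m + 1) * I := by
        refine intervalIntegral.integral_mono_on ht.1 ((hcont _).intervalIntegrable _ _)
          intervalIntegrable_const fun s hs => ?_
        exact ih (i + 1) (by omega) s ⟨hs.1, hs.2.trans ht.2⟩
      refine this.trans ?_
      rw [intervalIntegral.integral_const, sub_zero, smul_eq_mul]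
      exact mul_le_of_le_one_left (by positivity) ht.2
  obtain ⟨m, rfl⟩ := Nat.exists_eq_add_of_lt hj
  have : j + m + 1 - j = m + 1 := by omega
  rw [this]
  exact main m j (by omega) t ht

end Calculus

end LipTrunc

end

noncomputable section

namespace LipTrunc

/-! ### Smooth cut-off functions and the regularised distance -/

lemma norm_iteratedFDeriv_comp_const_smul_le {E : Type} [NormedAddCommGroup E] [NormedSpace ℝ E]
    {G : Type} [NormedAddCommGroup G] [NormedSpace ℝ G] {h : E → G} (hh : ContDiff ℝ ∞ h)
    {c : ℝ} (hc : 0 ≤ c) (j : ℕ) (x : E) :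
    ‖iteratedFDeriv ℝ j (fun x => h (c • x)) x‖ ≤ c ^ j * ‖iteratedFDeriv ℝ j h (c • x)‖ := by
  set T : E →L[ℝ] E := c • ContinuousLinearMap.id ℝ E with hT
  have hTn : ‖T‖ ≤ c := by
    rw [hT, norm_smul, Real.norm_of_nonneg hc]
    exact mul_le_of_le_one_right hc ContinuousLinearMap.norm_id_le
  have : (fun x => h (c • x)) = h ∘ T := rfl
  rw [this, T.iteratedFDeriv_comp_right hh _ (by exact_mod_cast le_top)]
  refine (ContinuousMultilinearMap.norm_compContinuousLinearMap_le _ _).trans ?_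
  rw [mul_comm]
  simp only [Finset.prod_const, Finset.card_univ, Fintype.card_fin]
  gcongr
  exact le_rfl

/-- Mollify the indicator of `A` with a kernel supported in the unit ball. All derivatives fall on
the kernel, so the bounds do not depend on `A`. -/
lemma exists_unit_cutoff (n k : ℕ) : ∃ C : ℝ, 0 ≤ C ∧ ∀ A : Set (Eucl n), MeasurableSet A →
    ∃ χ : Eucl n → ℝ, ContDiff ℝ ∞ χ ∧ (∀ x, 0 ≤ χ x) ∧ (∀ x, χ x ≤ 1) ∧
      (∀ x, Metric.ball x 1 ⊆ A → χ x = 1) ∧ (∀ x, Disjoint (Metric.ball x 1) A → χ x = 0) ∧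
      ∀ j ≤ k, ∀ x, ‖iteratedFDeriv ℝ j χ x‖ ≤ C := by
  let b : ContDiffBump (0 : Eucl n) := ⟨1 / 2, 1, by norm_num, by norm_num⟩
  set ρ : Eucl n → ℝ := b.normed volume with hρ
  have hρs : ContDiff ℝ ∞ ρ := b.contDiff_normed
  have hρ0 : ∀ x, 0 ≤ ρ x := b.nonneg_normed
  have hρsupp : ∀ x, 1 ≤ ‖x‖ → ρ x = 0 := by
    intro x hx
    have : x ∉ Function.support ρ := by
      rw [hρ, b.support_normed_eq]
      simpa [b] using hx
    simpa using this
  have hρint : ∫ x, ρ x = 1 := b.integral_normed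
  have hρi : Integrable ρ := b.integrable_normed
  have hρc : HasCompactSupport ρ := b.hasCompactSupport_normed
  have hbd : ∀ j : ℕ, ∃ B, ∀ x, ‖iteratedFDeriv ℝ j ρ x‖ ≤ B := fun j =>
    (hρs.continuous_iteratedFDeriv (by exact_mod_cast le_top)).bounded_above_of_compact_support
      (hρc.iteratedFDeriv j)
  choose B hB using hbd
  set V : ℝ := volume.real (Metric.closedBall (0 : Eucl n) 2) with hV
  have hB0 : ∀ j, 0 ≤ B j := fun j => (norm_nonneg _).trans (hB j 0)
  refine ⟨∑ j ∈ Finset.range (k + 1), B j * V, Finset.sum_nonneg fun j _ =>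
    mul_nonneg (hB0 j) measureReal_nonneg, fun A hA => ?_⟩
  have hinteg : ∀ x, Integrable fun y => ρ (x - y) := fun x => hρi.comp_sub_left x
  have htot : ∀ x, ∫ y, ρ (x - y) = 1 := fun x => by rw [integral_sub_left_eq_self, hρint]
  have hF : ContDiff ℝ ∞ (Function.uncurry fun x y : Eucl n => ρ (x - y)) :=
    hρs.comp (f := fun p : Eucl n × Eucl n => p.1 - p.2) (by fun_prop)
  -- Since `A` may be unbounded, it is cut down locally to a bounded set, where the results on
  -- parametric integrals over a finite measure carried by a compact set apply.
  have hlocal : ∀ x₁ : Eucl n, (fun x => ∫ y in A, ρ (x - y)) =ᶠ[𝓝 x₁]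
      fun x => ∫ y in A ∩ Metric.closedBall x₁ 2, ρ (x - y) := by
    intro x₁
    filter_upwards [Metric.ball_mem_nhds x₁ one_pos] with x hx
    refine setIntegral_eq_of_subset_of_forall_sdiff_eq_zero hA inter_subset_left fun y hy => ?_
    refine hρsupp _ ?_
    have h1 : ¬ dist y x₁ ≤ 2 := fun h => hy.2 ⟨hy.1, h⟩
    have h2 : dist x x₁ < 1 := hx
    rw [← dist_eq_norm]
    have := dist_triangle_left y x₁ x
    linarith
  have hae : ∀ x₁ : Eucl n, ∀ᵐ y ∂(volume.restrict (A ∩ Metric.closedBall x₁ 2)),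
      y ∈ Metric.closedBall x₁ 2 := fun x₁ =>
    (ae_restrict_mem (hA.inter Metric.isClosed_closedBall.measurableSet)).mono fun y hy => hy.2
  have hfin : ∀ x₁ : Eucl n, IsFiniteMeasure (volume.restrict (A ∩ Metric.closedBall x₁ 2)) :=
    fun x₁ => ⟨by
      rw [Measure.restrict_apply_univ]
      exact (measure_mono inter_subset_right).trans_lt (isCompact_closedBall x₁ 2).measure_lt_top⟩
  refine ⟨fun x => ∫ y in A, ρ (x - y), ?_, ?_, ?_, ?_, ?_, ?_⟩
  · refine contDiff_iff_contDiffAt.2 fun x₁ => ?_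
    have := hfin x₁
    exact (contDiff_parametric_integral (isCompact_closedBall x₁ 2) (hae x₁) hF).contDiffAt.congr_of_eventuallyEq
      (hlocal x₁)
  · intro x
    exact integral_nonneg fun y => hρ0 _
  · intro x
    rw [← htot x]
    exact setIntegral_le_integral (hinteg x) (Eventually.of_forall fun y => hρ0 _)
  · intro x hx
    change ∫ y in A, ρ (x - y) = 1
    rw [← htot x]
    refine setIntegral_eq_integral_of_forall_compl_eq_zero fun y hy => hρsupp _ ?_
    rw [← dist_eq_norm, dist_comm]
    exact not_lt.1 fun h => hy (hx h)
  · intro x hx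
    refine setIntegral_eq_zero_of_forall_eq_zero fun y hy => hρsupp _ ?_
    rw [← dist_eq_norm, dist_comm]
    exact not_lt.1 fun h => hx.le_bot ⟨h, hy⟩
  · intro j hj x
    have := hfin x
    rw [((hlocal x).iteratedFDeriv ℝ j).eq_of_nhds]
    refine (norm_iteratedFDeriv_parametric_integral_le (isCompact_closedBall x 2) (hae x) j hF x).trans ?_
    refine le_trans ?_ (Finset.single_le_sum (f := fun j => B j * V)
      (fun j _ => mul_nonneg (hB0 j) measureReal_nonneg) (Finset.mem_range.2 (Nat.lt_succ_of_le hj)))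
    have hle : ∀ y : Eucl n, ‖‖iteratedFDeriv ℝ j (fun x' => ρ (x' - y)) x‖‖ ≤ B j := by
      intro y
      rw [norm_norm, iteratedFDeriv_comp_sub]
      exact hB j _
    refine (le_abs_self _).trans ?_
    rw [← Real.norm_eq_abs]
    refine (norm_integral_le_of_norm_le_const (Eventually.of_forall hle)).trans ?_
    refine mul_le_mul_of_nonneg_left ?_ (hB0 j)
    rw [measureReal_restrict_apply_univ, hV]
    have hvol : volume.real (Metric.closedBall (0 : Eucl n) 2) = volume.real (Metric.closedBall x 2) := by
      rw [Measure.real, Measure.real, Measure.addHaar_closedBall_center volume x]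
    rw [hvol]
    exact measureReal_mono inter_subset_right (isCompact_closedBall x 2).measure_lt_top.ne

lemma exists_cutoff (n k : ℕ) : ∃ C : ℝ, 0 ≤ C ∧ ∀ (A : Set (Eucl n)) (s : ℝ), MeasurableSet A →
    0 < s → ∃ χ : Eucl n → ℝ, ContDiff ℝ ∞ χ ∧ (∀ x, 0 ≤ χ x) ∧ (∀ x, χ x ≤ 1) ∧
      (∀ x, Metric.ball x s ⊆ A → χ x = 1) ∧ (∀ x, Disjoint (Metric.ball x s) A → χ x = 0) ∧
      ∀ j ≤ k, ∀ x, ‖iteratedFDeriv ℝ j χ x‖ ≤ C * s⁻¹ ^ j := by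
  obtain ⟨C, hC, H⟩ := exists_unit_cutoff n k
  refine ⟨C, hC, fun A s hA hs => ?_⟩
  obtain ⟨χ, h1, h2, h3, h4, h5, h6⟩ := H ((fun y => s • y) ⁻¹' A) (hA.preimage (by fun_prop))
  have hball : ∀ x y : Eucl n, y ∈ Metric.ball (s⁻¹ • x) 1 ↔ s • y ∈ Metric.ball x s := by
    intro x y
    rw [Metric.mem_ball, Metric.mem_ball]
    have : dist (s • y) x = s * dist y (s⁻¹ • x) := by
      conv_lhs => rw [show x = s • s⁻¹ • x by rw [smul_smul, mul_inv_cancel₀ hs.ne', one_smul]]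
      rw [dist_smul₀, Real.norm_of_nonneg hs.le]
    rw [this]
    constructor
    · intro h; nlinarith
    · intro h; by_contra h'; nlinarith
  refine ⟨fun x => χ (s⁻¹ • x), h1.comp (by fun_prop), fun x => h2 _, fun x => h3 _, ?_, ?_, ?_⟩
  · intro x hx
    exact h4 _ fun y hy => hx ((hball x y).1 hy)
  · intro x hx
    refine h5 _ (Set.disjoint_left.2 fun y hy hyA => ?_)
    exact Set.disjoint_left.1 hx ((hball x y).1 hy) hyA
  · intro j hj x
    refine (norm_iteratedFDeriv_comp_const_smul_le h1 (by positivity) j x).trans ?_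
    rw [mul_comm]
    gcongr
    exact h6 j hj _

lemma sum_dyadic_le {ε d : ℝ} (hε : 0 < ε) (hd : 0 ≤ d) (M : ℕ) :
    ∑ m ∈ Finset.range M, (if ε * 2 ^ m ≤ d then ε * 2 ^ m else 0) ≤ 2 * d := by
  -- The second bound, by the next dyadic number, carries the induction for the first.
  have : ∑ m ∈ Finset.range M, (if ε * 2 ^ m ≤ d then ε * 2 ^ m else 0) ≤ 2 * d ∧
      ∑ m ∈ Finset.range M, (if ε * 2 ^ m ≤ d then ε * 2 ^ m else 0) ≤ ε * 2 ^ M := by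
    induction M with
    | zero => simp; exact ⟨hd, hε.le⟩
    | succ M ih =>
      rw [Finset.sum_range_succ]
      have h2 : ε * 2 ^ (M + 1) = 2 * (ε * 2 ^ M) := by ring
      have h3 : 0 < ε * 2 ^ M := by positivity
      split_ifs with h
      · constructor <;> linarith [ih.1, ih.2]
      · constructor <;> linarith [ih.1, ih.2]
  exact this.1

/-- A smooth function comparable with the distance to `F` (away from `F`), with the natural bounds on
its derivatives, vanishing in a neighbourhood of `F`. -/
lemma exists_regularized_distance (n k : ℕ) : ∃ C : ℝ, 1 ≤ C ∧
    ∀ (F : Set (Eucl n)) (ε D : ℝ), 0 < ε → ∃ r : Eucl n → ℝ,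
      ContDiff ℝ ∞ r ∧ (∀ x, 0 ≤ r x) ∧ (∀ x, Metric.infDist x F ≤ ε → r x = 0) ∧
      (∀ x, r x ≤ 2 * Metric.infDist x F) ∧
      (∀ x, 3 * ε ≤ Metric.infDist x F → Metric.infDist x F ≤ D → Metric.infDist x F ≤ 6 * r x) ∧
      ∀ j ≤ k, ∀ x, 0 < Metric.infDist x F →
        ‖iteratedFDeriv ℝ j r x‖ ≤ C * Metric.infDist x F * (Metric.infDist x F)⁻¹ ^ j := by
  obtain ⟨C, hC, H⟩ := exists_cutoff n k
  refine ⟨2 * (C + 1) * 3 ^ k, ?_, fun F ε D hε => ?_⟩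
  · have : (1 : ℝ) ≤ 3 ^ k := one_le_pow₀ (by norm_num)
    nlinarith
  set d : Eucl n → ℝ := fun x => Metric.infDist x F with hd
  have hdc : Continuous d := Metric.continuous_infDist_pt F
  have hdl : ∀ x y, d x ≤ d y + dist x y := fun x y => Metric.infDist_le_infDist_add_dist
  have hd0 : ∀ x, 0 ≤ d x := fun x => Metric.infDist_nonneg
  have hs : ∀ m : ℕ, 0 < ε * 2 ^ m := fun m => by positivity
  -- The regularised distance is `∑ ε 2ᵐ χₘ`. The cut-off `χₘ` vanishes where the distance is at
  -- most `ε 2ᵐ` and equals `1` where it is at least `3 ε 2ᵐ`, so its derivatives live where the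
  -- distance is comparable to `ε 2ᵐ`.
  choose χ h1 h2 h3 h4 h5 h6 using fun m : ℕ =>
    H {x | 2 * (ε * 2 ^ m) < d x} (ε * 2 ^ m) (measurableSet_lt measurable_const hdc.measurable) (hs m)
  have hzero : ∀ m x, d x ≤ ε * 2 ^ m → χ m x = 0 := by
    intro m x hx
    refine h5 m x (Set.disjoint_left.2 fun y hy hy' => ?_)
    have := hdl y x
    have h' : dist y x < ε * 2 ^ m := hy
    have h'' : 2 * (ε * 2 ^ m) < d y := hy'
    linarith
  have hone : ∀ m x, 3 * (ε * 2 ^ m) ≤ d x → χ m x = 1 := by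
    intro m x hx
    refine h4 m x fun y hy => ?_
    have := hdl x y
    have h' : dist y x < ε * 2 ^ m := hy
    rw [dist_comm] at h'
    change 2 * (ε * 2 ^ m) < d y
    linarith
  -- Finitely many scales suffice because the lower bound is only wanted for distances up to `D`.
  obtain ⟨M, hM⟩ : ∃ M : ℕ, D < 3 * (ε * 2 ^ M) := by
    obtain ⟨M, hM⟩ := pow_unbounded_of_one_lt (D / (3 * ε)) (one_lt_two (α := ℝ))
    refine ⟨M, ?_⟩
    rw [div_lt_iff₀ (by positivity)] at hM
    linarith
  refine ⟨fun x => ∑ m ∈ Finset.range M, (ε * 2 ^ m) * χ m x, ?_, ?_, ?_, ?_, ?_, ?_⟩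
  · exact ContDiff.sum fun m _ => contDiff_const.mul (h1 m)
  · intro x
    exact Finset.sum_nonneg fun m _ => mul_nonneg (hs m).le (h2 m x)
  · intro x hx
    refine Finset.sum_eq_zero fun m _ => ?_
    rw [hzero m x, mul_zero]
    refine le_trans hx (le_mul_of_one_le_right hε.le (one_le_pow₀ (by norm_num)))
  · intro x
    refine le_trans (Finset.sum_le_sum fun m _ => ?_) (sum_dyadic_le hε (hd0 x) M)
    split_ifs with h
    · exact mul_le_of_le_one_right (hs m).le (h3 m x)
    · rw [hzero m x (not_le.1 h).le, mul_zero]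
  · intro x hx hxD
    have hex : ∃ m : ℕ, d x < 3 * (ε * 2 ^ m) := ⟨M, lt_of_le_of_lt hxD hM⟩
    classical
    -- This `m` is the largest with `3 ε 2ᵐ ≤ d x`. The single term `ε 2ᵐ` of the sum already
    -- exceeds `d x / 6`, which explains the constant `6`.
    obtain ⟨m, hm⟩ : ∃ m, Nat.find hex = m + 1 := by
      refine Nat.exists_eq_succ_of_ne_zero fun h0 => ?_
      have := Nat.find_spec hex
      rw [h0] at this
      simp only [pow_zero, mul_one] at this
      exact absurd hx (not_le.2 this)
    have hlt : d x < 3 * (ε * 2 ^ (m + 1)) := hm ▸ Nat.find_spec hex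
    have hge : 3 * (ε * 2 ^ m) ≤ d x := not_lt.1 (Nat.find_min hex (by omega))
    have hmM : m < M := by
      have := Nat.find_min' hex (lt_of_le_of_lt hxD hM)
      omega
    have hsingle := Finset.single_le_sum (f := fun m => (ε * 2 ^ m) * χ m x)
      (fun m _ => mul_nonneg (hs m).le (h2 m x)) (Finset.mem_range.2 hmM)
    simp only [hone m x hge, mul_one] at hsingle
    have : ε * 2 ^ (m + 1) = 2 * (ε * 2 ^ m) := by ring
    change d x ≤ _
    linarith
  · intro j hj x hx
    have hx' : 0 < d x := hx
    change _ ≤ _ * d x * (d x)⁻¹ ^ j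
    have hsmooth : ∀ m, ContDiff ℝ j (χ m) := fun m => (h1 m).of_le (by exact_mod_cast le_top)
    have hterm : ∀ m, ‖iteratedFDeriv ℝ j (fun x => (ε * 2 ^ m) * χ m x) x‖ ≤
        (if ε * 2 ^ m ≤ d x then ε * 2 ^ m else 0) * ((C + 1) * 3 ^ k * (d x)⁻¹ ^ j) := by
      intro m
      have e : (fun x => (ε * 2 ^ m) * χ m x) = (ε * 2 ^ m) • χ m := rfl
      rw [e, iteratedFDeriv_const_smul_apply (hsmooth m).contDiffAt, norm_smul,
        Real.norm_of_nonneg (hs m).le]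
      split_ifs with h
      · refine mul_le_mul_of_nonneg_left ?_ (hs m).le
        -- In the transition layer the scale of `χₘ` is at least `d x / 3`, the source of `3ᵏ`;
        -- beyond it `χₘ` is locally `1`.
        by_cases h3' : d x ≤ 3 * (ε * 2 ^ m)
        · refine (h6 m j hj x).trans ?_
          have hinv : (ε * 2 ^ m)⁻¹ ≤ 3 * (d x)⁻¹ := by
            rw [inv_le_iff_one_le_mul₀ (hs m), mul_assoc, mul_comm, mul_assoc, ← div_eq_inv_mul]
            rw [le_div_iff₀ hx']
            linarith
          have h3k : (3 : ℝ) ^ j ≤ 3 ^ k := pow_le_pow_right₀ (by norm_num) hj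
          calc C * (ε * 2 ^ m)⁻¹ ^ j ≤ C * (3 * (d x)⁻¹) ^ j := by gcongr
            _ = C * 3 ^ j * (d x)⁻¹ ^ j := by rw [mul_pow]; ring
            _ ≤ (C + 1) * 3 ^ k * (d x)⁻¹ ^ j := by gcongr; linarith
        · have hev : χ m =ᶠ[𝓝 x] fun _ => (1 : ℝ) := by
            filter_upwards [(isOpen_lt continuous_const hdc).mem_nhds (not_le.1 h3')] with y hy
            exact hone m y (le_of_lt hy)
          rw [(hev.iteratedFDeriv ℝ j).eq_of_nhds]
          rcases Nat.eq_zero_or_pos j with rfl | hjp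
          · have : (1 : ℝ) ≤ 3 ^ k := one_le_pow₀ (by norm_num)
            simp
            nlinarith
          · rw [iteratedFDeriv_const_of_ne (by omega)]
            simp only [Pi.zero_apply, norm_zero]
            positivity
      · have hev : χ m =ᶠ[𝓝 x] fun _ => (0 : ℝ) := by
          filter_upwards [(isOpen_lt hdc continuous_const).mem_nhds (not_le.1 h)] with y hy
          exact hzero m y (le_of_lt hy)
        rw [(hev.iteratedFDeriv ℝ j).eq_of_nhds]
        simp
    rw [iteratedFDeriv_fun_sum_apply fun m _ => (contDiff_const.mul (hsmooth m)).contDiffAt]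
    refine (norm_sum_le _ _).trans ((Finset.sum_le_sum fun m _ => hterm m).trans ?_)
    rw [← Finset.sum_mul]
    refine (mul_le_mul_of_nonneg_right (sum_dyadic_le hε (hd0 x) M) (by positivity)).trans_eq ?_
    ring

end LipTrunc

end

noncomputable section

namespace LipTrunc

/-! ### Averages over the unit ball -/

/-- The normalised Lebesgue measure on the closed unit ball. -/
def unitBallMeasure (n : ℕ) : Measure (Eucl n) :=
  (volume (Metric.closedBall (0 : Eucl n) 1))⁻¹ • volume.restrict (Metric.closedBall 0 1)

lemma volume_closedBall_pos {n : ℕ} (x : Eucl n) {r : ℝ} (hr : 0 < r) :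
    0 < volume (Metric.closedBall x r) :=
  Metric.measure_closedBall_pos volume x hr

lemma volume_closedBall_ne_top {n : ℕ} (x : Eucl n) (r : ℝ) :
    volume (Metric.closedBall x r) ≠ ⊤ :=
  (isCompact_closedBall x r).measure_lt_top.ne

lemma volumeReal_closedBall_pos {n : ℕ} (x : Eucl n) {r : ℝ} (hr : 0 < r) :
    0 < volume.real (Metric.closedBall x r) :=
  ENNReal.toReal_pos (volume_closedBall_pos x hr).ne' (volume_closedBall_ne_top x r)

lemma volumeReal_closedBall {n : ℕ} (x : Eucl n) {r : ℝ} (hr : 0 ≤ r) :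
    volume.real (Metric.closedBall x r) =
      r ^ n * volume.real (Metric.closedBall (0 : Eucl n) 1) := by
  rw [Measure.real, Measure.addHaar_closedBall' volume x hr, ENNReal.toReal_mul,
    ENNReal.toReal_ofReal (by positivity), finrank_euclideanSpace_fin]
  rfl

instance isProbabilityMeasure_unitBallMeasure (n : ℕ) :
    IsProbabilityMeasure (unitBallMeasure n) := by
  constructor
  rw [unitBallMeasure, Measure.smul_apply, Measure.restrict_apply_univ, smul_eq_mul,
    ENNReal.inv_mul_cancel (volume_closedBall_pos 0 one_pos).ne' (volume_closedBall_ne_top _ _)]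

lemma ae_mem_unitBallMeasure (n : ℕ) :
    ∀ᵐ y ∂(unitBallMeasure n), y ∈ Metric.closedBall (0 : Eucl n) 1 :=
  Measure.ae_smul_measure (ae_restrict_mem Metric.isClosed_closedBall.measurableSet) _

lemma integral_unitBallMeasure {n : ℕ} (f : Eucl n → ℝ) :
    ∫ y, f y ∂(unitBallMeasure n) =
      (volume.real (Metric.closedBall (0 : Eucl n) 1))⁻¹ * ∫ y in Metric.closedBall 0 1, f y := by
  rw [unitBallMeasure, integral_smul_measure, ENNReal.toReal_inv, smul_eq_mul]
  rfl

lemma integrable_unitBallMeasure {n : ℕ} {G : Type} [NormedAddCommGroup G] {g : Eucl n → G}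
    (hg : Continuous g) : Integrable g (unitBallMeasure n) :=
  integrable_of_continuous_of_ae_mem_compact (isCompact_closedBall 0 1) (ae_mem_unitBallMeasure n) hg

lemma setIntegral_closedBall_comp_affine {n : ℕ} (f : Eucl n → ℝ) (p : Eucl n) {c : ℝ} (hc : 0 < c) :
    ∫ y in Metric.closedBall (0 : Eucl n) 1, f (p + c • y) =
      (c ^ n)⁻¹ * ∫ y in Metric.closedBall p c, f y := by
  have h1 := Measure.setIntegral_comp_smul_of_pos volume (fun y => f (p + y))
    (Metric.closedBall (0 : Eucl n) 1) hc
  rw [h1, finrank_euclideanSpace_fin, smul_eq_mul, smul_unitClosedBall, Real.norm_of_nonneg hc.le]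
  congr 1
  have h2 := (measurePreserving_add_left (volume : Measure (Eucl n)) p).setIntegral_preimage_emb
    (measurableEmbedding_addLeft p) f (Metric.closedBall p c)
  rw [← h2]
  congr 2
  ext y
  simp

/-! ### The set where the maximal function is small -/

variable {n : ℕ} {G : Type} [NormedAddCommGroup G] [NormedSpace ℝ G]

/-- The points at which all averages of `|Dᵏu|` over balls are at most `l`. -/
def goodSet (k : ℕ) (u : Eucl n → G) (l : ℝ) : Set (Eucl n) :=
  {x | ∀ ρ, 0 < ρ → ∫ y in Metric.closedBall x ρ, ‖iteratedFDeriv ℝ k u y‖ ≤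
    l * volume.real (Metric.closedBall x ρ)}

lemma continuous_norm_iteratedFDeriv {u : Eucl n → G} (hu : ContDiff ℝ ∞ u) (k : ℕ) :
    Continuous fun x => ‖iteratedFDeriv ℝ k u x‖ :=
  (hu.continuous_iteratedFDeriv (by exact_mod_cast le_top)).norm

/-- If the continuous function `|Dᵏu|` exceeded `l` at `x`, so would its averages over small balls.
-/
lemma norm_le_of_mem_goodSet {k : ℕ} {u : Eucl n → G} (hu : ContDiff ℝ ∞ u) {l : ℝ} {x : Eucl n}
    (hx : x ∈ goodSet k u l) : ‖iteratedFDeriv ℝ k u x‖ ≤ l := by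
  by_contra! h
  obtain ⟨m, hm1, hm2⟩ := exists_between h
  have hc := continuous_norm_iteratedFDeriv hu k
  obtain ⟨ρ, hρ, hball⟩ := Metric.nhds_basis_closedBall.mem_iff.1
    ((isOpen_lt continuous_const hc).mem_nhds hm2)
  have h1 := hx ρ hρ
  have hV := volumeReal_closedBall_pos x hρ
  have h2 : m * volume.real (Metric.closedBall x ρ) ≤
      ∫ y in Metric.closedBall x ρ, ‖iteratedFDeriv ℝ k u y‖ := by
    have := setIntegral_mono_on (μ := volume) (s := Metric.closedBall x ρ) (f := fun _ => m)
      (g := fun y => ‖iteratedFDeriv ℝ k u y‖)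
      (integrableOn_const (volume_closedBall_ne_top x ρ))
      (hc.continuousOn.integrableOn_compact (isCompact_closedBall x ρ))
      Metric.isClosed_closedBall.measurableSet fun y hy => le_of_lt (hball hy)
    rwa [setIntegral_const, smul_eq_mul, mul_comm] at this
  nlinarith

/-- The integral is an average over a ball of radius `c` contained in the ball of radius `ρ` about
`w`; enlarging to the latter costs the ratio of the volumes. -/
lemma integral_unitBall_affine_le {k : ℕ} {u : Eucl n → G} (hu : ContDiff ℝ ∞ u) {l : ℝ}
    {w : Eucl n} (hw : w ∈ goodSet k u l) {b : Eucl n} {c ρ : ℝ} (hc : 0 < c) (hρ : ‖b‖ + c ≤ ρ) :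
    ∫ y, ‖iteratedFDeriv ℝ k u (w + b + c • y)‖ ∂(unitBallMeasure n) ≤ (ρ / c) ^ n * l := by
  have hcont := continuous_norm_iteratedFDeriv hu k
  have hρ0 : 0 < ρ := by linarith [norm_nonneg b]
  have hV := volumeReal_closedBall_pos (0 : Eucl n) one_pos
  rw [integral_unitBallMeasure, setIntegral_closedBall_comp_affine
    (fun z => ‖iteratedFDeriv ℝ k u z‖) (w + b) hc]
  have hsub : Metric.closedBall (w + b) c ⊆ Metric.closedBall w ρ := by
    refine Metric.closedBall_subset_closedBall' ?_
    rw [dist_eq_norm, add_sub_cancel_left]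
    linarith
  have h1 : ∫ y in Metric.closedBall (w + b) c, ‖iteratedFDeriv ℝ k u y‖ ≤
      l * (ρ ^ n * volume.real (Metric.closedBall (0 : Eucl n) 1)) := by
    rw [← volumeReal_closedBall w hρ0.le]
    refine le_trans ?_ (hw ρ hρ0)
    exact setIntegral_mono_set (hcont.continuousOn.integrableOn_compact (isCompact_closedBall w ρ))
      (Eventually.of_forall fun _ => norm_nonneg _) (Eventually.of_forall hsub)
  calc _ ≤ (volume.real (Metric.closedBall (0 : Eucl n) 1))⁻¹ * ((c ^ n)⁻¹ *
        (l * (ρ ^ n * volume.real (Metric.closedBall (0 : Eucl n) 1)))) := by gcongr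
    _ = (ρ / c) ^ n * l := by
      rw [div_pow]
      field_simp

/-! ### The truncation operator -/

/-- The displaced point `x + (i + 1) r(x) (2 (x - x₀) / R + y)`. -/
def displaced (x₀ : Eucl n) (R : ℝ) (r : Eucl n → ℝ) (i : ℕ) (y x : Eucl n) : Eucl n :=
  x + ((i + 1 : ℕ) : ℝ) • (r x • ((2 / R) • (x - x₀) + y))

/-- The coefficients of the extrapolation formula `p(0) = ∑ᵢ cᵢ p(i + 1)`. -/
def extrapCoeff (k i : ℕ) : ℝ := (-1) ^ i * (k.choose (i + 1))

/-- Smoothing of `u` at the variable scale `r(x)`: an average of extrapolations from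
points displaced away from `x₀`. -/
def smoothing (k : ℕ) (x₀ : Eucl n) (R : ℝ) (r : Eucl n → ℝ) (u : Eucl n → G) (x : Eucl n) : G :=
  ∑ i ∈ Finset.range k, extrapCoeff k i • ∫ y, u (displaced x₀ R r i y x) ∂(unitBallMeasure n)

section Smoothing

variable {k : ℕ} {x₀ : Eucl n} {R : ℝ} {r : Eucl n → ℝ}

lemma contDiff_displaced (hr : ContDiff ℝ ∞ r) (i : ℕ) :
    ContDiff ℝ ∞ (Function.uncurry fun x y => displaced x₀ R r i y x) := by
  have : ContDiff ℝ ∞ fun p : Eucl n × Eucl n => r p.1 := hr.comp contDiff_fst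
  unfold displaced Function.uncurry
  fun_prop

lemma contDiff_comp_displaced (hr : ContDiff ℝ ∞ r) {u : Eucl n → G} (hu : ContDiff ℝ ∞ u) (i : ℕ) :
    ContDiff ℝ ∞ (Function.uncurry fun x y => u (displaced x₀ R r i y x)) :=
  hu.comp (contDiff_displaced hr i)

lemma contDiff_displaced_right (hr : ContDiff ℝ ∞ r) (i : ℕ) (y : Eucl n) :
    ContDiff ℝ ∞ (displaced x₀ R r i y) :=
  (contDiff_displaced hr i).comp (f := fun x => (x, y)) (by fun_prop)

lemma continuous_displaced_left (i : ℕ) (x : Eucl n) :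
    Continuous fun y => displaced x₀ R r i y x := by
  unfold displaced
  fun_prop

lemma contDiff_smoothing_term (hr : ContDiff ℝ ∞ r) {u : Eucl n → G} (hu : ContDiff ℝ ∞ u) (i : ℕ) :
    ContDiff ℝ ∞ fun x => ∫ y, u (displaced x₀ R r i y x) ∂(unitBallMeasure n) :=
  contDiff_parametric_integral (isCompact_closedBall 0 1) (ae_mem_unitBallMeasure n)
    (contDiff_comp_displaced hr hu i)

lemma contDiff_smoothing (hr : ContDiff ℝ ∞ r) {u : Eucl n → G} (hu : ContDiff ℝ ∞ u) :
    ContDiff ℝ ∞ (smoothing k x₀ R r u) := by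
  unfold smoothing
  exact ContDiff.sum fun i _ => contDiff_const.smul (contDiff_smoothing_term hr hu i)

lemma integrable_comp_displaced {G : Type} [NormedAddCommGroup G] {u : Eucl n → G} (hu : Continuous u) (i : ℕ) (x : Eucl n) :
    Integrable (fun y => u (displaced x₀ R r i y x)) (unitBallMeasure n) :=
  integrable_unitBallMeasure (hu.comp (continuous_displaced_left i x))

lemma smoothing_sub {u v : Eucl n → G} (hu : Continuous u) (hv : Continuous v) (x : Eucl n) :
    smoothing k x₀ R r (u - v) x = smoothing k x₀ R r u x - smoothing k x₀ R r v x := by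
  unfold smoothing
  rw [← Finset.sum_sub_distrib]
  refine Finset.sum_congr rfl fun i _ => ?_
  rw [← smul_sub, ← integral_sub (integrable_comp_displaced hu i x)
    (integrable_comp_displaced hv i x)]
  rfl

lemma smoothing_polynomial [CompleteSpace G] {P : Eucl n → G} (hP : ContDiff ℝ ∞ P)
    (h0 : ∀ x, iteratedFDeriv ℝ k P x = 0) (x : Eucl n) : smoothing k x₀ R r P x = P x := by
  unfold smoothing
  simp_rw [← integral_smul]
  rw [← integral_finsetSum (f := fun i y => extrapCoeff k i • P (displaced x₀ R r i y x)) _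
    fun i _ => (integrable_comp_displaced hP.continuous i x).smul _]
  have : ∀ y, ∑ i ∈ Finset.range k, extrapCoeff k i • P (displaced x₀ R r i y x) = P x :=
    fun y => sum_extrapolation hP h0 x (r x • ((2 / R) • (x - x₀) + y))
  simp [this]

lemma smoothing_of_eq_zero [CompleteSpace G] (hk : 1 ≤ k) (u : Eucl n → G) {x : Eucl n} (hx : r x = 0) :
    smoothing k x₀ R r u x = u x := by
  -- All displaced points coincide with `x`, and as `k ≥ 1` constants are reproduced, so the weights
  -- add up to one.
  have h := smoothing_polynomial (k := k) (x₀ := x₀) (R := R) (r := r) (P := fun _ => u x)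
    contDiff_const (fun y => by rw [iteratedFDeriv_const_of_ne (by omega)]; rfl) x
  rw [← h]
  simp [smoothing, displaced, hx]

/-- Outside the half ball the drift `2(x - x₀)/R` is radial of length at least one and outweighs the
perturbation `y`, so displaced points never move inwards. Hence the smoothing sees only zeros of `u`
near and beyond the boundary sphere. -/
lemma norm_sub_le_norm_displaced_sub (hR : 0 < R) (hr : ∀ x, 0 ≤ r x) (i : ℕ) {x y : Eucl n}
    (hx : R / 2 ≤ ‖x - x₀‖) (hy : ‖y‖ ≤ 1) : ‖x - x₀‖ ≤ ‖displaced x₀ R r i y x - x₀‖ := by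
  set c : ℝ := ((i + 1 : ℕ) : ℝ) * r x with hc
  have hc0 : 0 ≤ c := mul_nonneg (Nat.cast_nonneg _) (hr x)
  have e : displaced x₀ R r i y x - x₀ = (1 + c * (2 / R)) • (x - x₀) - (-(c • y)) := by
    simp only [displaced, hc]
    module
  rw [e]
  have h1 := norm_sub_norm_le ((1 + c * (2 / R)) • (x - x₀)) (-(c • y))
  rw [norm_neg, norm_smul, norm_smul, Real.norm_of_nonneg hc0,
    Real.norm_of_nonneg (by positivity)] at h1
  refine le_trans ?_ h1
  have h2 : c * ‖y‖ ≤ c := mul_le_of_le_one_right hc0 hy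
  have h3 : 1 ≤ 2 / R * ‖x - x₀‖ := by
    rw [div_mul_eq_mul_div, le_div_iff₀ hR]; linarith
  nlinarith

lemma smoothing_eq_zero (hR : 0 < R) (hr : ∀ x, 0 ≤ r x) {u : Eucl n → G} {R' : ℝ} (hR' : R / 2 ≤ R')
    (hu : ∀ z, R' < ‖z - x₀‖ → u z = 0) {x : Eucl n} (hx : R' < ‖x - x₀‖) :
    smoothing k x₀ R r u x = 0 := by
  unfold smoothing
  refine Finset.sum_eq_zero fun i _ => ?_
  rw [integral_eq_zero_of_ae, smul_zero]
  filter_upwards [ae_mem_unitBallMeasure n] with y hy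
  refine hu _ (hx.trans_le (norm_sub_le_norm_displaced_sub hR hr i (by linarith) ?_))
  simpa using hy

end Smoothing

end LipTrunc

end

noncomputable section

namespace LipTrunc

variable {n : ℕ} {G : Type} [NormedAddCommGroup G] [NormedSpace ℝ G]

/-! ### Derivative estimates for the smoothing operator -/

lemma norm_iteratedFDeriv_le_of_fderiv_const {E : Type} [NormedAddCommGroup E] [NormedSpace ℝ E]
    {g : E → G} {T : E →L[ℝ] G} (hg : ∀ x, fderiv ℝ g x = T) {x : E} {c B : ℝ} (hc : 0 ≤ c)
    (hB : 0 ≤ B) (hT : ‖T‖ ≤ B * c) {m : ℕ} (hm : 1 ≤ m) :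
    ‖iteratedFDeriv ℝ m g x‖ ≤ B * c ^ m := by
  obtain ⟨m, rfl⟩ := Nat.exists_eq_add_of_le' hm
  have hconst : fderiv ℝ g = fun _ => T := funext hg
  rw [← norm_iteratedFDeriv_fderiv, hconst]
  rcases Nat.eq_zero_or_pos m with rfl | hmp
  · simpa using hT
  · rw [iteratedFDeriv_const_of_ne (by omega)]
    simp only [Pi.zero_apply, norm_zero]
    positivity

/-- Leibniz' rule for `r` times the affine map `x ↦ 2(x - x₀)/R + y`. That map is bounded by `4` and
its slope `2/R` by `4/d`, because `d ≤ 2R`; the sum of binomial coefficients gives `2ᵏ`, and `i + 1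
≤ k` the factor `k`. -/
lemma norm_iteratedFDeriv_displaced_le {k : ℕ} {x₀ : Eucl n} {R : ℝ} {r : Eucl n → ℝ} (hR : 0 < R)
    (hr : ContDiff ℝ ∞ r) {x : Eucl n} (hx : ‖x - x₀‖ ≤ R) {d C : ℝ} (hd : 0 < d) (hdR : d ≤ 2 * R)
    (hC : 0 ≤ C) (hrd : ∀ j ≤ k, ‖iteratedFDeriv ℝ j r x‖ ≤ C * d * d⁻¹ ^ j) {i : ℕ} (hi : i < k)
    {y : Eucl n} (hy : ‖y‖ ≤ 1) {j : ℕ} (hj1 : 1 ≤ j) (hj : j ≤ k) :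
    ‖iteratedFDeriv ℝ j (displaced x₀ R r i y) x‖ ≤ (1 + k * (4 * C * 2 ^ k)) * d * d⁻¹ ^ j := by
  set g : Eucl n → Eucl n := fun x => (2 / R) • (x - x₀) + y with hg
  have hgs : ContDiff ℝ ∞ g := by fun_prop
  have hg' : ∀ z, fderiv ℝ g z = (2 / R) • ContinuousLinearMap.id ℝ (Eucl n) := by
    intro z
    have h : HasFDerivAt g ((2 / R) • ContinuousLinearMap.id ℝ (Eucl n)) z :=
      (((hasFDerivAt_id z).sub_const x₀).const_smul (2 / R)).add_const y
    exact h.fderiv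
  have hgb : ∀ m, ‖iteratedFDeriv ℝ m g x‖ ≤ 4 * d⁻¹ ^ m := by
    intro m
    rcases Nat.eq_zero_or_pos m with rfl | hm
    · rw [norm_iteratedFDeriv_zero, pow_zero, mul_one]
      refine (norm_add_le _ _).trans ?_
      rw [norm_smul, Real.norm_of_nonneg (by positivity)]
      have : 2 / R * ‖x - x₀‖ ≤ 2 / R * R := by gcongr
      rw [div_mul_cancel₀ _ hR.ne'] at this
      linarith
    · refine norm_iteratedFDeriv_le_of_fderiv_const hg' (by positivity) (by norm_num) ?_ hm
      rw [norm_smul, Real.norm_of_nonneg (by positivity)]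
      refine (mul_le_of_le_one_right (by positivity) ContinuousLinearMap.norm_id_le).trans ?_
      rw [← div_eq_mul_inv, div_le_div_iff₀ hR hd]
      linarith
  have hid : ‖iteratedFDeriv ℝ j (fun z : Eucl n => z) x‖ ≤ d * d⁻¹ ^ j := by
    refine norm_iteratedFDeriv_le_of_fderiv_const (T := ContinuousLinearMap.id ℝ (Eucl n))
      (fun z => fderiv_fun_id) (by positivity) hd.le ?_ hj1
    rw [mul_inv_cancel₀ hd.ne']
    exact ContinuousLinearMap.norm_id_le
  have hrg : ‖iteratedFDeriv ℝ j (fun z => r z • g z) x‖ ≤ 4 * C * 2 ^ k * (d * d⁻¹ ^ j) := by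
    refine (norm_iteratedFDeriv_smul_le hr hgs x (by exact_mod_cast le_top)).trans ?_
    have hterm : ∀ m ∈ Finset.range (j + 1), (j.choose m : ℝ) * ‖iteratedFDeriv ℝ m r x‖ *
        ‖iteratedFDeriv ℝ (j - m) g x‖ ≤ (j.choose m : ℝ) * (4 * C * (d * d⁻¹ ^ j)) := by
      intro m hm
      have hmj : m ≤ j := Nat.lt_succ_iff.1 (Finset.mem_range.1 hm)
      calc _ ≤ (j.choose m : ℝ) * (C * d * d⁻¹ ^ m) * (4 * d⁻¹ ^ (j - m)) := by
            gcongr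
            · exact hrd m (hmj.trans hj)
            · exact hgb _
        _ = (j.choose m : ℝ) * (4 * C * (d * (d⁻¹ ^ m * d⁻¹ ^ (j - m)))) := by ring
        _ = _ := by rw [← pow_add, Nat.add_sub_cancel' hmj]
    refine (Finset.sum_le_sum hterm).trans ?_
    rw [← Finset.sum_mul, ← Nat.cast_sum, Nat.sum_range_choose]
    push_cast
    have : (2 : ℝ) ^ j ≤ 2 ^ k := pow_le_pow_right₀ (by norm_num) hj
    calc (2 : ℝ) ^ j * (4 * C * (d * d⁻¹ ^ j)) ≤ 2 ^ k * (4 * C * (d * d⁻¹ ^ j)) := by gcongr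
      _ = _ := by ring
  have hrgs : ContDiff ℝ ∞ (fun z => r z • g z) := hr.smul hgs
  have e : displaced x₀ R r i y = (fun z => z) + ((i + 1 : ℕ) : ℝ) • (fun z => r z • g z) := rfl
  have hc1 : ContDiffAt ℝ j (fun z : Eucl n => z) x := contDiff_id.contDiffAt
  have hrgj : ContDiff ℝ j (fun z => r z • g z) := hrgs.of_le (by exact_mod_cast le_top)
  have hc2 : ContDiffAt ℝ j (((i + 1 : ℕ) : ℝ) • (fun z => r z • g z)) x :=
    (hrgj.const_smul (((i + 1 : ℕ) : ℝ))).contDiffAt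
  rw [e, iteratedFDeriv_add_apply hc1 hc2,
    iteratedFDeriv_const_smul_apply hrgj.contDiffAt]
  refine (norm_add_le _ _).trans ?_
  rw [norm_smul, Real.norm_of_nonneg (Nat.cast_nonneg _)]
  have hik : ((i + 1 : ℕ) : ℝ) ≤ k := by exact_mod_cast hi
  calc _ ≤ d * d⁻¹ ^ j + (k : ℝ) * (4 * C * 2 ^ k * (d * d⁻¹ ^ j)) := by gcongr
    _ = _ := by ring

/-- The total weight `∑ᵢ |cᵢ|` of the extrapolation formula. -/
def extrapWeight (k : ℕ) : ℝ := ∑ i ∈ Finset.range k, |extrapCoeff k i|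

lemma extrapWeight_nonneg (k : ℕ) : 0 ≤ extrapWeight k := Finset.sum_nonneg fun _ _ => abs_nonneg _

lemma norm_iteratedFDeriv_smoothing_le_sum {k : ℕ} {x₀ : Eucl n} {R : ℝ} {r : Eucl n → ℝ}
    (hr : ContDiff ℝ ∞ r) {h : Eucl n → G} (hh : ContDiff ℝ ∞ h) (x : Eucl n) {A d : ℝ} (hA : 1 ≤ A)
    (hd : 0 < d)
    (hΨ : ∀ i < k, ∀ y : Eucl n, ‖y‖ ≤ 1 → ∀ j, 1 ≤ j → j ≤ k →
      ‖iteratedFDeriv ℝ j (displaced x₀ R r i y) x‖ ≤ A * d * d⁻¹ ^ j) {Q : ℝ}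
    (hQ : ∀ i < k, ∀ j ≤ k,
      ∫ y, ‖iteratedFDeriv ℝ j h (displaced x₀ R r i y x)‖ ∂(unitBallMeasure n) ≤ d⁻¹ ^ j * Q) :
    ‖iteratedFDeriv ℝ k (smoothing k x₀ R r h) x‖ ≤
      extrapWeight k * (k.factorial * A ^ k * d⁻¹ ^ k * ((k + 1) * Q)) := by
  have hterm : ∀ i < k, ‖iteratedFDeriv ℝ k
      (fun x => ∫ y, h (displaced x₀ R r i y x) ∂(unitBallMeasure n)) x‖ ≤
      k.factorial * A ^ k * d⁻¹ ^ k * ((k + 1) * Q) := by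
    intro i hi
    have hcont : ∀ j : ℕ, Continuous fun y => ‖iteratedFDeriv ℝ j h (displaced x₀ R r i y x)‖ :=
      fun j => (continuous_norm_iteratedFDeriv hh j).comp (continuous_displaced_left i x)
    refine (norm_iteratedFDeriv_parametric_integral_le (isCompact_closedBall 0 1)
      (ae_mem_unitBallMeasure n) k (contDiff_comp_displaced hr hh i) x).trans ?_
    have hmono : ∫ y, ‖iteratedFDeriv ℝ k (fun x' => h (displaced x₀ R r i y x')) x‖
        ∂(unitBallMeasure n) ≤ ∫ y, k.factorial * A ^ k * d⁻¹ ^ k *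
          ∑ j ∈ Finset.range (k + 1), d ^ j * ‖iteratedFDeriv ℝ j h (displaced x₀ R r i y x)‖
          ∂(unitBallMeasure n) := by
      refine integral_mono_of_nonneg (Eventually.of_forall fun _ => norm_nonneg _) ?_ ?_
      · exact integrable_unitBallMeasure (continuous_const.mul
          (continuous_finsetSum _ fun j _ => continuous_const.mul (hcont j)))
      · filter_upwards [ae_mem_unitBallMeasure n] with y hy
        exact norm_iteratedFDeriv_comp_le_scaled hh (contDiff_displaced_right hr i y) hA hd
          (hΨ i hi y (by simpa using hy))
    refine hmono.trans ?_
    rw [integral_const_mul]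
    refine mul_le_mul_of_nonneg_left ?_ (by positivity)
    rw [integral_finsetSum _ fun j _ => (integrable_unitBallMeasure (hcont j)).const_mul _]
    have : ∀ j ∈ Finset.range (k + 1), ∫ y, d ^ j * ‖iteratedFDeriv ℝ j h (displaced x₀ R r i y x)‖
        ∂(unitBallMeasure n) ≤ Q := by
      intro j hj
      rw [integral_const_mul]
      calc _ ≤ d ^ j * (d⁻¹ ^ j * Q) := by
            gcongr
            exact hQ i hi j (Nat.lt_succ_iff.1 (Finset.mem_range.1 hj))
        _ = Q := by rw [← mul_assoc, ← mul_pow, mul_inv_cancel₀ hd.ne', one_pow, one_mul]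
    refine (Finset.sum_le_sum this).trans_eq ?_
    simp
  have hs : ∀ i, ContDiff ℝ k fun x => ∫ y, h (displaced x₀ R r i y x) ∂(unitBallMeasure n) :=
    fun i => (contDiff_smoothing_term hr hh i).of_le (by exact_mod_cast le_top)
  have e : smoothing k x₀ R r h = fun x => ∑ i ∈ Finset.range k,
      (extrapCoeff k i • fun x => ∫ y, h (displaced x₀ R r i y x) ∂(unitBallMeasure n)) x := rfl
  have hc : ∀ i ∈ Finset.range k, ContDiffAt ℝ k (extrapCoeff k i •
      fun x => ∫ y, h (displaced x₀ R r i y x) ∂(unitBallMeasure n)) x :=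
    fun i _ => ((hs i).const_smul _).contDiffAt
  rw [e, iteratedFDeriv_fun_sum_apply hc]
  refine (norm_sum_le _ _).trans ?_
  rw [extrapWeight, Finset.sum_mul]
  refine Finset.sum_le_sum fun i hi => ?_
  rw [iteratedFDeriv_const_smul_apply (hs i).contDiffAt, norm_smul, Real.norm_eq_abs]
  exact mul_le_mul_of_nonneg_left (hterm i (Finset.mem_range.1 hi)) (abs_nonneg _)

/-- The derivative of the smoothing at `x` is controlled by averages of `|Dᵏu|` along segments
that emanate from a point `w`. -/
lemma norm_iteratedFDeriv_smoothing_le [CompleteSpace G] {k : ℕ} {x₀ : Eucl n} {R : ℝ} {r : Eucl n → ℝ}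
    (hr : ContDiff ℝ ∞ r) {u : Eucl n → G} (hu : ContDiff ℝ ∞ u) (x w : Eucl n) {A B d S : ℝ}
    (hA : 1 ≤ A) (hB : 1 ≤ B) (hd : 0 < d) (hS : 0 ≤ S)
    (hΨ : ∀ i < k, ∀ y : Eucl n, ‖y‖ ≤ 1 → ∀ j, 1 ≤ j → j ≤ k →
      ‖iteratedFDeriv ℝ j (displaced x₀ R r i y) x‖ ≤ A * d * d⁻¹ ^ j)
    (hw : ∀ i < k, ∀ y : Eucl n, ‖y‖ ≤ 1 → ‖displaced x₀ R r i y x - w‖ ≤ B * d)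
    (hav : ∀ i < k, ∀ s : ℝ, 0 < s → s ≤ 1 → ∫ y, ‖iteratedFDeriv ℝ k u
      (w + s • (displaced x₀ R r i y x - w))‖ ∂(unitBallMeasure n) ≤ S) :
    ‖iteratedFDeriv ℝ k (smoothing k x₀ R r u) x‖ ≤
      extrapWeight k * (k.factorial * A ^ k * ((k + 1) * B ^ k)) * S := by
  -- The smoothing fixes `P`, whose `k`-th derivative vanishes, so `u` may be replaced by `u - P`:
  -- the `k`-th derivatives are unchanged, and those of lower order now vanish at `w`.
  obtain ⟨P, hP, hP0, hPw⟩ := exists_taylor_polynomial hu w k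
  have hdiff : ∀ j z, iteratedFDeriv ℝ j (u - P) z =
      iteratedFDeriv ℝ j u z - iteratedFDeriv ℝ j P z := fun j z =>
    iteratedFDeriv_sub_apply (hu.of_le (by exact_mod_cast le_top)).contDiffAt
      (hP.of_le (by exact_mod_cast le_top)).contDiffAt
  have hh : ContDiff ℝ ∞ (u - P) := hu.sub hP
  have hhk : ∀ z, iteratedFDeriv ℝ k (u - P) z = iteratedFDeriv ℝ k u z := fun z => by
    rw [hdiff, hP0, sub_zero]
  have hhw : ∀ j < k, iteratedFDeriv ℝ j (u - P) w = 0 := fun j hj => by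
    rw [hdiff, hPw j hj, sub_self]
  have hred : iteratedFDeriv ℝ k (smoothing k x₀ R r u) x =
      iteratedFDeriv ℝ k (smoothing k x₀ R r (u - P)) x := by
    have e : smoothing k x₀ R r (u - P) = smoothing k x₀ R r u - P := by
      funext z
      rw [smoothing_sub hu.continuous hP.continuous, smoothing_polynomial hP hP0]
      rfl
    rw [e, iteratedFDeriv_sub_apply
      ((contDiff_smoothing hr hu).of_le (by exact_mod_cast le_top)).contDiffAt
      (hP.of_le (by exact_mod_cast le_top)).contDiffAt, hP0, sub_zero]
  have hBd : 0 ≤ B * d := by positivity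
  have hQ : ∀ i < k, ∀ j ≤ k, ∫ y, ‖iteratedFDeriv ℝ j (u - P) (displaced x₀ R r i y x)‖
      ∂(unitBallMeasure n) ≤ d⁻¹ ^ j * (B ^ k * d ^ k * S) := by
    intro i hi j hj
    have hbound : ∫ y, ‖iteratedFDeriv ℝ j (u - P) (displaced x₀ R r i y x)‖
        ∂(unitBallMeasure n) ≤ (B * d) ^ (k - j) * S := by
      rcases hj.lt_or_eq with hjk | rfl
      · set Φ : Eucl n → ℝ → ℝ := fun y s =>
          ‖iteratedFDeriv ℝ k u (w + s • (displaced x₀ R r i y x - w))‖ with hΦ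
        have hΦc : Continuous (Function.uncurry Φ) := by
          refine (continuous_norm_iteratedFDeriv hu k).comp
            (f := fun p : Eucl n × ℝ => w + p.2 • (displaced x₀ R r i p.1 x - w)) ?_
          have := (continuous_displaced_left (x₀ := x₀) (R := R) (r := r) i x).comp
            (continuous_fst (X := Eucl n) (Y := ℝ))
          exact continuous_const.add (continuous_snd.smul (this.sub continuous_const))
        have hinteg : Integrable (Function.uncurry Φ)
            ((unitBallMeasure n).prod (volume.restrict (Ioc (0 : ℝ) 1))) := by
          refine integrable_of_continuous_of_ae_mem_compact
            ((isCompact_closedBall (0 : Eucl n) 1).prod (isCompact_Icc (a := (0 : ℝ)) (b := 1)))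
            ?_ hΦc
          have h1 := Measure.quasiMeasurePreserving_fst (μ := unitBallMeasure n)
            (ν := volume.restrict (Ioc (0 : ℝ) 1)) |>.ae (ae_mem_unitBallMeasure n)
          have h2 := Measure.quasiMeasurePreserving_snd (μ := unitBallMeasure n)
            (ν := volume.restrict (Ioc (0 : ℝ) 1)) |>.ae (ae_restrict_mem measurableSet_Ioc)
          filter_upwards [h1, h2] with p hp1 hp2
          exact ⟨hp1, Ioc_subset_Icc_self hp2⟩
        have hpt : ∀ y : Eucl n, ‖y‖ ≤ 1 →
            ‖iteratedFDeriv ℝ j (u - P) (displaced x₀ R r i y x)‖ ≤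
              (B * d) ^ (k - j) * ∫ s in Ioc (0 : ℝ) 1, Φ y s := by
          intro y hy
          have h1 := norm_iteratedFDeriv_le_integral_of_vanishing hh hhw
            (displaced x₀ R r i y x - w) hjk (t := 1) ⟨zero_le_one, le_rfl⟩
          rw [one_smul, add_sub_cancel, intervalIntegral.integral_of_le zero_le_one] at h1
          simp only [hhk] at h1
          refine h1.trans (mul_le_mul_of_nonneg_right ?_ (integral_nonneg fun _ => norm_nonneg _))
          exact pow_le_pow_left₀ (norm_nonneg _) (hw i hi y hy) _
        -- Fubini puts the average over `y` inside: for fixed `s` it is the quantity bounded by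
        -- `hav`, whereas a single segment is a null set.
        calc _ ≤ ∫ y, ((B * d) ^ (k - j) * ∫ s in Ioc (0 : ℝ) 1, Φ y s) ∂(unitBallMeasure n) := by
              refine integral_mono_of_nonneg (Eventually.of_forall fun _ => norm_nonneg _) ?_ ?_
              · exact hinteg.integral_prod_left.const_mul _
              · filter_upwards [ae_mem_unitBallMeasure n] with y hy
                exact hpt y (by simpa using hy)
          _ = (B * d) ^ (k - j) * ∫ s in Ioc (0 : ℝ) 1, ∫ y, Φ y s ∂(unitBallMeasure n) := by
              rw [integral_const_mul, integral_integral_swap hinteg]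
          _ ≤ (B * d) ^ (k - j) * ∫ s in Ioc (0 : ℝ) 1, S := by
              refine mul_le_mul_of_nonneg_left ?_ (by positivity)
              refine setIntegral_mono_on hinteg.integral_prod_right (integrable_const _)
                measurableSet_Ioc fun s hs => hav i hi s hs.1 hs.2
          _ = (B * d) ^ (k - j) * S := by simp
      · simp only [hhk, Nat.sub_self, pow_zero, one_mul]
        have := hav i hi 1 one_pos le_rfl
        simpa using this
    refine hbound.trans ?_
    have e1 : d ^ k = d ^ j * d ^ (k - j) := by rw [← pow_add, Nat.add_sub_cancel' hj]
    have e2 : d⁻¹ ^ j * d ^ j = 1 := by rw [← mul_pow, inv_mul_cancel₀ hd.ne', one_pow]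
    have e3 : d⁻¹ ^ j * (B ^ k * d ^ k * S) = B ^ k * d ^ (k - j) * S := by
      rw [e1]
      linear_combination (B ^ k * d ^ (k - j) * S) * e2
    rw [e3, mul_pow]
    have : B ^ (k - j) ≤ B ^ k := pow_le_pow_right₀ hB (Nat.sub_le _ _)
    gcongr
  rw [hred]
  refine (norm_iteratedFDeriv_smoothing_le_sum hr hh x hA hd hΨ hQ).trans_eq ?_
  have e2 : d⁻¹ ^ k * d ^ k = 1 := by rw [← mul_pow, inv_mul_cancel₀ hd.ne', one_pow]
  linear_combination (extrapWeight k * k.factorial * A ^ k * (k + 1) * B ^ k * S) * e2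

end LipTrunc

end

noncomputable section

namespace LipTrunc

variable {n : ℕ} {G : Type} [NormedAddCommGroup G] [NormedSpace ℝ G]

/-! ### Truncation of test functions -/

lemma iteratedFDeriv_eq_zero_of_notMem {Ω : Set (Eucl n)} {u : Eucl n → G}
    (hu : IsTestFunction Ω u) {x : Eucl n} (hx : x ∉ Ω) (j : ℕ) :
    iteratedFDeriv ℝ j u x = 0 := by
  have h : x ∉ tsupport u := fun h => hx (hu.2.2 h)
  have hs := support_iteratedFDeriv_subset (𝕜 := ℝ) (f := u) j
  by_contra hne
  exact h (hs hne)

lemma exists_closedBall_of_isTestFunction {x₀ : Eucl n} {R : ℝ} (hR : 0 < R) {u : Eucl n → G}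
    (hu : IsTestFunction (Metric.ball x₀ R) u) :
    ∃ R', R / 2 ≤ R' ∧ R' < R ∧ ∀ z, R' < ‖z - x₀‖ → u z = 0 := by
  obtain ⟨R', hR', hsub⟩ := exists_lt_subset_ball (isClosed_tsupport u) hu.2.2
  refine ⟨max R' (R / 2), le_max_right _ _, max_lt hR' (by linarith), fun z hz => ?_⟩
  by_contra hne
  have := hsub (subset_tsupport u hne)
  rw [Metric.mem_ball, dist_eq_norm] at this
  exact absurd (le_max_left R' (R / 2)) (not_le.2 (hz.trans this))

lemma isTestFunction_ball_of_eq_zero {x₀ : Eucl n} {R R' : ℝ} (hR' : R' < R) {v : Eucl n → G}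
    (hv : ContDiff ℝ ∞ v) (h0 : ∀ z, R' < ‖z - x₀‖ → v z = 0) :
    IsTestFunction (Metric.ball x₀ R) v := by
  have hsub : tsupport v ⊆ Metric.closedBall x₀ R' := by
    refine closure_minimal (fun z hz => ?_) Metric.isClosed_closedBall
    rw [Metric.mem_closedBall, dist_eq_norm]
    exact not_lt.1 fun h => hz (h0 z h)
  exact ⟨hv, HasCompactSupport.of_support_subset_isCompact (isCompact_closedBall x₀ R')
    ((subset_tsupport v).trans hsub), hsub.trans (Metric.closedBall_subset_ball hR')⟩

/-- In `2 + 6k` the distance from `x` to `w` contributes `2`, the drift `4k` and the radius swept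
out by `y` another `2k`. The first bound measures the whole ball of displaced points as seen from
`w`, the second a single point. -/
lemma norm_displaced_sub_le {x₀ : Eucl n} {R : ℝ} (hR : 0 < R) {r : Eucl n → ℝ} {k i : ℕ}
    (hi : i < k) {x w y : Eucl n} {d : ℝ} (hx : ‖x - x₀‖ ≤ R) (hy : ‖y‖ ≤ 1) (hr0 : 0 ≤ r x)
    (hr : r x ≤ 2 * d) (hw : ‖x - w‖ ≤ 2 * d) :
    ‖displaced x₀ R r i 0 x - w‖ + (i + 1 : ℕ) * r x ≤ (2 + 6 * k) * d ∧
      ‖displaced x₀ R r i y x - w‖ ≤ (2 + 6 * k) * d := by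
  have hik : ((i + 1 : ℕ) : ℝ) ≤ k := by exact_mod_cast hi
  have hi0 : (0 : ℝ) ≤ ((i + 1 : ℕ) : ℝ) := Nat.cast_nonneg _
  have hcr : ((i + 1 : ℕ) : ℝ) * r x ≤ k * (2 * d) := by gcongr
  have h1 : ‖displaced x₀ R r i 0 x - w‖ ≤ 2 * d + 2 * (((i + 1 : ℕ) : ℝ) * r x) := by
    have e : displaced x₀ R r i 0 x - w =
        (x - w) + (((i + 1 : ℕ) : ℝ) * r x * (2 / R)) • (x - x₀) := by
      simp only [displaced]
      module
    rw [e]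
    refine (norm_add_le _ _).trans (add_le_add hw ?_)
    rw [norm_smul, Real.norm_of_nonneg (by positivity)]
    calc _ ≤ ((i + 1 : ℕ) : ℝ) * r x * (2 / R) * R := by gcongr
      _ = _ := by field_simp
  have h2 : ‖displaced x₀ R r i y x - w‖ ≤
      ‖displaced x₀ R r i 0 x - w‖ + ((i + 1 : ℕ) : ℝ) * r x := by
    have e : displaced x₀ R r i y x - w =
        (displaced x₀ R r i 0 x - w) + (((i + 1 : ℕ) : ℝ) * r x) • y := by
      simp only [displaced]
      module
    rw [e]
    refine (norm_add_le _ _).trans (add_le_add le_rfl ?_)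
    rw [norm_smul, Real.norm_of_nonneg (by positivity)]
    exact mul_le_of_le_one_right (by positivity) hy
  constructor <;> linarith

/-- Smooth truncation of a test function, at a level `l`. -/
theorem exists_smooth_truncation (n k : ℕ) (hk : 1 ≤ k) : ∃ C : ℝ, 1 ≤ C ∧
    ∀ (G : Type) [NormedAddCommGroup G] [NormedSpace ℝ G] [CompleteSpace G]
      (x₀ : Eucl n) (R : ℝ), 0 < R → ∀ u : Eucl n → G, IsTestFunction (Metric.ball x₀ R) u →
      ∀ l : ℝ, 0 < l → ∃ v : Eucl n → G, IsTestFunction (Metric.ball x₀ R) v ∧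
        (∀ x, ‖iteratedFDeriv ℝ k v x‖ ≤ C * l) ∧
        ∀ x ∈ goodSet k u l, v x = u x ∧ iteratedFDeriv ℝ k v x = iteratedFDeriv ℝ k u x := by
  obtain ⟨Cr, hCr, Hr⟩ := exists_regularized_distance n k
  set A : ℝ := 1 + k * (4 * Cr * 2 ^ k) with hA
  set B : ℝ := 2 + 6 * k with hB
  have hA1 : 1 ≤ A := by rw [hA]; linarith [show 0 ≤ (k : ℝ) * (4 * Cr * 2 ^ k) by positivity]
  have hB1 : 1 ≤ B := by rw [hB]; linarith [show (0 : ℝ) ≤ 6 * k by positivity]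
  -- The power is the ratio of volumes where `r` is comparable to the distance; `2` serves the layer
  -- close to `F`.
  set K : ℝ := (6 * B) ^ n + 2 with hK
  have hK2 : 2 ≤ K := by rw [hK]; linarith [show (0 : ℝ) ≤ (6 * B) ^ n by positivity]
  set C₀ : ℝ := extrapWeight k * (k.factorial * A ^ k * ((k + 1) * B ^ k)) with hC₀
  have hC₀0 : 0 ≤ C₀ := mul_nonneg (extrapWeight_nonneg k) (by positivity)
  refine ⟨C₀ * K + 2, by nlinarith, ?_⟩
  intro G _ _ _ x₀ R hR u hu l hl
  have hCl : 0 ≤ (C₀ * K + 2) * l := by positivity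
  set F := goodSet k u l with hF
  have hmem : ∀ j, ∀ x ∉ Metric.ball x₀ R, iteratedFDeriv ℝ j u x = 0 := fun j x hx =>
    iteratedFDeriv_eq_zero_of_notMem hu hx j
  -- If `F` misses the ball, then `u` and its derivatives vanish on `F`, and the zero function is a
  -- truncation.
  by_cases hne : (F ∩ Metric.ball x₀ R).Nonempty
  swap
  · refine ⟨0, ⟨contDiff_const, HasCompactSupport.zero, by simp⟩, fun x => ?_, fun x hx => ?_⟩
    · have : iteratedFDeriv ℝ k (0 : Eucl n → G) x = 0 := by
        rw [show (0 : Eucl n → G) = fun _ => 0 from rfl, iteratedFDeriv_fun_zero]; rfl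
      rwa [this, norm_zero]
    · have hxb : x ∉ Metric.ball x₀ R := fun h => hne ⟨x, hx, h⟩
      constructor
      · have h0 := hmem 0 x hxb
        have := congrArg (fun M => M (fun _ => 0)) h0
        simpa using this.symm
      · rw [hmem k x hxb, show (0 : Eucl n → G) = fun _ => 0 from rfl, iteratedFDeriv_fun_zero]
        rfl
  obtain ⟨p, hpF, hpb⟩ := hne
  have hFne : F.Nonempty := ⟨p, hpF⟩
  have hus : ContDiff ℝ ∞ u := hu.1
  set f : Eucl n → ℝ := fun x => ‖iteratedFDeriv ℝ k u x‖ with hf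
  have hfc : Continuous f := continuous_norm_iteratedFDeriv hus k
  have hfu : UniformContinuous f :=
    (hu.2.1.iteratedFDeriv (𝕜 := ℝ) k).norm.uniformContinuous_of_continuous hfc
  obtain ⟨δ, hδ, hδf⟩ := Metric.uniformContinuous_iff.1 hfu l hl
  -- A pointwise bound near `F` from uniform continuity. It covers the layer where `r` is switched
  -- off; `δ` depends on `u`, but no constant in the conclusion does.
  have hnear : ∀ w ∈ F, ∀ z, dist z w < δ → f z ≤ 2 * l := by
    intro w hw z hz
    have h1 := hδf hz
    rw [Real.dist_eq] at h1
    have h2 : f w ≤ l := norm_le_of_mem_goodSet hus hw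
    linarith [le_abs_self (f z - f w)]
  -- Chosen so that points at distance at most `3 B ε` from `F` stay within `δ`.
  set ε : ℝ := δ / (6 * B) with hε
  have hε0 : 0 < ε := by positivity
  have hεB : 3 * B * ε < δ := by
    have : 3 * B * ε = δ / 2 := by rw [hε]; field_simp; norm_num
    linarith
  obtain ⟨r, hrs, hr0, hrz, hr2, hr6, hrd⟩ := Hr F ε (2 * R) hε0
  obtain ⟨R', hR'1, hR'2, hR'u⟩ := exists_closedBall_of_isTestFunction hR hu
  have hTs := contDiff_smoothing (k := k) (x₀ := x₀) (R := R) hrs hus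
  have hT0 : ∀ z, R' < ‖z - x₀‖ → smoothing k x₀ R r u z = 0 := fun z hz =>
    smoothing_eq_zero hR hr0 hR'1 hR'u hz
  have hTtest := isTestFunction_ball_of_eq_zero hR'2 hTs hT0
  have heq : ∀ x, Metric.infDist x F ≤ ε → smoothing k x₀ R r u x = u x := fun x hx =>
    smoothing_of_eq_zero hk u (hrz x hx)
  have heqD : ∀ x, Metric.infDist x F < ε →
      iteratedFDeriv ℝ k (smoothing k x₀ R r u) x = iteratedFDeriv ℝ k u x := by
    intro x hx
    have hev : smoothing k x₀ R r u =ᶠ[𝓝 x] u := by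
      filter_upwards [(isOpen_lt (Metric.continuous_infDist_pt F) continuous_const).mem_nhds hx]
        with y hy
      exact heq y (le_of_lt hy)
    exact (hev.iteratedFDeriv ℝ k).eq_of_nhds
  refine ⟨smoothing k x₀ R r u, hTtest, fun x => ?_, fun x hx => ?_⟩
  swap
  · have h0 : Metric.infDist x F = 0 := Metric.infDist_zero_of_mem hx
    exact ⟨heq x (by rw [h0]; exact hε0.le), heqD x (by rw [h0]; exact hε0)⟩
  by_cases hxb : x ∈ Metric.ball x₀ R
  swap
  · rwa [iteratedFDeriv_eq_zero_of_notMem hTtest hxb, norm_zero]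
  set d := Metric.infDist x F with hd
  -- Points of the closure of `F` are handled by the uniform continuity of `|Dᵏu|`. At positive
  -- distance `w` is a nearly nearest point of `F`.
  rcases (Metric.infDist_nonneg (x := x) (s := F)).eq_or_lt with hd0 | hd0
  · rw [heqD x (by rw [← hd0]; exact hε0)]
    obtain ⟨w, hw, hxw⟩ := (Metric.infDist_lt_iff hFne).1 (by rw [← hd0]; exact hδ : Metric.infDist x F < δ)
    have h1 : f x ≤ 2 * l := hnear w hw x hxw
    have : 0 ≤ C₀ * K * l := by positivity
    change f x ≤ _
    linarith
  have hd0' : 0 < d := hd0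
  obtain ⟨w, hw, hxw⟩ := (Metric.infDist_lt_iff hFne).1 (show Metric.infDist x F < 2 * d by linarith)
  have hxR : ‖x - x₀‖ ≤ R := by rw [← dist_eq_norm]; exact le_of_lt hxb
  have hxw' : ‖x - w‖ ≤ 2 * d := by rw [← dist_eq_norm]; exact hxw.le
  have hdR : d ≤ 2 * R := by
    have h1 : d ≤ dist x p := Metric.infDist_le_dist_of_mem hpF
    have h2 := dist_triangle_right x p x₀
    have h3 : dist x x₀ < R := hxb
    have h4 : dist p x₀ < R := hpb
    linarith
  have hgeo : ∀ i < k, ∀ y : Eucl n, ‖y‖ ≤ 1 →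
      ‖displaced x₀ R r i 0 x - w‖ + (i + 1 : ℕ) * r x ≤ B * d ∧
        ‖displaced x₀ R r i y x - w‖ ≤ B * d := fun i hi y hy =>
    norm_displaced_sub_le hR hi hxR hy (hr0 x) (hr2 x) hxw'
  have hav : ∀ i < k, ∀ s : ℝ, 0 < s → s ≤ 1 →
      ∫ y, f (w + s • (displaced x₀ R r i y x - w)) ∂(unitBallMeasure n) ≤ K * l := by
    intro i hi s hs0 hs1
    -- For `d ≥ 3ε` the points fill a ball of radius `s(i+1)r(x)` inside the ball of radius `sBd`
    -- about `w`, and the ratio of the radii is at most `6B` uniformly in `s`. For smaller `d` that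
    -- ball may degenerate, but all points lie in the `δ`-neighbourhood of `F`.
    rcases le_or_gt (3 * ε) d with hreg | htrans
    · have h6 := hr6 x hreg hdR
      have hrpos : 0 < r x := by linarith
      have hi1 : (1 : ℝ) ≤ ((i + 1 : ℕ) : ℝ) := by exact_mod_cast Nat.le_add_left 1 i
      have hi0 : (0 : ℝ) < ((i + 1 : ℕ) : ℝ) := by positivity
      set c : ℝ := s * (((i + 1 : ℕ) : ℝ) * r x) with hc
      have hc0 : 0 < c := by positivity
      have e : ∀ y, w + s • (displaced x₀ R r i y x - w) =
          w + s • (displaced x₀ R r i 0 x - w) + c • y := by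
        intro y
        simp only [displaced, hc]
        module
      rw [integral_congr_ae (Eventually.of_forall fun y => congrArg f (e y))]
      have hρ : ‖s • (displaced x₀ R r i 0 x - w)‖ + c ≤ s * (B * d) := by
        rw [norm_smul, Real.norm_of_nonneg hs0.le, hc, ← mul_add]
        exact mul_le_mul_of_nonneg_left (hgeo i hi 0 (by simp)).1 hs0.le
      refine (integral_unitBall_affine_le hus hw hc0 hρ).trans ?_
      have hratio : s * (B * d) / c ≤ 6 * B := by
        rw [div_le_iff₀ hc0, hc]
        have h7 : d ≤ 6 * (((i + 1 : ℕ) : ℝ) * r x) := by nlinarith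
        calc s * (B * d) ≤ s * (B * (6 * (((i + 1 : ℕ) : ℝ) * r x))) := by gcongr
          _ = _ := by ring
      have : (s * (B * d) / c) ^ n ≤ (6 * B) ^ n := pow_le_pow_left₀ (by positivity) hratio n
      refine mul_le_mul_of_nonneg_right ?_ hl.le
      linarith
    · have hle : ∀ᵐ y ∂(unitBallMeasure n), f (w + s • (displaced x₀ R r i y x - w)) ≤ 2 * l := by
        filter_upwards [ae_mem_unitBallMeasure n] with y hy
        refine hnear w hw _ ?_
        rw [dist_eq_norm, add_sub_cancel_left, norm_smul, Real.norm_of_nonneg hs0.le]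
        have h1 := (hgeo i hi y (by simpa using hy)).2
        have h2 : s * ‖displaced x₀ R r i y x - w‖ ≤ ‖displaced x₀ R r i y x - w‖ :=
          mul_le_of_le_one_left (norm_nonneg _) hs1
        have h3 : B * d ≤ B * (3 * ε) := by gcongr
        linarith
      have h1 : ∫ y, f (w + s • (displaced x₀ R r i y x - w)) ∂(unitBallMeasure n) ≤
          ∫ _, 2 * l ∂(unitBallMeasure n) :=
        integral_mono_of_nonneg (Eventually.of_forall fun _ => norm_nonneg _)
          (integrable_const _) hle
      simp only [integral_const, probReal_univ, smul_eq_mul, one_mul] at h1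
      nlinarith
  have hfinal := norm_iteratedFDeriv_smoothing_le hrs hus x w (S := K * l) hA1 hB1 hd0' (by positivity)
    (fun i hi y hy j hj1 hj => norm_iteratedFDeriv_displaced_le hR hrs hxR hd0' hdR (by linarith)
      (fun j hj => hrd j hj x hd0) hi hy hj1 hj)
    (fun i hi y hy => (hgeo i hi y hy).2) hav
  refine hfinal.trans ?_
  rw [← hC₀]
  linarith

end LipTrunc

end

noncomputable section

namespace LipTrunc

/-! ### N-functions -/

namespace IsNFunction

variable {φ : ℝ → ℝ}

lemma map_zero (hφ : IsNFunction φ) : φ 0 = 0 := (hφ.eq_zero_iff 0 le_rfl).2 rfl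

lemma pos (hφ : IsNFunction φ) {t : ℝ} (ht : 0 < t) : 0 < φ t :=
  (hφ.nonneg t ht.le).lt_of_ne fun h => ht.ne' ((hφ.eq_zero_iff t ht.le).1 h.symm)

lemma mono (hφ : IsNFunction φ) {s t : ℝ} (hs : 0 ≤ s) (hst : s ≤ t) : φ s ≤ φ t :=
  hφ.monotoneOn hs (hs.trans hst) hst

lemma continuous_comp (hφ : IsNFunction φ) {X : Type*} [TopologicalSpace X] {f : X → ℝ}
    (hf : Continuous f) (h0 : ∀ x, 0 ≤ f x) : Continuous fun x => φ (f x) :=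
  hφ.continuousOn.comp_continuous hf h0

lemma measurable_comp (hφ : IsNFunction φ) {X : Type*} [MeasurableSpace X] {μ : Measure X}
    {f : X → ℝ} (hf : AEMeasurable f μ) (h0 : ∀ x, 0 ≤ f x) : AEMeasurable (fun x => φ (f x)) μ := by
  have hc : Continuous fun t : ℝ => φ (max t 0) :=
    hφ.continuous_comp (by fun_prop) fun t => le_max_right _ _
  refine (hc.measurable.comp_aemeasurable hf).congr (Eventually.of_forall fun x => ?_)
  simp [max_eq_left (h0 x)]

lemma map_mul_le (hφ : IsNFunction φ) {s t : ℝ} (hs : 0 ≤ s) (hs1 : s ≤ 1) (ht : 0 ≤ t) :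
    φ (s * t) ≤ s * φ t := by
  have := hφ.convexOn.2 (x := t) (y := 0) ht (le_refl (0 : ℝ)) hs (sub_nonneg.2 hs1) (by ring)
  simpa [hφ.map_zero] using this

lemma map_add_le (hφ : IsNFunction φ) {s t : ℝ} (hs : 0 ≤ s) (ht : 0 ≤ t) :
    φ (s + t) ≤ φ (2 * s) + φ (2 * t) := by
  have h1 := hφ.nonneg (2 * s) (by linarith)
  have h2 := hφ.nonneg (2 * t) (by linarith)
  rcases le_total s t with h | h
  · linarith [hφ.mono (s := s + t) (t := 2 * t) (by linarith) (by linarith)]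
  · linarith [hφ.mono (s := s + t) (t := 2 * s) (by linarith) (by linarith)]

lemma one_le_delta2Const (h2 : Delta2 φ) : 1 ≤ delta2Const φ :=
  le_csInf h2 fun _ hC => hC.1

/-- The infimum defining the doubling constant is itself admissible: it dominates each quotient
`φ(2t)/φ(t)`. -/
lemma map_two_mul_le (hφ : IsNFunction φ) (h2 : Delta2 φ) {t : ℝ} (ht : 0 ≤ t) :
    φ (2 * t) ≤ delta2Const φ * φ t := by
  rcases ht.eq_or_lt with rfl | htp
  · simp [hφ.map_zero]
  · rw [← div_le_iff₀ (hφ.pos htp)]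
    refine le_csInf h2 fun C hC => ?_
    rw [div_le_iff₀ (hφ.pos htp)]
    exact hC.2 t ht

lemma map_two_pow_mul_le (hφ : IsNFunction φ) (h2 : Delta2 φ) {t : ℝ} (ht : 0 ≤ t) (p : ℕ) :
    φ (2 ^ p * t) ≤ delta2Const φ ^ p * φ t := by
  induction p with
  | zero => simp
  | succ p ih =>
    have h := hφ.map_two_mul_le h2 (t := 2 ^ p * t) (by positivity)
    rw [pow_succ', mul_assoc, pow_succ', mul_assoc]
    exact h.trans (mul_le_mul_of_nonneg_left ih (zero_le_one.trans (one_le_delta2Const h2)))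

lemma map_mul_le_of_le_two_pow (hφ : IsNFunction φ) (h2 : Delta2 φ) {c t : ℝ} (hc : 0 ≤ c)
    (ht : 0 ≤ t) {p : ℕ} (hp : c ≤ 2 ^ p) : φ (c * t) ≤ delta2Const φ ^ p * φ t :=
  (hφ.mono (by positivity) (by gcongr)).trans (hφ.map_two_pow_mul_le h2 ht p)

lemma tendsto_zero_of_comp {ι : Type*} {F : Filter ι} (hφ : IsNFunction φ) {a : ι → ℝ}
    (ha : ∀ i, 0 ≤ a i) (h : Tendsto (fun i => φ (a i)) F (𝓝 0)) : Tendsto a F (𝓝 0) := by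
  rw [Metric.tendsto_nhds]
  intro ε hε
  filter_upwards [h.eventually (gt_mem_nhds (hφ.pos hε))] with i hi
  rw [Real.dist_eq, sub_zero, abs_of_nonneg (ha i)]
  by_contra! hcon
  exact absurd hi (not_lt.2 (hφ.mono hε.le hcon))

end IsNFunction

/-! ### The weak-type estimate -/

variable {n : ℕ} {G : Type} [NormedAddCommGroup G] [NormedSpace ℝ G]

/-- Jensen's inequality on one ball: `φ(l) ≤ φ(average of f) ≤ average of φ(f)`. -/
lemma ofReal_mul_volume_le_of_lt_average {φ : ℝ → ℝ} (hφ : IsNFunction φ) {f : Eucl n → ℝ}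
    (hf : Continuous f) (h0 : ∀ x, 0 ≤ f x) {l ρ : ℝ} (hl : 0 ≤ l) (hρ : 0 < ρ) {x : Eucl n}
    (h : l * volume.real (Metric.closedBall x ρ) < ∫ y in Metric.closedBall x ρ, f y) :
    ENNReal.ofReal (φ l) * volume (Metric.closedBall x ρ) ≤
      ∫⁻ y in Metric.closedBall x ρ, ENNReal.ofReal (φ (f y)) := by
  have hV := volumeReal_closedBall_pos x hρ
  have hφf : Continuous fun y => φ (f y) := hφ.continuous_comp hf h0
  have hinteg : IntegrableOn (fun y => φ (f y)) (Metric.closedBall x ρ) :=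
    hφf.continuousOn.integrableOn_compact (isCompact_closedBall x ρ)
  have hJ := hφ.convexOn.map_set_average_le (μ := volume) (t := Metric.closedBall x ρ) (f := f)
    hφ.continuousOn isClosed_Ici (volume_closedBall_pos x hρ).ne' (volume_closedBall_ne_top x ρ)
    (Eventually.of_forall fun y => h0 y)
    (hf.continuousOn.integrableOn_compact (isCompact_closedBall x ρ)) hinteg
  rw [setAverage_eq, setAverage_eq, smul_eq_mul, smul_eq_mul] at hJ
  have h1 : l ≤ (volume.real (Metric.closedBall x ρ))⁻¹ * ∫ y in Metric.closedBall x ρ, f y := by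
    rw [inv_mul_eq_div, le_div_iff₀ hV]
    exact h.le
  have h2 : φ l * volume.real (Metric.closedBall x ρ) ≤
      ∫ y in Metric.closedBall x ρ, φ (f y) := by
    have := (hφ.mono hl h1).trans hJ
    rwa [inv_mul_eq_div, le_div_iff₀ hV] at this
  rw [← ofReal_integral_eq_lintegral_ofReal hinteg (Eventually.of_forall fun y => hφ.nonneg _ (h0 y))]
  refine le_trans ?_ (ENNReal.ofReal_le_ofReal h2)
  rw [ENNReal.ofReal_mul (hφ.nonneg l hl), Measure.real,
    ENNReal.ofReal_toReal (volume_closedBall_ne_top x ρ)]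

/-- The weak-type estimate for the maximal function of `|Dᵏu|`. -/
lemma ofReal_mul_volume_goodSet_compl_le (hn : 1 ≤ n) {φ : ℝ → ℝ} (hφ : IsNFunction φ) {k : ℕ}
    {u : Eucl n → G} (hu : ContDiff ℝ ∞ u) (hc : HasCompactSupport u) {l : ℝ} (hl : 0 < l) :
    ENNReal.ofReal (φ l) * volume (goodSet k u l)ᶜ ≤
      5 ^ n * ∫⁻ x, ENNReal.ofReal (φ ‖iteratedFDeriv ℝ k u x‖) := by
  set f : Eucl n → ℝ := fun x => ‖iteratedFDeriv ℝ k u x‖ with hf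
  have hfc : Continuous f := continuous_norm_iteratedFDeriv hu k
  have hfi : Integrable f := hfc.integrable_of_hasCompactSupport (hc.iteratedFDeriv k).norm
  have hf0 : ∀ x, 0 ≤ f x := fun x => norm_nonneg _
  have hex : ∀ x : Eucl n, ∃ ρ : ℝ, x ∈ (goodSet k u l)ᶜ → 0 < ρ ∧
      l * volume.real (Metric.closedBall x ρ) < ∫ y in Metric.closedBall x ρ, f y := by
    intro x
    by_cases hx : x ∈ (goodSet k u l)ᶜ
    · have hx' : ∃ ρ, 0 < ρ ∧ l * volume.real (Metric.closedBall x ρ) <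
          ∫ y in Metric.closedBall x ρ, f y := by
        simpa [goodSet] using hx
      obtain ⟨ρ, h⟩ := hx'
      exact ⟨ρ, fun _ => h⟩
    · exact ⟨0, fun h => absurd h hx⟩
  choose ρ hρ using hex
  set V := volume.real (Metric.closedBall (0 : Eucl n) 1) with hV
  have hV0 : 0 < V := volumeReal_closedBall_pos _ one_pos
  -- The covering lemma needs bounded radii: a large ball cannot have average above `l` because `f`
  -- is integrable. Here `ρ ≤ ρⁿ` for `ρ ≥ 1` uses `n ≥ 1`.
  have hbd : ∀ x ∈ (goodSet k u l)ᶜ, ρ x ≤ max 1 ((∫ y, f y) / (l * V)) := by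
    intro x hx
    obtain ⟨h1, h2⟩ := hρ x hx
    rcases le_total (ρ x) 1 with h | h
    · exact h.trans (le_max_left _ _)
    · refine le_trans ?_ (le_max_right _ _)
      rw [le_div_iff₀ (by positivity)]
      rw [volumeReal_closedBall x h1.le] at h2
      have h3 : ρ x ≤ ρ x ^ n := le_self_pow₀ h (by omega)
      have h4 := setIntegral_le_integral (s := Metric.closedBall x (ρ x)) hfi
        (Eventually.of_forall hf0)
      have h5 : ρ x * (l * V) ≤ ρ x ^ n * (l * V) := by gcongr
      calc _ ≤ l * (ρ x ^ n * V) := by linarith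
        _ ≤ _ := h2.le.trans h4
  obtain ⟨w, hwt, hdisj, hcov⟩ := Vitali.exists_disjoint_subfamily_covering_enlargement_closedBall
    (goodSet k u l)ᶜ (fun x => x) ρ _ hbd 5 (by norm_num)
  have hwc : w.Countable := hdisj.countable_of_nonempty_interior fun x hx =>
    ⟨x, by
      rw [interior_closedBall _ (hρ x (hwt hx)).1.ne']
      exact Metric.mem_ball_self (hρ x (hwt hx)).1⟩
  have hcover : (goodSet k u l)ᶜ ⊆ ⋃ x ∈ w, Metric.closedBall x (5 * ρ x) := by
    intro x hx
    obtain ⟨b, hb, hsub⟩ := hcov x hx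
    exact mem_biUnion hb (hsub (Metric.mem_closedBall_self (hρ x hx).1.le))
  have hball : ∀ x ∈ w, ENNReal.ofReal (φ l) * volume (Metric.closedBall x (5 * ρ x)) ≤
      5 ^ n * ∫⁻ y in Metric.closedBall x (ρ x), ENNReal.ofReal (φ (f y)) := by
    intro x hx
    obtain ⟨h1, h2⟩ := hρ x (hwt hx)
    have h3 := ofReal_mul_volume_le_of_lt_average hφ hfc hf0 hl.le h1 h2
    have h4 : volume (Metric.closedBall x (5 * ρ x)) =
        5 ^ n * volume (Metric.closedBall x (ρ x)) := by
      rw [Measure.addHaar_closedBall_mul _ _ (by norm_num) h1.le, finrank_euclideanSpace_fin,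
        ENNReal.ofReal_pow (by norm_num), Measure.addHaar_closedBall_center volume x]
      norm_num
    rw [h4, mul_left_comm]
    gcongr
  calc ENNReal.ofReal (φ l) * volume (goodSet k u l)ᶜ
      ≤ ENNReal.ofReal (φ l) * ∑' x : w, volume (Metric.closedBall (x : Eucl n) (5 * ρ x)) := by
        gcongr
        exact (measure_mono hcover).trans (measure_biUnion_le _ hwc _)
    _ = ∑' x : w, ENNReal.ofReal (φ l) * volume (Metric.closedBall (x : Eucl n) (5 * ρ x)) :=
        ENNReal.tsum_mul_left.symm
    _ ≤ ∑' x : w, 5 ^ n * ∫⁻ y in Metric.closedBall (x : Eucl n) (ρ x), ENNReal.ofReal (φ (f y)) :=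
        ENNReal.tsum_le_tsum fun x => hball x x.2
    _ = 5 ^ n * ∫⁻ y in ⋃ x ∈ w, Metric.closedBall x (ρ x), ENNReal.ofReal (φ (f y)) := by
        rw [ENNReal.tsum_mul_left, lintegral_biUnion hwc
          (fun x _ => Metric.isClosed_closedBall.measurableSet) hdisj]
    _ ≤ 5 ^ n * ∫⁻ y, ENNReal.ofReal (φ (f y)) := by
        gcongr
        exact Measure.restrict_le_self

/-! ### A Poincaré inequality for test functions on a ball -/

/-- Mean value inequality from a point of the boundary sphere, where all derivatives vanish, at
distance at most `2R`; such a point exists since `n ≥ 1`. -/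
lemma norm_iteratedFDeriv_le_of_isTestFunction (hn : 1 ≤ n) {x₀ : Eucl n} {R : ℝ} (hR : 0 < R)
    {v : Eucl n → G} (hv : IsTestFunction (Metric.ball x₀ R) v) {k : ℕ} {S : ℝ}
    (hS : ∀ x, ‖iteratedFDeriv ℝ k v x‖ ≤ S) {j : ℕ} (hj : j ≤ k) (x : Eucl n) :
    ‖iteratedFDeriv ℝ j v x‖ ≤ (2 * R) ^ (k - j) * S := by
  have hS0 : 0 ≤ S := (norm_nonneg _).trans (hS x₀)
  obtain ⟨m, hm⟩ := Nat.exists_eq_add_of_le hj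
  have hkj : k - j = m := by omega
  rw [hkj]
  clear hj hkj
  induction m generalizing j x with
  | zero =>
    obtain rfl : k = j := hm
    simpa using hS x
  | succ m ih =>
    by_cases hx : x ∈ Metric.ball x₀ R
    swap
    · rw [iteratedFDeriv_eq_zero_of_notMem hv hx, norm_zero]
      positivity
    let e : Eucl n := EuclideanSpace.single ⟨0, hn⟩ 1
    have he : ‖e‖ = 1 := by simp [e]
    have hp : x₀ + R • e ∉ Metric.ball x₀ R := by
      rw [Metric.mem_ball, dist_eq_norm, add_sub_cancel_left, norm_smul, he,
        Real.norm_of_nonneg hR.le]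
      simp
    have hd : ∀ z ∈ (univ : Set (Eucl n)), DifferentiableAt ℝ (iteratedFDeriv ℝ j v) z :=
      fun z _ => hv.1.differentiable_iteratedFDeriv (by exact_mod_cast ENat.natCast_lt_top j) z
    have hb : ∀ z ∈ (univ : Set (Eucl n)),
        ‖fderiv ℝ (iteratedFDeriv ℝ j v) z‖ ≤ (2 * R) ^ m * S := by
      intro z _
      rw [norm_fderiv_iteratedFDeriv]
      exact ih (j := j + 1) z (by omega)
    have h := convex_univ.norm_image_sub_le_of_norm_fderiv_le hd hb (mem_univ (x₀ + R • e))
      (mem_univ x)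
    rw [iteratedFDeriv_eq_zero_of_notMem hv hp, sub_zero] at h
    refine h.trans ?_
    have hdist : ‖x - (x₀ + R • e)‖ ≤ 2 * R := by
      rw [← sub_sub]
      refine (norm_sub_le _ _).trans ?_
      rw [norm_smul, he, Real.norm_of_nonneg hR.le, ← dist_eq_norm]
      have : dist x x₀ < R := hx
      linarith
    calc _ ≤ (2 * R) ^ m * S * (2 * R) := by gcongr
      _ = _ := by ring

end LipTrunc

end

noncomputable section

namespace LipTrunc

variable {n N : ℕ}

/-! ### Multi-indices and iterated derivatives -/

/-- The standard basis vectors. -/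
def stdVec (i : Fin n) : Eucl n := EuclideanSpace.single i 1

/-- The non-decreasing list of coordinates in which `i` occurs `α i` times. -/
def indexList (α : Fin n → ℕ) : List (Fin n) :=
  (List.finRange n).flatMap fun i => List.replicate (α i) i

lemma length_indexList (α : Fin n → ℕ) : (indexList α).length = ∑ i, α i := by
  simp [indexList, List.length_flatMap, Fin.sum_univ_def]

lemma count_indexList (α : Fin n → ℕ) (a : Fin n) : (indexList α).count a = α a := by
  rw [indexList, List.count_flatMap]
  have : (List.count a ∘ fun i => List.replicate (α i) i) = fun i => if i = a then α i else 0 := by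
    funext i
    simp [List.count_replicate]
  rw [this, ← Fin.sum_univ_def]
  simp

lemma partialDeriv_iterate_eq_listDeriv (i : Fin n) (m : ℕ) (g : Eucl n → ℝ) :
    (partialDeriv i)^[m] g = listDeriv (List.replicate m (stdVec i)) g := by
  induction m with
  | zero => rfl
  | succ m ih =>
    rw [Function.iterate_succ_apply', ih, List.replicate_succ, listDeriv_cons]
    rfl

lemma multiDeriv_eq_listDeriv (α : Fin n → ℕ) (f : Eucl n → ℝ) :
    multiDeriv α f = listDeriv ((indexList α).map stdVec) f := by
  unfold multiDeriv indexList
  induction List.finRange n with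
  | nil => rfl
  | cons i l ih =>
    rw [List.foldr_cons, ih, partialDeriv_iterate_eq_listDeriv, List.flatMap_cons, List.map_append,
      listDeriv_append, List.map_replicate]

lemma sum_multiIndex {j : ℕ} (α : MultiIndex n j) : ∑ i, α.1 i = j :=
  (Finset.mem_piAntidiag.1 α.2).1

/-- The tuple of basis vectors in which `eᵢ` occurs `α i` times. -/
def basisTuple {j : ℕ} (α : MultiIndex n j) : Fin j → Eucl n := fun i =>
  stdVec ((indexList α.1).get (i.cast ((length_indexList α.1).trans (sum_multiIndex α)).symm))

lemma ofFn_basisTuple {j : ℕ} (α : MultiIndex n j) :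
    List.ofFn (basisTuple α) = (indexList α.1).map stdVec := by
  have h := (length_indexList α.1).trans (sum_multiIndex α)
  refine List.ext_getElem (by simp [h]) fun i h1 h2 => ?_
  simp [basisTuple]

/-- The linear map `M ↦ (M(e^α))_{|α| = j}`. -/
def tensorOf (n N j : ℕ) : (Eucl n [×j]→L[ℝ] Eucl N) →L[ℝ] SymTensor n N j :=
  ((PiLp.continuousLinearEquiv 2 ℝ (fun _ : MultiIndex n j => Eucl N)).symm :
      (MultiIndex n j → Eucl N) →L[ℝ] SymTensor n N j) ∘L
    ContinuousLinearMap.pi fun α => ContinuousMultilinearMap.apply ℝ _ _ (basisTuple α)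

lemma tensorOf_apply {j : ℕ} (M : Eucl n [×j]→L[ℝ] Eucl N) (α : MultiIndex n j) :
    tensorOf n N j M α = M (basisTuple α) := rfl

lemma tensorOf_iteratedFDeriv_apply {j : ℕ} {u : Eucl n → Eucl N} (hu : ContDiff ℝ j u) (x : Eucl n)
    (α : MultiIndex n j) :
    tensorOf n N j (iteratedFDeriv ℝ j u x) α = listDeriv ((indexList α.1).map stdVec) u x := by
  rw [tensorOf_apply, iteratedFDeriv_apply_eq_listDeriv hu, ofFn_basisTuple]

/-- The multi-index that counts the occurrences in a tuple of coordinates. -/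
def countIndex {j : ℕ} (t : Fin j → Fin n) : Fin n → ℕ := fun i => (List.ofFn t).count i

lemma perm_indexList_countIndex {j : ℕ} (t : Fin j → Fin n) :
    (List.ofFn t).Perm (indexList (countIndex t)) :=
  List.perm_iff_count.2 fun a => (count_indexList (countIndex t) a).symm

lemma countIndex_mem {j : ℕ} (t : Fin j → Fin n) :
    countIndex t ∈ Finset.piAntidiag (Finset.univ : Finset (Fin n)) j := by
  rw [Finset.mem_piAntidiag]
  refine ⟨?_, fun i _ => Finset.mem_univ i⟩
  rw [← length_indexList, ← (perm_indexList_countIndex t).length_eq, List.length_ofFn]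

lemma norm_iteratedFDeriv_basis_le {j : ℕ} {u : Eucl n → Eucl N} (hu : ContDiff ℝ j u) (x : Eucl n)
    (t : Fin j → Fin n) : ‖iteratedFDeriv ℝ j u x (fun i => stdVec (t i))‖ ≤
      ‖tensorOf n N j (iteratedFDeriv ℝ j u x)‖ := by
  have h : iteratedFDeriv ℝ j u x (fun i => stdVec (t i)) =
      tensorOf n N j (iteratedFDeriv ℝ j u x) ⟨countIndex t, countIndex_mem t⟩ := by
    rw [tensorOf_iteratedFDeriv_apply hu, iteratedFDeriv_apply_eq_listDeriv hu]
    refine congrFun (listDeriv_perm ?_ (by simpa using hu)) x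
    have e : List.ofFn (fun i => stdVec (t i)) = (List.ofFn t).map stdVec := by
      rw [List.map_ofFn]; rfl
    rw [e]
    exact (perm_indexList_countIndex t).map stdVec
  rw [h]
  exact PiLp.norm_apply_le _ _

/-- Expanding each argument in the standard basis gives `nʲ` terms, each a partial derivative and so
a component of the tensor. -/
lemma norm_iteratedFDeriv_le_norm_tensorOf {j : ℕ} {u : Eucl n → Eucl N} (hu : ContDiff ℝ j u)
    (x : Eucl n) : ‖iteratedFDeriv ℝ j u x‖ ≤
      (n : ℝ) ^ j * ‖tensorOf n N j (iteratedFDeriv ℝ j u x)‖ := by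
  refine ContinuousMultilinearMap.opNorm_le_bound (by positivity) fun v => ?_
  set M := iteratedFDeriv ℝ j u x with hM
  have hv : v = fun i => ∑ c, (v i c) • stdVec c := by
    funext i
    ext a
    simp [stdVec, Finset.sum_apply, Pi.single_apply]
  have hexp : M v = ∑ t : Fin j → Fin n, (∏ i, v i (t i)) • M (fun i => stdVec (t i)) := by
    conv_lhs => rw [hv]
    rw [M.map_sum]
    refine Finset.sum_congr rfl fun t _ => ?_
    exact M.map_smul_univ (fun i => v i (t i)) (fun i => stdVec (t i))
  rw [hexp]
  refine (norm_sum_le _ _).trans ?_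
  have hterm : ∀ t ∈ (Finset.univ : Finset (Fin j → Fin n)),
      ‖(∏ i, v i (t i)) • M (fun i => stdVec (t i))‖ ≤ (∏ i, ‖v i‖) * ‖tensorOf n N j M‖ := by
    intro t _
    rw [norm_smul, norm_prod]
    gcongr with i
    · exact PiLp.norm_apply_le (v i) (t i)
    · exact norm_iteratedFDeriv_basis_le hu x t
  refine (Finset.sum_le_sum hterm).trans_eq ?_
  simp
  ring

/-! ### Weak derivatives -/

lemma IsTestFunction.listDeriv {Ω : Set (Eucl n)} {F : Type} [NormedAddCommGroup F] [NormedSpace ℝ F]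
    {η : Eucl n → F} (hη : IsTestFunction Ω η) (L : List (Eucl n)) :
    IsTestFunction Ω (listDeriv L η) := by
  induction L with
  | nil => exact hη
  | cons v L ih =>
    rw [listDeriv_cons]
    have hsub : tsupport (fun x => fderiv ℝ (LipTrunc.listDeriv L η) x v) ⊆
        tsupport (LipTrunc.listDeriv L η) := tsupport_fderiv_apply_subset ℝ v
    refine ⟨?_, ih.2.1.fderiv_apply ℝ v, hsub.trans ih.2.2⟩
    exact (ih.1.fderiv_right (m := ∞) (by simp)).clm_apply contDiff_const

lemma integrable_smul_of_isTestFunction {Ω : Set (Eucl n)} {η : Eucl n → ℝ}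
    (hη : IsTestFunction Ω η) {F : Type} [NormedAddCommGroup F] [NormedSpace ℝ F] {u : Eucl n → F}
    (hu : LocallyIntegrableOn u Ω) : Integrable (fun x => η x • u x) := by
  have hK : IntegrableOn u (tsupport η) := hu.integrableOn_compact_subset hη.2.2 hη.2.1
  have h1 : IntegrableOn (fun x => η x • u x) (tsupport η) :=
    hK.continuousOn_smul hη.1.continuous.continuousOn hη.2.1
  refine h1.integrable_of_forall_notMem_eq_zero fun x hx => ?_
  rw [image_eq_zero_of_notMem_tsupport hx, zero_smul]

lemma setIntegral_smul_of_isTestFunction {Ω : Set (Eucl n)} {η : Eucl n → ℝ}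
    (hη : IsTestFunction Ω η) {F : Type} [NormedAddCommGroup F] [NormedSpace ℝ F] (u : Eucl n → F) :
    ∫ x in Ω, η x • u x = ∫ x, η x • u x := by
  refine setIntegral_eq_integral_of_forall_compl_eq_zero fun x hx => ?_
  rw [image_eq_zero_of_notMem_tsupport fun h => hx (hη.2.2 h), zero_smul]

lemma isTestFunction_multiDeriv {Ω : Set (Eucl n)} {η : Eucl n → ℝ} (hη : IsTestFunction Ω η)
    (α : Fin n → ℕ) : IsTestFunction Ω (multiDeriv α η) := by
  rw [multiDeriv_eq_listDeriv]
  exact hη.listDeriv _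

lemma integral_listDeriv_smul {η : Eucl n → ℝ} {F : Type} [NormedAddCommGroup F] [NormedSpace ℝ F]
    (hη : IsTestFunction univ η) (L : List (Eucl n)) : ∀ {u : Eucl n → F},
    ContDiff ℝ (L.length : ℕ) u →
    ∫ x, listDeriv L η x • u x = (-1 : ℝ) ^ L.length • ∫ x, η x • listDeriv L.reverse u x := by
  induction L with
  | nil => intro u _; simp
  | cons v L ih =>
    intro u hu
    have hloc : ∀ {g : Eucl n → F}, Continuous g → LocallyIntegrableOn g univ :=
      fun hg => hg.locallyIntegrable.locallyIntegrableOn _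
    have hu1 : ContDiff ℝ 1 u := hu.of_le (by simp)
    have hdu : ContDiff ℝ (L.length : ℕ) fun x => fderiv ℝ u x v :=
      ContDiff.fderiv_dir (by simpa using hu) v
    have hL := hη.listDeriv L
    have h1 := integral_smul_fderiv_eq_neg_fderiv_smul_of_integrable (μ := volume)
      (f := listDeriv L η) (g := u) (v := v)
      (integrable_smul_of_isTestFunction (hη.listDeriv (v :: L)) (hloc hu.continuous))
      (integrable_smul_of_isTestFunction hL (hloc hdu.continuous))
      (integrable_smul_of_isTestFunction hL (hloc hu.continuous))
      (fun x _ => hL.1.differentiable (by simp) x)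
      (fun x _ => hu1.differentiable (by simp) x)
    have h2 : ∫ x, listDeriv (v :: L) η x • u x = -∫ x, listDeriv L η x • fderiv ℝ u x v := by
      rw [h1, neg_neg]
      rfl
    rw [h2, ih hdu, List.reverse_cons, listDeriv_append, List.length_cons, pow_succ]
    simp [listDeriv_cons]

/-- Integration by parts, which reverses the order of the directions. Finite differentiability is
all that is asked, because the truncation will be obtained as a `Cᵏ` sum of a series. -/
lemma hasWeakGrad_of_contDiff {Ω : Set (Eucl n)} {j : ℕ} {u : Eucl n → Eucl N} (hu : ContDiff ℝ j u) :
    HasWeakGrad Ω j u fun x => tensorOf n N j (iteratedFDeriv ℝ j u x) := by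
  intro α
  have hlen : ((indexList α.1).map (stdVec (n := n))).length = j := by
    rw [List.length_map, length_indexList, sum_multiIndex]
  have hcont : Continuous (listDeriv ((indexList α.1).map stdVec) u) :=
    (contDiff_listDeriv (m := 0) _ (by rw [zero_add, hlen]; exact hu)).continuous
  have e : (fun x => tensorOf n N j (iteratedFDeriv ℝ j u x) α) =
      listDeriv ((indexList α.1).map stdVec) u :=
    funext fun x => tensorOf_iteratedFDeriv_apply hu x α
  rw [e]
  refine ⟨hu.continuous.locallyIntegrable.locallyIntegrableOn _,
    hcont.locallyIntegrable.locallyIntegrableOn _, fun η hη => ?_⟩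
  have hη' : IsTestFunction univ η := ⟨hη.1, hη.2.1, subset_univ _⟩
  rw [setIntegral_smul_of_isTestFunction (isTestFunction_multiDeriv hη _),
    setIntegral_smul_of_isTestFunction hη, multiDeriv_eq_listDeriv,
    integral_listDeriv_smul hη' _ (by rw [hlen]; exact hu), hlen, sum_multiIndex,
    listDeriv_perm (List.reverse_perm _) (by rw [List.length_reverse, hlen]; exact hu)]

lemma HasWeakDeriv.sub {Ω : Set (Eucl n)} {α : Fin n → ℕ} {u u' v v' : Eucl n → Eucl N}
    (h : HasWeakDeriv Ω α u v) (h' : HasWeakDeriv Ω α u' v') :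
    HasWeakDeriv Ω α (u - u') (v - v') := by
  refine ⟨h.1.sub h'.1, h.2.1.sub h'.2.1, fun η hη => ?_⟩
  have hη' := isTestFunction_multiDeriv hη α
  simp only [Pi.sub_apply, smul_sub]
  rw [integral_sub (integrable_smul_of_isTestFunction hη' h.1).integrableOn
    (integrable_smul_of_isTestFunction hη' h'.1).integrableOn,
    integral_sub (integrable_smul_of_isTestFunction hη h.2.1).integrableOn
    (integrable_smul_of_isTestFunction hη h'.2.1).integrableOn, h.2.2 η hη, h'.2.2 η hη, smul_sub]

/-- The fundamental lemma of the calculus of variations. As `weakGrad` is an arbitrary choice, every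
later identification of it goes through this uniqueness. -/
lemma HasWeakDeriv.ae_eq {Ω : Set (Eucl n)} (hΩ : IsOpen Ω) {α : Fin n → ℕ}
    {u v v' : Eucl n → Eucl N} (h : HasWeakDeriv Ω α u v) (h' : HasWeakDeriv Ω α u v') :
    v =ᵐ[volume.restrict Ω] v' := by
  have key := hΩ.ae_eq_zero_of_integral_contDiff_smul_eq_zero (μ := volume) (h.2.1.sub h'.2.1)
    fun g hg1 hg2 hg3 => by
      have hg : IsTestFunction Ω g := ⟨hg1, hg2, hg3⟩
      have h1 := h.2.2 g hg
      rw [h'.2.2 g hg] at h1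
      have h2 := (smul_right_injective (Eucl N)
        (pow_ne_zero (∑ i, α i) (by norm_num : (-1 : ℝ) ≠ 0))) h1
      rw [setIntegral_smul_of_isTestFunction hg, setIntegral_smul_of_isTestFunction hg] at h2
      simp only [Pi.sub_apply, smul_sub]
      rw [integral_sub (integrable_smul_of_isTestFunction hg h.2.1)
        (integrable_smul_of_isTestFunction hg h'.2.1), h2, sub_self]
  refine (ae_restrict_iff' hΩ.measurableSet).2 (key.mono fun x hx hxΩ => ?_)
  exact sub_eq_zero.1 (hx hxΩ)

lemma HasWeakGrad.sub {Ω : Set (Eucl n)} {j : ℕ} {u u' : Eucl n → Eucl N}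
    {V V' : Eucl n → SymTensor n N j} (h : HasWeakGrad Ω j u V) (h' : HasWeakGrad Ω j u' V') :
    HasWeakGrad Ω j (u - u') (V - V') := fun α => (h α).sub (h' α)

lemma HasWeakGrad.ae_eq {Ω : Set (Eucl n)} (hΩ : IsOpen Ω) {j : ℕ} {u : Eucl n → Eucl N}
    {V V' : Eucl n → SymTensor n N j} (h : HasWeakGrad Ω j u V) (h' : HasWeakGrad Ω j u V') :
    V =ᵐ[volume.restrict Ω] V' := by
  have := ae_all_iff.2 fun α => (h α).ae_eq hΩ (h' α)
  filter_upwards [this] with x hx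
  ext α : 1
  exact hx α

lemma hasWeakGrad_weakGrad {Ω : Set (Eucl n)} {j : ℕ} {u : Eucl n → Eucl N}
    (h : HasWeakGradOfOrder Ω j u) : HasWeakGrad Ω j u (weakGrad Ω j u) := by
  rw [weakGrad, dif_pos h]
  exact h.choose_spec

lemma HasWeakGrad.weakGrad_ae_eq {Ω : Set (Eucl n)} (hΩ : IsOpen Ω) {j : ℕ} {u : Eucl n → Eucl N}
    {V : Eucl n → SymTensor n N j} (h : HasWeakGrad Ω j u V) :
    weakGrad Ω j u =ᵐ[volume.restrict Ω] V :=
  (hasWeakGrad_weakGrad ⟨V, h⟩).ae_eq hΩ h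

lemma weakGrad_ae_eq_of_contDiff {Ω : Set (Eucl n)} (hΩ : IsOpen Ω) {j : ℕ} {u : Eucl n → Eucl N}
    (hu : ContDiff ℝ j u) :
    weakGrad Ω j u =ᵐ[volume.restrict Ω] fun x => tensorOf n N j (iteratedFDeriv ℝ j u x) :=
  (hasWeakGrad_of_contDiff hu).weakGrad_ae_eq hΩ

lemma weakGrad_sub_ae_eq {Ω : Set (Eucl n)} (hΩ : IsOpen Ω) {j : ℕ} {u ψ : Eucl n → Eucl N}
    (hu : HasWeakGradOfOrder Ω j u) (hψ : ContDiff ℝ j ψ) :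
    weakGrad Ω j (u - ψ) =ᵐ[volume.restrict Ω]
      fun x => weakGrad Ω j u x - tensorOf n N j (iteratedFDeriv ℝ j ψ x) :=
  ((hasWeakGrad_weakGrad hu).sub (hasWeakGrad_of_contDiff hψ)).weakGrad_ae_eq hΩ

lemma multiDeriv_zero (f : Eucl n → ℝ) : multiDeriv 0 f = f := by
  have : indexList (0 : Fin n → ℕ) = [] := List.length_eq_zero_iff.1 (by simp [length_indexList])
  rw [multiDeriv_eq_listDeriv, this]
  rfl

/-- The unique multi-index of order zero. -/
def zeroIndex (n : ℕ) : MultiIndex n 0 := ⟨0, by simp⟩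

lemma weakGrad_zero_ae_eq {Ω : Set (Eucl n)} (hΩ : IsOpen Ω) {u : Eucl n → Eucl N}
    (hu : HasWeakGradOfOrder Ω 0 u) :
    (fun x => weakGrad Ω 0 u x (zeroIndex n)) =ᵐ[volume.restrict Ω] u := by
  have h := hasWeakGrad_weakGrad hu (zeroIndex n)
  refine h.ae_eq hΩ ⟨h.1, h.1, fun η _ => ?_⟩
  change ∫ x in Ω, multiDeriv 0 η x • u x = (-1 : ℝ) ^ (∑ i, (0 : Fin n → ℕ) i) • _
  rw [multiDeriv_zero]
  simp

end LipTrunc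

end

noncomputable section

namespace LipTrunc

variable {n N : ℕ}

/-! ### Series of test functions -/

lemma memSobolev_of_contDiff {x₀ : Eucl n} {R : ℝ} {k : ℕ} {w : Eucl n → Eucl N} (hw : ContDiff ℝ k w)
    {b : ℕ → ℝ} (hb : ∀ j ≤ k, ∀ x, ‖iteratedFDeriv ℝ j w x‖ ≤ b j) (p : ℝ≥0∞) :
    MemSobolev p (Metric.ball x₀ R) k w := by
  intro j hj
  have hwj : ContDiff ℝ j w := hw.of_le (by exact_mod_cast hj)
  refine ⟨⟨_, hasWeakGrad_of_contDiff hwj⟩, ?_⟩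
  have : IsFiniteMeasure (volume.restrict (Metric.ball x₀ R)) :=
    ⟨by rw [Measure.restrict_apply_univ]; exact measure_ball_lt_top⟩
  refine (memLp_congr_ae (weakGrad_ae_eq_of_contDiff Metric.isOpen_ball hwj)).2 ?_
  refine MemLp.of_bound (C := ‖tensorOf n N j‖ * b j) ?_ (Eventually.of_forall fun x => ?_)
  · exact ((tensorOf n N j).continuous.comp
      (hwj.continuous_iteratedFDeriv le_rfl)).aestronglyMeasurable
  · exact (ContinuousLinearMap.le_opNorm _ _).trans
      (mul_le_mul_of_nonneg_left (hb j hj x) (norm_nonneg _))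

lemma sobolevNorm_one_le {x₀ : Eucl n} {R : ℝ} {k : ℕ} {w : Eucl n → Eucl N} (hw : ContDiff ℝ k w)
    {b : ℕ → ℝ} (hb : ∀ j ≤ k, ∀ x, ‖iteratedFDeriv ℝ j w x‖ ≤ b j) :
    sobolevNorm 1 (Metric.ball x₀ R) k w ≤
      ∑ j ∈ Finset.range (k + 1), volume (Metric.ball x₀ R) * ENNReal.ofReal (‖tensorOf n N j‖ * b j) := by
  refine Finset.sum_le_sum fun j hj => ?_
  have hj' : j ≤ k := Nat.lt_succ_iff.1 (Finset.mem_range.1 hj)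
  have hwj : ContDiff ℝ j w := hw.of_le (by exact_mod_cast hj')
  rw [eLpNorm_congr_ae (weakGrad_ae_eq_of_contDiff Metric.isOpen_ball hwj)]
  refine (eLpNorm_le_of_ae_bound (C := ‖tensorOf n N j‖ * b j)
    (Eventually.of_forall fun x => ?_)).trans_eq ?_
  · exact (ContinuousLinearMap.le_opNorm _ _).trans
      (mul_le_mul_of_nonneg_left (hb j hj' x) (norm_nonneg _))
  · simp

lemma isTestFunction_sum {Ω : Set (Eucl n)} {T : ℕ → Eucl n → Eucl N}
    (hT : ∀ m, IsTestFunction Ω (T m)) (M : ℕ) :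
    IsTestFunction Ω (fun x => ∑ m ∈ Finset.range M, T m x) := by
  induction M with
  | zero =>
    simp only [Finset.range_zero, Finset.sum_empty]
    exact ⟨contDiff_const, HasCompactSupport.zero, by simp [tsupport, Function.support]⟩
  | succ M ih =>
    simp only [Finset.sum_range_succ]
    refine ⟨ih.1.add (hT M).1, ih.2.1.add (hT M).2.1, ?_⟩
    exact (tsupport_add _ _).trans (union_subset ih.2.2 (hT M).2.2)

/-- A series of test functions on a ball whose `k`-th derivatives are bounded by a geometric
sequence. -/
structure GeometricSeries (x₀ : Eucl n) (R : ℝ) (k : ℕ) (c : ℝ) (T : ℕ → Eucl n → Eucl N) : Prop where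
  isTestFunction : ∀ m, IsTestFunction (Metric.ball x₀ R) (T m)
  bound : ∀ m x, ‖iteratedFDeriv ℝ k (T m) x‖ ≤ c * (1 / 2) ^ m

namespace GeometricSeries

variable {x₀ : Eucl n} {R : ℝ} {k : ℕ} {c : ℝ} {T : ℕ → Eucl n → Eucl N}

lemma shift (h : GeometricSeries x₀ R k c T) (M : ℕ) :
    GeometricSeries x₀ R k (c * (1 / 2) ^ M) fun m => T (m + M) where
  isTestFunction m := h.isTestFunction _
  bound m x := (h.bound (m + M) x).trans_eq (by rw [pow_add]; ring)

lemma bound_lower (hn : 1 ≤ n) (hR : 0 < R) (h : GeometricSeries x₀ R k c T) {j : ℕ} (hj : j ≤ k) (m : ℕ) (x : Eucl n) :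
    ‖iteratedFDeriv ℝ j (T m) x‖ ≤ (2 * R) ^ (k - j) * (c * (1 / 2) ^ m) :=
  norm_iteratedFDeriv_le_of_isTestFunction hn hR (h.isTestFunction m) (h.bound m) hj x

lemma summable_bound (R : ℝ) (k : ℕ) (c : ℝ) (j : ℕ) :
    Summable fun m : ℕ => (2 * R) ^ (k - j) * (c * (1 / 2) ^ m) :=
  (summable_geometric_two.mul_left c).mul_left _

lemma contDiff (hn : 1 ≤ n) (hR : 0 < R) (h : GeometricSeries x₀ R k c T) : ContDiff ℝ k fun x => ∑' m, T m x :=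
  contDiff_tsum (N := (k : ℕ∞)) (fun m => (h.isTestFunction m).1.of_le (by exact_mod_cast le_top))
    (fun j _ => summable_bound R k c j)
    fun j m x hj => h.bound_lower hn hR (by exact_mod_cast hj) m x

lemma iteratedFDeriv_eq (hn : 1 ≤ n) (hR : 0 < R) (h : GeometricSeries x₀ R k c T) {j : ℕ} (hj : j ≤ k) (x : Eucl n) :
    iteratedFDeriv ℝ j (fun x => ∑' m, T m x) x = ∑' m, iteratedFDeriv ℝ j (T m) x :=
  congrFun (iteratedFDeriv_tsum (N := (k : ℕ∞))
    (fun m => (h.isTestFunction m).1.of_le (by exact_mod_cast le_top))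
    (fun j _ => summable_bound R k c j)
    (fun j m x hj => h.bound_lower hn hR (by exact_mod_cast hj) m x) (by exact_mod_cast hj)) x

lemma summable (hn : 1 ≤ n) (hR : 0 < R) (h : GeometricSeries x₀ R k c T) {j : ℕ} (hj : j ≤ k) (x : Eucl n) :
    Summable fun m => iteratedFDeriv ℝ j (T m) x :=
  Summable.of_norm_bounded (summable_bound R k c j) fun m => h.bound_lower hn hR hj m x

lemma summable_apply (hn : 1 ≤ n) (hR : 0 < R) (h : GeometricSeries x₀ R k c T) (x : Eucl n) : Summable fun m => T m x := by
  refine Summable.of_norm_bounded (summable_bound R k c 0) fun m => ?_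
  simpa using h.bound_lower hn hR (Nat.zero_le k) m x

lemma norm_iteratedFDeriv_le (hn : 1 ≤ n) (hR : 0 < R) (h : GeometricSeries x₀ R k c T) {j : ℕ} (hj : j ≤ k) (x : Eucl n) :
    ‖iteratedFDeriv ℝ j (fun x => ∑' m, T m x) x‖ ≤ (2 * R) ^ (k - j) * (2 * c) := by
  rw [h.iteratedFDeriv_eq hn hR hj]
  refine tsum_of_norm_bounded ?_ fun m => h.bound_lower hn hR hj m x
  have := (hasSum_geometric_two.mul_left c).mul_left ((2 * R) ^ (k - j))
  rwa [mul_comm c 2] at this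

/-- Partial sums are test functions, and the remainder is again a geometric series, with constant `c
2⁻ᴹ`, so its derivatives up to order `k` are uniformly small on the bounded ball. -/
lemma memSobolevInftyZero (hn : 1 ≤ n) (hR : 0 < R) (h : GeometricSeries x₀ R k c T) :
    MemSobolevInftyZero (Metric.ball x₀ R) k fun x => ∑' m, T m x := by
  have hmem := fun p => memSobolev_of_contDiff (x₀ := x₀) (R := R) (h.contDiff hn hR)
    (fun j hj x => h.norm_iteratedFDeriv_le hn hR hj x) p
  refine ⟨hmem ⊤, hmem 1, fun ε hε => ?_⟩
  have hlim : Tendsto (fun M : ℕ => ∑ j ∈ Finset.range (k + 1), volume (Metric.ball x₀ R) *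
      ENNReal.ofReal (‖tensorOf n N j‖ * ((2 * R) ^ (k - j) * (2 * (c * (1 / 2) ^ M))))) atTop
      (𝓝 (∑ j ∈ Finset.range (k + 1), volume (Metric.ball x₀ R) * ENNReal.ofReal
        (‖tensorOf n N j‖ * ((2 * R) ^ (k - j) * (2 * (c * 0)))))) := by
    refine tendsto_finsetSum _ fun j _ => ?_
    refine ENNReal.Tendsto.const_mul (ENNReal.tendsto_ofReal ?_) (Or.inr measure_ball_lt_top.ne)
    exact (((tendsto_pow_atTop_nhds_zero_of_lt_one (by norm_num) (by norm_num)).const_mul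
      c).const_mul 2).const_mul _ |>.const_mul _
  simp only [mul_zero, ENNReal.ofReal_zero, Finset.sum_const_zero] at hlim
  obtain ⟨M, hM⟩ := (hlim.eventually (gt_mem_nhds hε)).exists
  refine ⟨_, isTestFunction_sum h.isTestFunction M, lt_of_le_of_lt ?_ hM⟩
  have e : (fun x => ∑' m, T m x) - (fun x => ∑ m ∈ Finset.range M, T m x) =
      fun x => ∑' m, T (m + M) x := by
    funext x
    rw [Pi.sub_apply, ← (h.summable_apply hn hR x).sum_add_tsum_nat_add M, add_sub_cancel_left]
  rw [e]
  exact sobolevNorm_one_le ((h.shift M).contDiff hn hR)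
    fun j hj x => (h.shift M).norm_iteratedFDeriv_le hn hR hj x

end GeometricSeries

/-! ### Approximation by test functions -/

/-- Convexity gives `φ(2s · t) ≤ 2s φ(t)` for `2s ≤ 1`, so small norm means small modular. The `2`
inside `φ` anticipates the splitting of sums by `map_add_le`. -/
lemma lintegral_le_of_luxemburgNorm_lt {φ : ℝ → ℝ} (hφ : IsNFunction φ) {Ω : Set (Eucl n)} {F : Type}
    [NormedAddCommGroup F] {f : Eucl n → F} {ε : ℝ} (hε1 : ε ≤ 1)
    (h : luxemburgNorm φ Ω f < ENNReal.ofReal (ε / 2)) :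
    ∫⁻ x in Ω, ENNReal.ofReal (φ (2 * ‖f x‖)) ≤ ENNReal.ofReal ε := by
  simp only [luxemburgNorm, iInf_lt_iff] at h
  obtain ⟨s, hs, hmod, hlt⟩ := h
  have hsε : s < ε / 2 := (ENNReal.ofReal_lt_ofReal_iff_of_nonneg hs.le).1 hlt
  calc ∫⁻ x in Ω, ENNReal.ofReal (φ (2 * ‖f x‖))
      ≤ ∫⁻ x in Ω, ENNReal.ofReal (2 * s) * ENNReal.ofReal (φ ‖‖f x‖ / s‖) := by
        refine lintegral_mono fun x => ?_
        rw [← ENNReal.ofReal_mul (by positivity)]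
        refine ENNReal.ofReal_le_ofReal ?_
        rw [Real.norm_of_nonneg (by positivity)]
        have := hφ.map_mul_le (s := 2 * s) (t := ‖f x‖ / s) (by positivity) (by linarith) (by positivity)
        rwa [mul_assoc, mul_div_cancel₀ _ hs.ne'] at this
    _ = ENNReal.ofReal (2 * s) * modular φ Ω (fun x => ‖f x‖ / s) :=
        lintegral_const_mul' _ _ ENNReal.ofReal_ne_top
    _ ≤ ENNReal.ofReal (2 * s) * 1 := by gcongr
    _ ≤ ENNReal.ofReal ε := by
        rw [mul_one]
        exact ENNReal.ofReal_le_ofReal (by linarith)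

lemma exists_isTestFunction_approx {φ : ℝ → ℝ} (hφ : IsNFunction φ) {Ω : Set (Eucl n)} (hΩ : IsOpen Ω)
    {k : ℕ} {q : Eucl n → Eucl N} (hq : MemOrliczSobolevZero φ Ω k q) {ε : ℝ} (hε : 0 < ε) (hε1 : ε ≤ 1) :
    ∃ ψ : Eucl n → Eucl N, IsTestFunction Ω ψ ∧ ∀ j ≤ k, ∫⁻ x in Ω, ENNReal.ofReal
      (φ (2 * ‖weakGrad Ω j q x - tensorOf n N j (iteratedFDeriv ℝ j ψ x)‖)) ≤ ENNReal.ofReal ε := by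
  obtain ⟨ψ, hψ, hlt⟩ := hq.2 (ENNReal.ofReal (ε / 2)) (by simpa using hε)
  refine ⟨ψ, hψ, fun j hj => ?_⟩
  have h1 : luxemburgNorm φ Ω (weakGrad Ω j (q - ψ)) < ENNReal.ofReal (ε / 2) :=
    lt_of_le_of_lt (Finset.single_le_sum (f := fun j => luxemburgNorm φ Ω (weakGrad Ω j (q - ψ)))
      (fun _ _ => zero_le) (Finset.mem_range.2 (Nat.lt_succ_of_le hj))) hlt
  refine le_trans (le_of_eq ?_) (lintegral_le_of_luxemburgNorm_lt hφ hε1 h1)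
  refine lintegral_congr_ae ?_
  filter_upwards [weakGrad_sub_ae_eq hΩ (hq.1 j hj).1 (hψ.1.of_le (by exact_mod_cast le_top))] with x hx
  rw [hx]

lemma ae_tendsto_zero_of_tsum_lintegral_ne_top {X : Type*} [MeasurableSpace X] {μ : Measure X}
    {f : ℕ → X → ℝ≥0∞} (hf : ∀ m, AEMeasurable (f m) μ) (h : ∑' m, ∫⁻ x, f m x ∂μ ≠ ⊤) :
    ∀ᵐ x ∂μ, Tendsto (fun m => f m x) atTop (𝓝 0) := by
  rw [← lintegral_tsum hf] at h
  filter_upwards [ae_lt_top' (AEMeasurable.tsum hf) h] with x hx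
  exact ENNReal.tendsto_atTop_zero_of_tsum_ne_top hx.ne

lemma aemeasurable_ofReal_comp {φ : ℝ → ℝ} (hφ : IsNFunction φ) {X : Type*} [MeasurableSpace X]
    {μ : Measure X} {F : Type*} [NormedAddCommGroup F] {f : X → F} (hf : AEStronglyMeasurable f μ)
    {c : ℝ} (hc : 0 ≤ c) : AEMeasurable (fun x => ENNReal.ofReal (φ (c * ‖f x‖))) μ :=
  (hφ.measurable_comp (hf.norm.aemeasurable.const_mul c) fun _ =>
    mul_nonneg hc (norm_nonneg _)).ennreal_ofReal

end LipTrunc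

end

noncomputable section

namespace LipTrunc

variable {n N : ℕ}

/-! ### Truncation of Orlicz–Sobolev functions -/

/-- The differences of consecutive terms of a sequence. -/
def increments (ψ : ℕ → Eucl n → Eucl N) : ℕ → Eucl n → Eucl N
  | 0 => ψ 0
  | m + 1 => ψ (m + 1) - ψ m

lemma isTestFunction_increments {Ω : Set (Eucl n)} {ψ : ℕ → Eucl n → Eucl N}
    (hψ : ∀ m, IsTestFunction Ω (ψ m)) (m : ℕ) : IsTestFunction Ω (increments ψ m) := by
  cases m with
  | zero => exact hψ 0
  | succ m =>
    refine ⟨(hψ (m + 1)).1.sub (hψ m).1, (hψ (m + 1)).2.1.sub (hψ m).2.1, ?_⟩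
    exact (tsupport_sub _ _).trans (union_subset (hψ (m + 1)).2.2 (hψ m).2.2)

lemma iteratedFDeriv_increments_succ {ψ : ℕ → Eucl n → Eucl N} (hψ : ∀ m, ContDiff ℝ ∞ (ψ m)) (j m : ℕ)
    (x : Eucl n) : iteratedFDeriv ℝ j (increments ψ (m + 1)) x =
      iteratedFDeriv ℝ j (ψ (m + 1)) x - iteratedFDeriv ℝ j (ψ m) x :=
  iteratedFDeriv_sub_apply ((hψ (m + 1)).of_le (by exact_mod_cast le_top)).contDiffAt
    ((hψ m).of_le (by exact_mod_cast le_top)).contDiffAt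

lemma sum_increments (ψ : ℕ → Eucl n → Eucl N) (M : ℕ) (x : Eucl n) :
    ∑ m ∈ Finset.range (M + 1), increments ψ m x = ψ M x := by
  induction M with
  | zero => simp [increments]
  | succ M ih => rw [Finset.sum_range_succ, ih]; simp [increments]

lemma sum_iteratedFDeriv_increments {ψ : ℕ → Eucl n → Eucl N} (hψ : ∀ m, ContDiff ℝ ∞ (ψ m)) (j M : ℕ)
    (x : Eucl n) : ∑ m ∈ Finset.range (M + 1), iteratedFDeriv ℝ j (increments ψ m) x =
      iteratedFDeriv ℝ j (ψ M) x := by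
  induction M with
  | zero => simp [increments]
  | succ M ih => rw [Finset.sum_range_succ, ih, iteratedFDeriv_increments_succ hψ, add_sub_cancel]

/-- Passes from the operator norm, used in the truncation of test functions, to the tensor norm of
the modular; the comparison factor `nᵏ` is absorbed by `p` doublings. -/
lemma lintegral_iteratedFDeriv_le {φ : ℝ → ℝ} (hφ : IsNFunction φ) (h2 : Delta2 φ) {Ω : Set (Eucl n)}
    (hΩ : MeasurableSet Ω) {k p : ℕ} (hp : (n : ℝ) ^ k ≤ 2 ^ p) {d : Eucl n → Eucl N}
    (hd : IsTestFunction Ω d) :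
    ∫⁻ x, ENNReal.ofReal (φ ‖iteratedFDeriv ℝ k d x‖) ≤ ENNReal.ofReal (delta2Const φ ^ p) *
      ∫⁻ x in Ω, ENNReal.ofReal (φ ‖tensorOf n N k (iteratedFDeriv ℝ k d x)‖) := by
  have h1 : ∫⁻ x, ENNReal.ofReal (φ ‖iteratedFDeriv ℝ k d x‖) =
      ∫⁻ x in Ω, ENNReal.ofReal (φ ‖iteratedFDeriv ℝ k d x‖) := by
    rw [← lintegral_indicator hΩ]
    refine lintegral_congr fun x => ?_
    by_cases hx : x ∈ Ω
    · rw [indicator_of_mem hx]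
    · rw [indicator_of_notMem hx, iteratedFDeriv_eq_zero_of_notMem hd hx, norm_zero, hφ.map_zero,
        ENNReal.ofReal_zero]
  have hΔ : 0 ≤ delta2Const φ := zero_le_one.trans (IsNFunction.one_le_delta2Const h2)
  rw [h1, ← lintegral_const_mul' _ _ ENNReal.ofReal_ne_top]
  refine lintegral_mono fun x => ?_
  rw [← ENNReal.ofReal_mul (by positivity)]
  refine ENNReal.ofReal_le_ofReal ?_
  exact (hφ.mono (norm_nonneg _) (norm_iteratedFDeriv_le_norm_tensorOf
    (hd.1.of_le (by exact_mod_cast le_top)) x)).trans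
    (hφ.map_mul_le_of_le_two_pow h2 (by positivity) (norm_nonneg _) hp)

/-- Truncation of an Orlicz–Sobolev function with zero boundary values, up to an error `δ` in the
size of the exceptional set `U`. -/
lemma exists_truncation_with_error (hn : 1 ≤ n) {k : ℕ} {C : ℝ}
    (hC : ∀ (x₀ : Eucl n) (R : ℝ), 0 < R → ∀ u : Eucl n → Eucl N,
      IsTestFunction (Metric.ball x₀ R) u → ∀ l : ℝ, 0 < l →
      ∃ v : Eucl n → Eucl N, IsTestFunction (Metric.ball x₀ R) v ∧
        (∀ x, ‖iteratedFDeriv ℝ k v x‖ ≤ C * l) ∧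
        ∀ x ∈ goodSet k u l, v x = u x ∧ iteratedFDeriv ℝ k v x = iteratedFDeriv ℝ k u x)
    {p : ℕ} (hp : (n : ℝ) ^ k ≤ 2 ^ p) {φ : ℝ → ℝ} (hφ : IsNFunction φ) (h2 : Delta2 φ)
    {x₀ : Eucl n} {R : ℝ} (hR : 0 < R) {q : Eucl n → Eucl N}
    (hq : MemOrliczSobolevZero φ (Metric.ball x₀ R) k q) {l : ℝ} (hl : 0 < l) {δ : ℝ} (hδ : 0 < δ)
    (hδ1 : δ ≤ 1) :
    ∃ (w : Eucl n → Eucl N) (U : Set (Eucl n)), MemSobolevInftyZero (Metric.ball x₀ R) k w ∧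
      ContDiff ℝ k w ∧ (∀ j ≤ k, ∀ x, ‖iteratedFDeriv ℝ j w x‖ ≤ (2 * R) ^ (k - j) * (2 * (C * l))) ∧
      ENNReal.ofReal (φ l) * volume U ≤ 5 ^ n * ENNReal.ofReal (delta2Const φ ^ p) *
        (ENNReal.ofReal (delta2Const φ) *
          modular φ (Metric.ball x₀ R) (weakGrad (Metric.ball x₀ R) k q) + ENNReal.ofReal (2 * δ)) ∧
      ∀ᵐ x ∂(volume.restrict (Metric.ball x₀ R)), x ∉ U → q x = w x ∧
        weakGrad (Metric.ball x₀ R) k q x = tensorOf n N k (iteratedFDeriv ℝ k w x) := by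
  set Ω := Metric.ball x₀ R with hΩ
  have hΩo : IsOpen Ω := Metric.isOpen_ball
  set Δ := delta2Const φ with hΔ
  have hΔ1 : 1 ≤ Δ := IsNFunction.one_le_delta2Const h2
  -- The powers of `Δ⁻¹` compensate the loss from truncating at level `l 2⁻ᵐ`; the powers of `1/4`
  -- leave a convergent series of total size at most `δ`.
  set ε : ℕ → ℝ := fun m => δ * (4 * Δ)⁻¹ ^ (m + 1) with hε
  have h4Δ : (4 * Δ)⁻¹ ≤ 1 / 4 := by
    rw [inv_le_comm₀ (by positivity) (by norm_num)]
    norm_num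
    exact hΔ1
  have hε0 : ∀ m, 0 < ε m := fun m => by positivity
  have hεle : ∀ m, ε m ≤ δ * (1 / 4) ^ (m + 1) := fun m => by
    simp only [hε]
    gcongr
  have hε1 : ∀ m, ε m ≤ 1 := fun m => (hεle m).trans
    (mul_le_one₀ hδ1 (by positivity) (pow_le_one₀ (by norm_num) (by norm_num)))
  choose ψ hψ hψe using fun m => exists_isTestFunction_approx hφ hΩo hq (hε0 m) (hε1 m)
  have hψs : ∀ m, ContDiff ℝ ∞ (ψ m) := fun m => (hψ m).1
  set d := increments ψ with hd
  have hdt : ∀ m, IsTestFunction Ω (d m) := isTestFunction_increments hψ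
  have hlm : ∀ m : ℕ, 0 < l * (1 / 2) ^ m := fun m => by positivity
  choose T hT hTb hTg using fun m : ℕ => hC x₀ R hR (d m) (hdt m) (l * (1 / 2) ^ m) (hlm m)
  have hser : GeometricSeries x₀ R k (C * l) T := ⟨hT, fun m x => (hTb m x).trans_eq (by ring)⟩
  set W : (j : ℕ) → Eucl n → SymTensor n N j := fun j => weakGrad Ω j q with hW
  have hWm : ∀ j ≤ k, AEStronglyMeasurable (W j) (volume.restrict Ω) := fun j hj =>
    (hq.1 j hj).2.1.aestronglyMeasurable
  have hDm : ∀ j m, Continuous fun x => tensorOf n N j (iteratedFDeriv ℝ j (ψ m) x) := fun j m =>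
    (tensorOf n N j).continuous.comp
      ((hψs m).continuous_iteratedFDeriv (by exact_mod_cast le_top))
  have hdiffm : ∀ j ≤ k, ∀ m, AEMeasurable (fun x => ENNReal.ofReal
      (φ (2 * ‖W j x - tensorOf n N j (iteratedFDeriv ℝ j (ψ m) x)‖))) (volume.restrict Ω) :=
    fun j hj m => aemeasurable_ofReal_comp hφ ((hWm j hj).sub (hDm j m).aestronglyMeasurable) two_pos.le
  -- convergence almost everywhere
  have hconv : ∀ j ≤ k, ∀ᵐ x ∂(volume.restrict Ω),
      Tendsto (fun m => tensorOf n N j (iteratedFDeriv ℝ j (ψ m) x)) atTop (𝓝 (W j x)) := by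
    intro j hj
    have hsum : ∑' m, ∫⁻ x in Ω, ENNReal.ofReal
        (φ (2 * ‖W j x - tensorOf n N j (iteratedFDeriv ℝ j (ψ m) x)‖)) ≠ ⊤ := by
      refine ne_top_of_le_ne_top ?_ (ENNReal.tsum_le_tsum fun m => hψe m j hj)
      have hs : Summable ε := by
        refine Summable.of_nonneg_of_le (fun m => (hε0 m).le) hεle ?_
        refine Summable.mul_left _ ((summable_nat_add_iff 1).2 ?_)
        exact summable_geometric_of_lt_one (by norm_num) (by norm_num)
      rw [← ENNReal.ofReal_tsum_of_nonneg (fun m => (hε0 m).le) hs]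
      exact ENNReal.ofReal_ne_top
    filter_upwards [ae_tendsto_zero_of_tsum_lintegral_ne_top (hdiffm j hj) hsum] with x hx
    have h1 : Tendsto (fun m => φ (2 * ‖W j x - tensorOf n N j (iteratedFDeriv ℝ j (ψ m) x)‖)) atTop
        (𝓝 0) := by
      have := (ENNReal.tendsto_toReal ENNReal.zero_ne_top).comp hx
      refine this.congr fun m => ?_
      exact ENNReal.toReal_ofReal (hφ.nonneg _ (by positivity))
    have h3 := (hφ.tendsto_zero_of_comp (fun m => by positivity) h1).const_mul (1 / 2)
    rw [tendsto_iff_norm_sub_tendsto_zero]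
    refine (h3.congr fun m => ?_).trans (by simp)
    rw [norm_sub_rev]
    ring
  refine ⟨fun x => ∑' m, T m x, ⋃ m, (goodSet k (d m) (l * (1 / 2) ^ m))ᶜ,
    hser.memSobolevInftyZero hn hR, hser.contDiff hn hR,
    fun j hj x => hser.norm_iteratedFDeriv_le hn hR hj x, ?_, ?_⟩
  · -- the size of the exceptional set
    set I : ℕ → ℝ≥0∞ := fun m =>
      ∫⁻ x in Ω, ENNReal.ofReal (φ ‖tensorOf n N k (iteratedFDeriv ℝ k (d m) x)‖) with hI
    -- The zeroth increment is `ψ 0` itself; it alone carries the modular of `∇ᵏq`, all others being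
    -- errors.
    have hI0 : I 0 ≤ ENNReal.ofReal Δ * modular φ Ω (W k) + ENNReal.ofReal δ := by
      calc I 0 ≤ ∫⁻ x in Ω, (ENNReal.ofReal
            (φ (2 * ‖W k x - tensorOf n N k (iteratedFDeriv ℝ k (ψ 0) x)‖)) +
            ENNReal.ofReal Δ * ENNReal.ofReal (φ ‖W k x‖)) := by
            refine lintegral_mono fun x => ?_
            rw [← ENNReal.ofReal_mul (by positivity), ← ENNReal.ofReal_add
              (hφ.nonneg _ (by positivity)) (mul_nonneg (by positivity) (hφ.nonneg _ (norm_nonneg _)))]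
            refine ENNReal.ofReal_le_ofReal ?_
            have htri : ‖tensorOf n N k (iteratedFDeriv ℝ k (ψ 0) x)‖ ≤
                ‖W k x - tensorOf n N k (iteratedFDeriv ℝ k (ψ 0) x)‖ + ‖W k x‖ := by
              rw [norm_sub_rev]
              simpa using norm_add_le (tensorOf n N k (iteratedFDeriv ℝ k (ψ 0) x) - W k x) (W k x)
            exact (hφ.mono (norm_nonneg _) htri).trans ((hφ.map_add_le (norm_nonneg _)
              (norm_nonneg _)).trans (add_le_add le_rfl (hφ.map_two_mul_le h2 (norm_nonneg _))))
        _ = (∫⁻ x in Ω, ENNReal.ofReal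
            (φ (2 * ‖W k x - tensorOf n N k (iteratedFDeriv ℝ k (ψ 0) x)‖))) +
            ENNReal.ofReal Δ * modular φ Ω (W k) := by
            rw [lintegral_add_left' (hdiffm k le_rfl 0), lintegral_const_mul' _ _ ENNReal.ofReal_ne_top]
            rfl
        _ ≤ ENNReal.ofReal δ + ENNReal.ofReal Δ * modular φ Ω (W k) := by
            gcongr
            refine (hψe 0 k le_rfl).trans (ENNReal.ofReal_le_ofReal ((hεle 0).trans ?_))
            norm_num
            linarith
        _ = _ := add_comm _ _
    have hIs : ∀ m, I (m + 1) ≤ ENNReal.ofReal (2 * ε m) := by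
      intro m
      calc I (m + 1) ≤ ∫⁻ x in Ω, (ENNReal.ofReal
            (φ (2 * ‖W k x - tensorOf n N k (iteratedFDeriv ℝ k (ψ (m + 1)) x)‖)) +
            ENNReal.ofReal (φ (2 * ‖W k x - tensorOf n N k (iteratedFDeriv ℝ k (ψ m) x)‖))) := by
            refine lintegral_mono fun x => ?_
            rw [← ENNReal.ofReal_add (hφ.nonneg _ (by positivity)) (hφ.nonneg _ (by positivity))]
            refine ENNReal.ofReal_le_ofReal ?_
            rw [hd, iteratedFDeriv_increments_succ hψs, map_sub]
            refine (hφ.mono (norm_nonneg _) ?_).trans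
              (hφ.map_add_le (norm_nonneg _) (norm_nonneg _))
            rw [norm_sub_rev (W k x) (tensorOf n N k (iteratedFDeriv ℝ k (ψ (m + 1)) x))]
            refine le_trans (le_of_eq ?_) (norm_add_le _ _)
            rw [sub_add_sub_cancel]
        _ = (∫⁻ x in Ω, ENNReal.ofReal
              (φ (2 * ‖W k x - tensorOf n N k (iteratedFDeriv ℝ k (ψ (m + 1)) x)‖))) +
            ∫⁻ x in Ω, ENNReal.ofReal
              (φ (2 * ‖W k x - tensorOf n N k (iteratedFDeriv ℝ k (ψ m) x)‖)) :=
            lintegral_add_left' (hdiffm k le_rfl (m + 1)) _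
        _ ≤ ENNReal.ofReal (ε (m + 1)) + ENNReal.ofReal (ε m) :=
            add_le_add (hψe (m + 1) k le_rfl) (hψe m k le_rfl)
        _ ≤ ENNReal.ofReal (2 * ε m) := by
            rw [← ENNReal.ofReal_add (hε0 _).le (hε0 _).le]
            refine ENNReal.ofReal_le_ofReal ?_
            have : ε (m + 1) ≤ ε m := by
              simp only [hε]
              refine mul_le_mul_of_nonneg_left ?_ hδ.le
              exact pow_le_pow_of_le_one (by positivity) (h4Δ.trans (by norm_num)) (Nat.le_succ _)
            linarith
    have hU : ∀ m, ENNReal.ofReal (φ l) * volume (goodSet k (d m) (l * (1 / 2) ^ m))ᶜ ≤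
        5 ^ n * ENNReal.ofReal (Δ ^ p) * (ENNReal.ofReal (Δ ^ m) * I m) := by
      intro m
      have h1 : φ l ≤ Δ ^ m * φ (l * (1 / 2) ^ m) := by
        have := hφ.map_two_pow_mul_le h2 (hlm m).le m
        have e : (2 : ℝ) ^ m * (l * (1 / 2) ^ m) = l := by
          rw [mul_left_comm, ← mul_pow]; norm_num
        rwa [e] at this
      calc _ ≤ ENNReal.ofReal (Δ ^ m * φ (l * (1 / 2) ^ m)) *
            volume (goodSet k (d m) (l * (1 / 2) ^ m))ᶜ := by
            gcongr
        _ = ENNReal.ofReal (Δ ^ m) * (ENNReal.ofReal (φ (l * (1 / 2) ^ m)) *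
            volume (goodSet k (d m) (l * (1 / 2) ^ m))ᶜ) := by
            rw [ENNReal.ofReal_mul (by positivity), mul_assoc]
        _ ≤ ENNReal.ofReal (Δ ^ m) * (5 ^ n * (ENNReal.ofReal (Δ ^ p) * I m)) := by
            refine mul_le_mul_right ?_ _
            refine (ofReal_mul_volume_goodSet_compl_le hn hφ (hdt m).1 (hdt m).2.1 (hlm m)).trans ?_
            refine mul_le_mul_right ?_ _
            exact lintegral_iteratedFDeriv_le hφ h2 hΩo.measurableSet hp (hdt m)
        _ = _ := by ring
    have htail : ∑' m, ENNReal.ofReal (Δ ^ (m + 1)) * I (m + 1) ≤ ENNReal.ofReal δ := by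
      have hb : ∀ m, ENNReal.ofReal (Δ ^ (m + 1)) * I (m + 1) ≤
          ENNReal.ofReal (δ / 2 * (1 / 2) ^ m) := by
        intro m
        refine (mul_le_mul_right (hIs m) _).trans ?_
        rw [← ENNReal.ofReal_mul (by positivity)]
        refine ENNReal.ofReal_le_ofReal ?_
        have e : Δ ^ (m + 1) * (2 * ε m) = δ / 2 * (1 / 4) ^ m := by
          simp only [hε]
          rw [mul_inv, mul_pow, inv_pow Δ]
          field_simp
          rw [pow_succ]
          norm_num
          ring
        rw [e]
        gcongr
        norm_num
      refine (ENNReal.tsum_le_tsum hb).trans_eq ?_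
      rw [← ENNReal.ofReal_tsum_of_nonneg (fun m => by positivity)
        (summable_geometric_two.mul_left _), tsum_mul_left, tsum_geometric_two]
      congr 1
      ring
    calc ENNReal.ofReal (φ l) * volume (⋃ m, (goodSet k (d m) (l * (1 / 2) ^ m))ᶜ)
        ≤ ENNReal.ofReal (φ l) * ∑' m, volume (goodSet k (d m) (l * (1 / 2) ^ m))ᶜ := by
          gcongr
          exact measure_iUnion_le _
      _ = ∑' m, ENNReal.ofReal (φ l) * volume (goodSet k (d m) (l * (1 / 2) ^ m))ᶜ :=
          ENNReal.tsum_mul_left.symm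
      _ ≤ ∑' m, 5 ^ n * ENNReal.ofReal (Δ ^ p) * (ENNReal.ofReal (Δ ^ m) * I m) :=
          ENNReal.tsum_le_tsum hU
      _ = 5 ^ n * ENNReal.ofReal (Δ ^ p) * ∑' m, ENNReal.ofReal (Δ ^ m) * I m :=
          ENNReal.tsum_mul_left
      _ ≤ _ := by
          gcongr
          rw [tsum_eq_zero_add' ENNReal.summable, pow_zero, ENNReal.ofReal_one, one_mul]
          refine (add_le_add hI0 htail).trans_eq ?_
          rw [add_assoc, ← ENNReal.ofReal_add hδ.le hδ.le, two_mul]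
  · -- agreement off the exceptional set
    filter_upwards [hconv k le_rfl, hconv 0 (Nat.zero_le k),
      weakGrad_zero_ae_eq hΩo (hq.1 0 (Nat.zero_le k)).1] with x hx hx0 hxq hxU
    -- Off the union every truncated increment equals the original one, so the partial sums
    -- telescope to `ψ M`, which converges to `q`, and likewise for the `k`-th derivatives.
    have hgood : ∀ m, x ∈ goodSet k (d m) (l * (1 / 2) ^ m) := fun m => by
      by_contra h
      exact hxU (mem_iUnion.2 ⟨m, h⟩)
    constructor
    · have h1 : Tendsto (fun M => ψ M x) atTop (𝓝 (q x)) := by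
        have hcoord : Continuous fun z : SymTensor n N 0 => z (zeroIndex n) := by fun_prop
        have := (hcoord.tendsto _).comp hx0
        rw [← hxq]
        refine this.congr fun m => ?_
        simp [tensorOf_apply]
      have h3 := ((hser.summable_apply hn hR x).hasSum.tendsto_sum_nat).comp (tendsto_add_atTop_nat 1)
      refine tendsto_nhds_unique h1 (h3.congr fun M => ?_)
      rw [Function.comp_apply, Finset.sum_congr rfl fun m _ => (hTg m x (hgood m)).1]
      exact sum_increments ψ M x
    · rw [hser.iteratedFDeriv_eq hn hR le_rfl]
      have h3 := ((hser.summable hn hR le_rfl x).hasSum.tendsto_sum_nat).comp (tendsto_add_atTop_nat 1)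
      have h4 := ((tensorOf n N k).continuous.tendsto _).comp h3
      refine tendsto_nhds_unique hx (h4.congr fun M => ?_)
      rw [Function.comp_apply, Function.comp_apply,
        Finset.sum_congr rfl fun m _ => (hTg m x (hgood m)).2]
      rw [hd, sum_iteratedFDeriv_increments hψs]

end LipTrunc

end

/-! ### Exceptional sets, vanishing functions and the final estimate -/

noncomputable section

namespace LipTrunc

variable {n N : ℕ}

lemma volume_ne_le {x₀ : Eucl n} {R : ℝ} {q w : Eucl n → Eucl N} {U : Set (Eucl n)}
    (h : ∀ᵐ x ∂(volume.restrict (Metric.ball x₀ R)), x ∉ U → q x = w x) :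
    volume {x | x ∈ Metric.ball x₀ R ∧ q x ≠ w x} ≤ volume U := by
  refine measure_mono_ae ?_
  filter_upwards [(ae_restrict_iff' Metric.isOpen_ball.measurableSet).1 h] with x hx hmem
  by_contra hU
  exact hmem.2 (hx hmem.1 hU)

lemma memSobolevInftyZero_zero (x₀ : Eucl n) (R : ℝ) (k : ℕ) :
    MemSobolevInftyZero (Metric.ball x₀ R) k (0 : Eucl n → Eucl N) := by
  have hb : ∀ j ≤ k, ∀ x, ‖iteratedFDeriv ℝ j (0 : Eucl n → Eucl N) x‖ ≤ (fun _ => (0 : ℝ)) j := by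
    intro j _ x
    rw [show (0 : Eucl n → Eucl N) = fun _ => 0 from rfl, iteratedFDeriv_fun_zero]
    simp
  have hmem := fun p => memSobolev_of_contDiff (x₀ := x₀) (R := R) (contDiff_const (c := 0)) hb p
  refine ⟨hmem ⊤, hmem 1, fun ε hε => ⟨0, ⟨contDiff_const, HasCompactSupport.zero, by simp⟩, ?_⟩⟩
  rw [sub_zero]
  refine lt_of_le_of_lt (sobolevNorm_one_le (contDiff_const (c := 0)) hb) ?_
  simpa using hε

lemma weakGrad_zero_fun_ae_eq (x₀ : Eucl n) (R : ℝ) (k : ℕ) :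
    weakGrad (Metric.ball x₀ R) k (0 : Eucl n → Eucl N) =ᵐ[volume.restrict (Metric.ball x₀ R)]
      fun _ => 0 := by
  filter_upwards [weakGrad_ae_eq_of_contDiff (u := (0 : Eucl n → Eucl N)) (j := k)
    (Metric.isOpen_ball (x := x₀) (ε := R)) contDiff_const] with x hx
  rw [hx, show (0 : Eucl n → Eucl N) = fun _ => 0 from rfl, iteratedFDeriv_fun_zero, Pi.zero_apply,
    map_zero]

/-- A function that agrees with functions of arbitrarily small size off sets of arbitrarily small
measure vanishes almost everywhere. -/
lemma ae_eq_zero_of_small {x₀ : Eucl n} {R : ℝ} {q : Eucl n → Eucl N} {K : ℝ}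
    (h : ∀ l : ℝ, 0 < l → ∀ δ : ℝ≥0∞, 0 < δ → ∃ (w : Eucl n → Eucl N) (U : Set (Eucl n)),
      (∀ x, ‖w x‖ ≤ K * l) ∧ volume U ≤ δ ∧
        ∀ᵐ x ∂(volume.restrict (Metric.ball x₀ R)), x ∉ U → q x = w x) :
    ∀ᵐ x ∂(volume.restrict (Metric.ball x₀ R)), q x = 0 := by
  have h1 : ∀ l : ℝ, 0 < l → ∀ᵐ x ∂(volume.restrict (Metric.ball x₀ R)), ‖q x‖ ≤ K * l := by
    intro l hl
    rw [ae_iff]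
    refine le_antisymm (le_of_forall_pos_le_add fun δ hδ => ?_) zero_le
    obtain ⟨w, U, hw, hU, hae⟩ := h l hl δ hδ
    rw [zero_add]
    refine le_trans (measure_mono_ae (t := U) ?_) ((Measure.restrict_apply_le _ _).trans hU)
    filter_upwards [hae] with x hx hmem
    by_contra hxU
    refine hmem ?_
    rw [hx hxU]
    exact hw x
  have h2 : ∀ᵐ x ∂(volume.restrict (Metric.ball x₀ R)), ∀ i : ℕ, ‖q x‖ ≤ K * (1 / ((i : ℝ) + 1)) :=
    ae_all_iff.2 fun i => h1 _ (by positivity)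
  filter_upwards [h2] with x hx
  have hlim := tendsto_one_div_add_atTop_nhds_zero_nat (𝕜 := ℝ) |>.const_mul K
  rw [mul_zero] at hlim
  exact norm_le_zero_iff.1 (ge_of_tendsto' hlim hx)

/-- The modular of a truncation is controlled by the modular of the original function and the measure
of the exceptional set. -/
lemma lintegral_le_add_of_eq_off {φ : ℝ → ℝ} (hφ : IsNFunction φ) {Ω : Set (Eucl n)}
    {F : Type} [NormedAddCommGroup F] {V W : Eucl n → F} {U : Set (Eucl n)} {c : ℝ}
    (hb : ∀ᵐ x ∂(volume.restrict Ω), ‖V x‖ ≤ c)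
    (he : ∀ᵐ x ∂(volume.restrict Ω), x ∉ U → W x = V x) :
    modular φ Ω V ≤ modular φ Ω W + ENNReal.ofReal (φ c) * volume U := by
  -- `U` need not be measurable; its measurable hull has the same measure.
  set U' := toMeasurable volume U with hU'
  have hm : MeasurableSet U' := measurableSet_toMeasurable _ _
  calc modular φ Ω V ≤ ∫⁻ x in Ω, (ENNReal.ofReal (φ ‖W x‖) +
        U'.indicator (fun _ => ENNReal.ofReal (φ c)) x) := by
        refine lintegral_mono_ae ?_
        filter_upwards [hb, he] with x hx1 hx2
        by_cases hxU : x ∈ U'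
        · rw [indicator_of_mem hxU]
          exact le_add_left (ENNReal.ofReal_le_ofReal (hφ.mono (norm_nonneg _) hx1))
        · rw [hx2 fun h => hxU (subset_toMeasurable _ _ h)]
          exact le_self_add
    _ = modular φ Ω W + ∫⁻ x in Ω, U'.indicator (fun _ => ENNReal.ofReal (φ c)) x :=
        lintegral_add_right _ (measurable_const.indicator hm)
    _ ≤ modular φ Ω W + ENNReal.ofReal (φ c) * volume U := by
        gcongr
        rw [lintegral_indicator_const hm, hU', ← measure_toMeasurable (μ := volume) U]
        gcongr
        exact Measure.restrict_le_self

end LipTrunc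

end

theorem mainTheorem4 (n N k : ℕ) (hn : 1 ≤ n) (hN : 1 ≤ N) (hk : 1 ≤ k) :
    ∃ (C₁ : ℝ) (C₂ : ℝ → ℝ → ℝ), ∀ φ : ℝ → ℝ,
      LipTrunc.IsNFunction φ → LipTrunc.Delta2 φ → LipTrunc.Nabla2 φ →
      ∀ (x₀ : LipTrunc.Eucl n) (R : ℝ), 0 < R →
      ∀ q : LipTrunc.Eucl n → LipTrunc.Eucl N,
        LipTrunc.MemOrliczSobolevZero φ (Metric.ball x₀ R) k q →
      ∀ l : ℝ, 0 < l →
      ∃ ql : LipTrunc.Eucl n → LipTrunc.Eucl N,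
        LipTrunc.MemSobolevInftyZero (Metric.ball x₀ R) k ql ∧
        eLpNorm (LipTrunc.weakGrad (Metric.ball x₀ R) k ql) ⊤
            (volume.restrict (Metric.ball x₀ R)) ≤ ENNReal.ofReal (C₁ * l) ∧
        LipTrunc.modular φ (Metric.ball x₀ R) (LipTrunc.weakGrad (Metric.ball x₀ R) k ql) ≤
          ENNReal.ofReal (C₂ (LipTrunc.delta2Const φ) (LipTrunc.nabla2Const φ)) *
            LipTrunc.modular φ (Metric.ball x₀ R) (LipTrunc.weakGrad (Metric.ball x₀ R) k q) ∧
        ENNReal.ofReal (φ l) * volume {x | x ∈ Metric.ball x₀ R ∧ q x ≠ ql x} ≤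
          ENNReal.ofReal (C₂ (LipTrunc.delta2Const φ) (LipTrunc.nabla2Const φ)) *
            LipTrunc.modular φ (Metric.ball x₀ R)
              (LipTrunc.weakGrad (Metric.ball x₀ R) k q) := by
  obtain ⟨C, hC1, HC⟩ := LipTrunc.exists_smooth_truncation n k hk
  have hC := HC (LipTrunc.Eucl N)
  obtain ⟨p, hp⟩ := pow_unbounded_of_one_lt ((n : ℝ) ^ k) (one_lt_two (α := ℝ))
  set C₁ : ℝ := ‖LipTrunc.tensorOf n N k‖ * (2 * C) with hC₁
  have hC₁0 : 0 ≤ C₁ := mul_nonneg (ContinuousLinearMap.opNorm_nonneg _) (by linarith)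
  obtain ⟨p₁, hp₁⟩ := pow_unbounded_of_one_lt C₁ (one_lt_two (α := ℝ))
  -- The `1` is the part off the exceptional set, `Δ ^ p₁` comes from `φ(C₁ l) ≤ Δ ^ p₁ φ(l)`, and
  -- `3Δ` is `Δ` from the modular plus `2Δ` from the absorbed error.
  refine ⟨C₁, fun Δ _ => 1 + Δ ^ p₁ * (5 ^ n * Δ ^ p * (3 * Δ)), ?_⟩
  intro φ hφ h2 _ x₀ R hR q hq l hl
  set Ω := Metric.ball x₀ R with hΩ
  set Δ := LipTrunc.delta2Const φ with hΔ
  have hΔ1 : 1 ≤ Δ := LipTrunc.IsNFunction.one_le_delta2Const h2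
  set A := LipTrunc.modular φ Ω (LipTrunc.weakGrad Ω k q) with hA
  have hAtop : A ≠ ⊤ := (hq.1 k le_rfl).2.2.ne
  have key := fun l (hl : 0 < l) δ hδ hδ1 => LipTrunc.exists_truncation_with_error hn hC hp.le hφ h2 hR hq
    (l := l) hl (δ := δ) hδ hδ1
  have h5 : (5 : ℝ≥0∞) ^ n = ENNReal.ofReal (5 ^ n) := by
    rw [ENNReal.ofReal_pow (by norm_num)]
    norm_num
  -- A positive error cannot be absorbed by a vanishing modular. In that case letting the error and
  -- the level tend to zero forces `q = 0` almost everywhere, and zero is the truncation.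
  by_cases hA0 : A = 0
  · have hq0 : ∀ᵐ x ∂(volume.restrict Ω), q x = 0 := by
      refine LipTrunc.ae_eq_zero_of_small (K := (2 * R) ^ k * (2 * C)) fun l hl δ hδ => ?_
      have hpos : ENNReal.ofReal (φ l) ≠ 0 := by simpa using hφ.pos hl
      have hlim : Filter.Tendsto (fun t : ℝ => (ENNReal.ofReal (φ l))⁻¹ *
          (5 ^ n * ENNReal.ofReal (Δ ^ p) * ENNReal.ofReal (2 * t))) (nhdsWithin 0 (Set.Ioi 0))
          (nhds ((ENNReal.ofReal (φ l))⁻¹ *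
          (5 ^ n * ENNReal.ofReal (Δ ^ p) * ENNReal.ofReal (2 * 0)))) := by
        refine ENNReal.Tendsto.const_mul (ENNReal.Tendsto.const_mul (ENNReal.tendsto_ofReal ?_)
          (Or.inr ?_)) (Or.inr (by simpa using hφ.pos hl))
        · exact ((continuous_const.mul continuous_id).tendsto 0).mono_left nhdsWithin_le_nhds
        · exact ENNReal.mul_ne_top (by rw [h5]; exact ENNReal.ofReal_ne_top) ENNReal.ofReal_ne_top
      rw [mul_zero, ENNReal.ofReal_zero, mul_zero, mul_zero] at hlim
      obtain ⟨t, ht, ht0, ht1⟩ := ((hlim.eventually (gt_mem_nhds hδ)).and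
        (Ioc_mem_nhdsGT (zero_lt_one (α := ℝ)))).exists
      obtain ⟨w, U, -, -, hwb, hU, hae⟩ := key l hl t ht0 ht1
      refine ⟨w, U, fun x => ?_, ?_, hae.mono fun x hx hxU => (hx hxU).1⟩
      · have := hwb 0 (Nat.zero_le k) x
        rw [norm_iteratedFDeriv_zero, Nat.sub_zero] at this
        linarith
      · refine le_trans ?_ ht.le
        rw [← hA, hA0, mul_zero, zero_add] at hU
        rwa [← ENNReal.div_eq_inv_mul, ENNReal.le_div_iff_mul_le (Or.inl hpos)
          (Or.inl ENNReal.ofReal_ne_top), mul_comm]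
    refine ⟨0, LipTrunc.memSobolevInftyZero_zero x₀ R k, ?_, ?_, ?_⟩
    · have h0 := eLpNorm_congr_ae (p := ⊤) (LipTrunc.weakGrad_zero_fun_ae_eq (N := N) x₀ R k)
      exact (h0.trans eLpNorm_zero).trans_le zero_le
    · rw [LipTrunc.modular, lintegral_congr_ae (g := fun _ => 0)]
      · simp
      · filter_upwards [LipTrunc.weakGrad_zero_fun_ae_eq (N := N) x₀ R k] with x hx
        rw [hx, norm_zero, hφ.map_zero, ENNReal.ofReal_zero]
    · have := LipTrunc.volume_ne_le (w := 0) (U := ∅) (hq0.mono fun x hx _ => hx)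
      rw [measure_empty, nonpos_iff_eq_zero] at this
      rw [this, mul_zero]
      exact zero_le
  · have hApos : 0 < A.toReal := ENNReal.toReal_pos hA0 hAtop
    -- With error at most `A`, the summand `2δ` is bounded by `2 Δ A`, since `Δ ≥ 1`.
    obtain ⟨w, U, hmem, hws, hwb, hU, hae⟩ := key l hl (min A.toReal 1) (lt_min hApos one_pos)
      (min_le_right _ _)
    have hU' : ENNReal.ofReal (φ l) * volume U ≤
        ENNReal.ofReal (5 ^ n * Δ ^ p * (3 * Δ)) * A := by
      refine hU.trans ?_
      have h1 : ENNReal.ofReal (2 * min A.toReal 1) ≤ ENNReal.ofReal (2 * Δ) * A := by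
        conv_rhs => rw [← ENNReal.ofReal_toReal hAtop]
        rw [← ENNReal.ofReal_mul (by positivity)]
        refine ENNReal.ofReal_le_ofReal ?_
        nlinarith [min_le_left A.toReal 1]
      calc _ ≤ 5 ^ n * ENNReal.ofReal (Δ ^ p) * (ENNReal.ofReal Δ * A + ENNReal.ofReal (2 * Δ) * A) := by
            gcongr
        _ = _ := by
            rw [← add_mul, ← ENNReal.ofReal_add (by positivity) (by positivity), h5,
              ← ENNReal.ofReal_mul (by positivity), ← mul_assoc, ← ENNReal.ofReal_mul (by positivity)]
            congr 2
            ring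
    have hbd : ∀ᵐ x ∂(volume.restrict Ω), ‖LipTrunc.weakGrad Ω k w x‖ ≤ C₁ * l := by
      filter_upwards [LipTrunc.weakGrad_ae_eq_of_contDiff Metric.isOpen_ball hws] with x hx
      rw [hx]
      refine (ContinuousLinearMap.le_opNorm _ _).trans ?_
      have := hwb k le_rfl x
      rw [Nat.sub_self, pow_zero, one_mul] at this
      calc _ ≤ ‖LipTrunc.tensorOf n N k‖ * (2 * (C * l)) := by gcongr
        _ = _ := by rw [hC₁]; ring
    have hK1 : 1 ≤ Δ ^ p₁ := one_le_pow₀ hΔ1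
    have hK0 : 0 ≤ 5 ^ n * Δ ^ p * (3 * Δ) := by positivity
    refine ⟨w, hmem, ?_, ?_, ?_⟩
    · rw [eLpNorm_exponent_top]
      exact eLpNormEssSup_le_of_ae_bound hbd
    · have heq : ∀ᵐ x ∂(volume.restrict Ω), x ∉ U →
          LipTrunc.weakGrad Ω k q x = LipTrunc.weakGrad Ω k w x := by
        filter_upwards [hae, LipTrunc.weakGrad_ae_eq_of_contDiff Metric.isOpen_ball hws]
          with x hx1 hx2 hxU
        rw [hx2, (hx1 hxU).2]
      refine (LipTrunc.lintegral_le_add_of_eq_off hφ hbd heq).trans ?_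
      have h3 : ENNReal.ofReal (φ (C₁ * l)) * volume U ≤
          ENNReal.ofReal (Δ ^ p₁ * (5 ^ n * Δ ^ p * (3 * Δ))) * A := by
        calc _ ≤ ENNReal.ofReal (Δ ^ p₁ * φ l) * volume U := by
              gcongr
              exact hφ.map_mul_le_of_le_two_pow h2 hC₁0 hl.le hp₁.le
          _ = ENNReal.ofReal (Δ ^ p₁) * (ENNReal.ofReal (φ l) * volume U) := by
              rw [ENNReal.ofReal_mul (by positivity), mul_assoc]
          _ ≤ ENNReal.ofReal (Δ ^ p₁) * (ENNReal.ofReal (5 ^ n * Δ ^ p * (3 * Δ)) * A) :=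
              mul_le_mul_right hU' _
          _ = _ := by rw [← mul_assoc, ← ENNReal.ofReal_mul (by positivity)]
      refine (add_le_add le_rfl h3).trans_eq ?_
      rw [ENNReal.ofReal_add zero_le_one (by positivity), ENNReal.ofReal_one, add_mul, one_mul]
    · refine (mul_le_mul_right (LipTrunc.volume_ne_le (hae.mono fun x hx hxU => (hx hxU).1)) _).trans
        (hU'.trans ?_)
      refine mul_le_mul_left (ENNReal.ofReal_le_ofReal ?_) _
      nlinarith
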